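/- Let $\mathbb{T}$ be the unit circle with normalized Lebesgue measure $m$ and let $L^0$ be the space of (classes of a.e. equal) measurable a.e. finite functions $f\colon\mathbb{T}\to\mathbb{C}$. A Banach function space is a complex Banach space $X\subset L^0$ such that (a) if $f\in X$, $g\in L^0$ and $|g|\le|f|$ a.e., then $g\in X$ and $\|g\|_X\le\|f\|_X$; (b) $L^\infty\subset X$; (c) if $f_n,f\in X$ and $0\le f_n\uparrow f$ a.e., then $\|f\|_X=\sup_n\|f_n\|_X$. It has the Fatou property if $f_n\in X$, $f\in L^0$, $0\le f_n\uparrow f$ a.e. and $\sup_n\|f_n\|_X<\infty$ imply $f\in X$ and $\|f\|_X=\sup_n\|f_n\|_X$. It is rearrangement invariant (r.i.) if $f\in X$, $g\in L^0$ and $m\{|f|>\lambda\}=m\{|g|>\lambda\}$ for all $\lambda\ge0$ imply $g\in X$ and $\|g\|_X=\|f\|_X$; an r.i. Banach function space is contained in $L^1$. For $s>0$ and $\theta\in[0,2\pi)$ let $(D_sf)(e^{i\theta})=f(e^{is\theta})$ if $s\theta\in[0,2\pi)$ and $0$ otherwise. The Boyd indices of $X$ are $$\alpha_X=\lim_{s\to0^+}\frac{\log\|D_{1/s}\|_{X\to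 X}}{\log s},\qquad \beta_X=\lim_{s\to\infty}\frac{\log\|D_{1/s}\|_{X\to X}}{\log s},$$ and they are called nontrivial if $\alpha_X,\beta_X\in(0,1)$. Let $\chi_n(t)=t^n$, $\langle f,g\rangle=\int_{\mathbb{T}}f\bar g\,dm$ and $\widehat f(n)=\langle f,\chi_n\rangle$. Let $H[X]=\{f\in X:\widehat f(n)=0\text{ for all }n<0\}$ with the norm of $X$. The space of pointwise multipliers is $M(X,Y)=\{a\in L^0: ag\in Y\text{ for all }g\in X\}$ with $\|a\|_{M(X,Y)}=\sup_{\|g\|_X\le1}\|ag\|_Y$. The Riesz projection $P$ sends $f$ to the function $Pf\in L^1$ with $\widehat{Pf}(n)=\widehat f(n)$ for $n\ge0$ and $\widehat{Pf}(n)=0$ for $n<0$, and the Toeplitz operator with symbol $a$ is $T_af=P(af)$. **Theorem (general Brown–Halmos theorem).** Let $X,Y$ be separable r.i. Banach function spaces on $\mathbb{T}$ with $X\subset Y$, and suppose that $Y$ has nontrivial Boyd indices and the Fatou property; then $P$ is a bounded operator on $Y$. Let $A\colon H[X]\to H[Y]$ be a continuous linear operator and $(a_n)_{n\in\mathbb{Z}}$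 a sequence of complex numbers. Then $$\langle A\chi_j,\chi_k\rangle=a_{k-j}\qquad\text{for all } j,k\ge0$$ if and only if there exists $a\in M(X,Y)$ such that $A=T_a$ and $\widehat a(n)=a_n$ for all $n\in\mathbb{Z}$. Moreover, for every $a\in M(X,Y)$ the operator $T_a\colon H[X]\to H[Y]$ is well defined and bounded, and $$\|a\|_{M(X,Y)}\le\|T_a\|_{H[X]\to H[Y]}\le\|P\|_{Y\to Y}\,\|a\|_{M(X,Y)}.$$ -/

import Mathlib

open MeasureTheory Filter Topology
open scoped ENNReal ComplexOrder ComplexConjugate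

noncomputable section

namespace BrownHalmos

instance factTwoPiPos : Fact (0 < 2 * Real.pi) := ⟨Real.two_pi_pos⟩

/-- The unit circle, parametrised by the angle `θ ∈ ℝ / 2πℤ`; the point is `t = e^{iθ}`. -/
abbrev 𝕋 : Type := AddCircle (2 * Real.pi)

/-- Normalised Lebesgue measure `|dt| / 2π` on the circle. -/
abbrev m : Measure 𝕋 := AddCircle.haarAddCircle

/-- Complex measurable functions on the circle modulo equality almost everywhere. -/
abbrev L0 : Type := 𝕋 →ₘ[m] ℂ

/-! ### Banach function spaces -/

/-- A normed space `X ⊆ L⁰`, encoded by its norm extended by `∞` outside of `X`;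
thus `X = {f | nrm f < ∞}`. -/
structure FunctionSpace where
  nrm : L0 → ℝ≥0∞
  nrm_add_le : ∀ f g, nrm (f + g) ≤ nrm f + nrm g
  nrm_smul : ∀ (c : ℂ) f, nrm (c • f) = ‖c‖ₑ * nrm f
  eq_zero_of_nrm : ∀ f, nrm f = 0 → f = 0

namespace FunctionSpace

variable (X Y : FunctionSpace)

theorem nrm_zero : X.nrm 0 = 0 := by
  have h := X.nrm_smul 0 0
  have h0 : (0 : ℂ) • (0 : L0) = 0 := zero_smul ℂ (0 : L0)
  rwa [h0, enorm_zero, zero_mul] at h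

/-- The underlying linear subspace of `L⁰`. -/
def space : Submodule ℂ L0 where
  carrier := {f | X.nrm f < ∞}
  add_mem' {f g} hf hg := (X.nrm_add_le f g).trans_lt (ENNReal.add_lt_top.2 ⟨hf, hg⟩)
  zero_mem' := by simp [X.nrm_zero]
  smul_mem' c f hf := by
    simpa [X.nrm_smul] using ENNReal.mul_lt_top enorm_lt_top hf

instance instNorm : Norm X.space := ⟨fun f => (X.nrm f).toReal⟩

theorem normedSpaceCore : NormedSpace.Core ℂ X.space where
  norm_nonneg _ := ENNReal.toReal_nonneg
  norm_smul c f := by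
    change (X.nrm (c • (f : L0))).toReal = ‖c‖ * (X.nrm f).toReal
    simp [X.nrm_smul, ENNReal.toReal_mul]
  norm_triangle f g := by
    have hf : X.nrm f < ∞ := f.2
    have hg : X.nrm g < ∞ := g.2
    change (X.nrm (f + g : L0)).toReal ≤ (X.nrm f).toReal + (X.nrm g).toReal
    rw [← ENNReal.toReal_add hf.ne hg.ne]
    exact ENNReal.toReal_mono (ENNReal.add_lt_top.2 ⟨hf, hg⟩).ne (X.nrm_add_le _ _)
  norm_eq_zero_iff f := by
    have hf : X.nrm f < ∞ := f.2
    change (X.nrm f).toReal = 0 ↔ f = 0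
    rw [ENNReal.toReal_eq_zero_iff]
    constructor
    · rintro (h | h)
      · exact Subtype.ext (X.eq_zero_of_nrm _ h)
      · exact absurd h hf.ne
    · rintro rfl
      exact Or.inl X.nrm_zero

instance instNormedAddCommGroup : NormedAddCommGroup X.space :=
  NormedAddCommGroup.ofCore X.normedSpaceCore

instance instNormedSpace : NormedSpace ℂ X.space :=
  NormedSpace.ofCore X.normedSpaceCore

end FunctionSpace

/-- `0 ≤ fₙ ↑ g` almost everywhere. -/
def IncreasesTo (f : ℕ → L0) (g : L0) : Prop :=
  ∀ᵐ t ∂m, (∀ n, 0 ≤ f n t) ∧ Monotone (fun n => f n t) ∧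
    Tendsto (fun n => f n t) atTop (𝓝 (g t))

/-- Banach function spaces: complete, with the ideal property, containing `L^∞`, and with the
semi-Fatou property. -/
structure IsBanachFunctionSpace (X : FunctionSpace) : Prop where
  complete : CompleteSpace X.space
  ideal : ∀ f g : L0, f ∈ X.space → (∀ᵐ t ∂m, ‖g t‖ ≤ ‖f t‖) →
    g ∈ X.space ∧ X.nrm g ≤ X.nrm f
  linfty_subset : ∀ f : L0, (∃ C : ℝ, ∀ᵐ t ∂m, ‖f t‖ ≤ C) → f ∈ X.space
  semiFatou : ∀ (f : ℕ → L0) (g : L0), (∀ n, f n ∈ X.space) → g ∈ X.space →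
    IncreasesTo f g → X.nrm g = ⨆ n, X.nrm (f n)

/-- The Fatou property. -/
def HasFatouProperty (X : FunctionSpace) : Prop :=
  ∀ (f : ℕ → L0) (g : L0), (∀ n, f n ∈ X.space) → IncreasesTo f g →
    (⨆ n, X.nrm (f n)) < ∞ → g ∈ X.space ∧ X.nrm g = ⨆ n, X.nrm (f n)

/-- The distribution function of `|f|`. -/
def distribution (f : L0) (r : ℝ) : ℝ≥0∞ := m {t | r < ‖f t‖}

def Equimeasurable (f g : L0) : Prop := ∀ r : ℝ, 0 ≤ r → distribution f r = distribution g r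

def IsRearrangementInvariant (X : FunctionSpace) : Prop :=
  ∀ f g : L0, Equimeasurable f g → f ∈ X.space → g ∈ X.space ∧ X.nrm f = X.nrm g

/-! ### Boyd indices -/

/-- The angle in `[0, 2π)` of a point of the circle. -/
def angle (t : 𝕋) : ℝ := AddCircle.equivIco (2 * Real.pi) 0 t

theorem measurable_angle : Measurable angle :=
  measurable_subtype_coe.comp (AddCircle.measurableEquivIco (2 * Real.pi) 0).measurable

open Classical in
/-- `(D_s f)(e^{iθ}) = f(e^{isθ})` if `sθ ∈ [0, 2π)`, and `0` otherwise (`θ ∈ [0, 2π)`). -/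
def dilationFun (s : ℝ) (f : 𝕋 → ℂ) (t : 𝕋) : ℂ :=
  if s * angle t ∈ Set.Ico 0 (2 * Real.pi) then f ((s * angle t : ℝ) : 𝕋) else 0

theorem measurable_dilationFun (s : ℝ) {f : 𝕋 → ℂ} (hf : Measurable f) :
    Measurable (dilationFun s f) := by
  have h : Measurable fun t : 𝕋 => s * angle t := measurable_angle.const_mul s
  exact Measurable.ite (h measurableSet_Ico)
    (hf.comp ((AddCircle.measurable_mk' (a := 2 * Real.pi)).comp h)) measurable_const

/-- The dilation operator `D_s`. -/
def dilation (s : ℝ) (f : L0) : L0 :=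
  AEEqFun.mk (dilationFun s f)
    (measurable_dilationFun s f.stronglyMeasurable.measurable).aestronglyMeasurable

/-- The operator norm of `D_s` on `X`. -/
def dilationNorm (X : FunctionSpace) (s : ℝ) : ℝ≥0∞ :=
  ⨆ (f : L0) (_ : X.nrm f ≤ 1), X.nrm (dilation s f)

def HasLowerBoydIndex (X : FunctionSpace) (α : ℝ) : Prop :=
  Tendsto (fun s : ℝ => Real.log (dilationNorm X (1 / s)).toReal / Real.log s) (𝓝[>] 0) (𝓝 α)

def HasUpperBoydIndex (X : FunctionSpace) (β : ℝ) : Prop :=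
  Tendsto (fun s : ℝ => Real.log (dilationNorm X (1 / s)).toReal / Real.log s) atTop (𝓝 β)

def HasNontrivialBoydIndices (X : FunctionSpace) : Prop :=
  ∃ α ∈ Set.Ioo (0 : ℝ) 1, ∃ β ∈ Set.Ioo (0 : ℝ) 1,
    HasLowerBoydIndex X α ∧ HasUpperBoydIndex X β

/-! ### Multipliers -/

/-- The pointwise multipliers from `X` to `Y`. -/
def multipliers (X Y : FunctionSpace) : Set L0 := {a | ∀ g ∈ X.space, a * g ∈ Y.space}

/-- The norm of the multiplier space `M(X, Y)`. -/
def multiplierNorm (X Y : FunctionSpace) (a : L0) : ℝ≥0∞ :=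
  ⨆ (g : L0) (_ : X.nrm g ≤ 1), Y.nrm (a * g)

/-! ### Fourier coefficients, Hardy spaces, Riesz projection, Toeplitz operators -/

/-- `⟨f, g⟩ = ∫ f ḡ dm`. -/
def pairing (f g : L0) : ℂ := ∫ t, f t * conj (g t) ∂m

/-- The function `t ↦ tⁿ` on the circle. -/
def χ (n : ℤ) : L0 := (fourier n : C(𝕋, ℂ)).toAEEqFun m

/-- The Hardy space `H[X]` of integrable functions in `X` with vanishing negative Fourier
coefficients, normed as a subspace of `X`. -/
def hardy (X : FunctionSpace) : Submodule ℂ X.space where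
  carrier := {f | Integrable (f : L0) m ∧ ∀ n : ℤ, n < 0 → fourierCoeff (f : L0) n = 0}
  add_mem' {f g} hf hg := by
    have h : ((f + g : X.space) : L0) =ᵐ[m] ((f : L0) : 𝕋 → ℂ) + ((g : L0) : 𝕋 → ℂ) :=
      AEEqFun.coeFn_add _ _
    refine ⟨(hf.1.add hg.1).congr h.symm, fun n hn => ?_⟩
    rw [fourierCoeff_congr_ae h, fourierCoeff.add hf.1 hg.1]
    simp [hf.2 n hn, hg.2 n hn]
  zero_mem' := by
    have h : ((0 : X.space) : L0) =ᵐ[m] (0 : 𝕋 → ℂ) := AEEqFun.coeFn_zero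
    refine ⟨(integrable_zero _ _ _).congr h.symm, fun n hn => ?_⟩
    rw [fourierCoeff_congr_ae h]
    simp [fourierCoeff]
  smul_mem' c f hf := by
    have h : ((c • f : X.space) : L0) =ᵐ[m] c • ((f : L0) : 𝕋 → ℂ) := AEEqFun.coeFn_smul _ _
    refine ⟨(hf.1.smul c).congr h.symm, fun n hn => ?_⟩
    rw [fourierCoeff_congr_ae h, fourierCoeff.const_smul, hf.2 n hn, smul_zero]

theorem coeFn_χ (n : ℤ) : (χ n : 𝕋 → ℂ) =ᵐ[m] fourier n :=
  ContinuousMap.coeFn_toAEEqFun m _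

theorem χ_mem_space {X : FunctionSpace} (hX : IsBanachFunctionSpace X) (n : ℤ) :
    χ n ∈ X.space := by
  refine hX.linfty_subset _ ⟨1, ?_⟩
  filter_upwards [coeFn_χ n] with t ht
  rw [ht, fourier_apply, Circle.norm_coe]

theorem χ_mem_hardy {X : FunctionSpace} (hX : IsBanachFunctionSpace X) (j : ℕ) :
    (⟨χ j, χ_mem_space hX j⟩ : X.space) ∈ hardy X := by
  refine ⟨?_, fun n hn => ?_⟩
  · exact ((fourier (j : ℤ) : C(𝕋, ℂ)).continuous.integrable_of_hasCompactSupport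
      (HasCompactSupport.of_compactSpace _)).congr (coeFn_χ j).symm
  · have hne : -n + (j : ℤ) ≠ 0 := by omega
    rw [fourierCoeff_congr_ae (coeFn_χ j)]
    simp only [fourierCoeff, smul_eq_mul, ← fourier_add]
    exact integral_eq_zero_of_add_right_eq_neg (μ := m)
      (fourier_add_half_inv_index hne Real.two_pi_pos)

/-- The element `χ_j` of `H[X]`, for `j ≥ 0`. -/
def hardyχ {X : FunctionSpace} (hX : IsBanachFunctionSpace X) (j : ℕ) : hardy X :=
  ⟨⟨χ j, χ_mem_space hX j⟩, χ_mem_hardy hX j⟩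

/-- `h` is the Riesz projection of `f`, that is, `∑ f̂(n) tⁿ ↦ ∑_{n ≥ 0} f̂(n) tⁿ`. -/
def IsRieszProjectionOf (f h : L0) : Prop :=
  Integrable f m ∧ Integrable h m ∧
    ∀ n : ℤ, fourierCoeff h n = if 0 ≤ n then fourierCoeff f n else 0

/-- The bounded operator `P` is the Riesz projection on `Y`. -/
def IsRieszProjection {Y : FunctionSpace} (P : Y.space →L[ℂ] Y.space) : Prop :=
  ∀ f : Y.space, IsRieszProjectionOf f (P f)

/-- `A = T_a`, that is, `A f = P (a f)` for all `f ∈ H[X]`. -/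
def IsToeplitz {X Y : FunctionSpace} (a : L0) (A : hardy X →L[ℂ] hardy Y) : Prop :=
  ∀ f : hardy X, IsRieszProjectionOf (a * ((f : X.space) : L0)) ((A f : Y.space) : L0)

end BrownHalmos

end

/-
Averaging even powers of an analytic polynomial over the circle shows, as in M. Riesz's theorem,
that `P` is of strong type `(2k, 2k)` for every `k ≥ 1`; being self-adjoint, it is of weak type for
the conjugate exponents. The types so obtained come arbitrarily close to `1` and to `∞`, so `(Pf)*`
is dominated by a sum of dilations of `f*` whose norms in `Y` are summable because the Boyd indices
are nontrivial. Hence `P` is bounded on `Y`.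

If `A` has a Toeplitz matrix, the operators `χ₋ₙ A χₙ` converge on trigonometric polynomials to a
multiplication operator. The Fatou property of `Y` bounds its norm by that of `A`, and as
trigonometric polynomials are dense in the separable space `X`, its symbol `a` is a multiplier with
`‖a‖ ≤ ‖A‖`. Finally `A = T_a`, since the two operators agree on analytic polynomials, which are
dense in `H[X]`.
-/

noncomputable section

namespace BrownHalmos

/-! ### The norm on functions -/

namespace FunctionSpace

open Classical in
/-- The norm of `X`, evaluated at functions instead of classes of functions modulo equality almost
everywhere. Functions that are not measurable get the norm `∞`. -/
def fnrm (X : FunctionSpace) (f : 𝕋 → ℂ) : ℝ≥0∞ :=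
  if h : AEStronglyMeasurable f m then X.nrm (AEEqFun.mk f h) else ∞

variable {X : FunctionSpace} {f g h : 𝕋 → ℂ}

theorem fnrm_eq_nrm_mk (hf : AEStronglyMeasurable f m) : X.fnrm f = X.nrm (AEEqFun.mk f hf) :=
  dif_pos hf

theorem fnrm_coe (f : L0) : X.fnrm f = X.nrm f := by
  rw [fnrm_eq_nrm_mk f.aestronglyMeasurable, AEEqFun.mk_coeFn]

theorem fnrm_lt_top (f : X.space) : X.fnrm (f : L0) < ∞ :=
  (fnrm_coe _).trans_lt f.2

theorem fnrm_congr (h : f =ᵐ[m] g) : X.fnrm f = X.fnrm g := by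
  by_cases hf : AEStronglyMeasurable f m
  · rw [fnrm_eq_nrm_mk hf, fnrm_eq_nrm_mk (hf.congr h), AEEqFun.mk_eq_mk.2 h]
  · have hg : ¬ AEStronglyMeasurable g m := fun hg => hf (hg.congr h.symm)
    simp [fnrm, hf, hg]

theorem aestronglyMeasurable_of_fnrm_lt_top (h : X.fnrm f < ∞) : AEStronglyMeasurable f m := by
  by_contra hf
  simp [fnrm, hf] at h

theorem fnrm_add_le (f g : 𝕋 → ℂ) : X.fnrm (f + g) ≤ X.fnrm f + X.fnrm g := by
  by_cases hf : AEStronglyMeasurable f m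
  · by_cases hg : AEStronglyMeasurable g m
    · rw [fnrm_eq_nrm_mk hf, fnrm_eq_nrm_mk hg, fnrm_eq_nrm_mk (hf.add hg), ← AEEqFun.mk_add_mk]
      exact X.nrm_add_le _ _
    · simp [fnrm, hg]
  · simp [fnrm, hf]

theorem fnrm_sub_le_add (f g h : 𝕋 → ℂ) : X.fnrm (f - h) ≤ X.fnrm (f - g) + X.fnrm (g - h) := by
  simpa using fnrm_add_le (X := X) (f - g) (g - h)

theorem fnrm_const_smul (c : ℂ) (hf : AEStronglyMeasurable f m) :
    X.fnrm (c • f) = ‖c‖ₑ * X.fnrm f := by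
  rw [fnrm_eq_nrm_mk hf, fnrm_eq_nrm_mk (hf.const_smul c), ← X.nrm_smul, AEEqFun.smul_mk]

theorem fnrm_zero : X.fnrm 0 = 0 := by
  simpa using fnrm_const_smul (X := X) 0 (f := 0) aestronglyMeasurable_zero

theorem ae_eq_zero_of_fnrm_eq_zero (h : X.fnrm f = 0) : f =ᵐ[m] 0 := by
  have hf := aestronglyMeasurable_of_fnrm_lt_top (h ▸ ENNReal.zero_lt_top)
  rw [fnrm_eq_nrm_mk hf] at h
  exact AEEqFun.mk_eq_mk.1 ((X.eq_zero_of_nrm _ h).trans AEEqFun.zero_def)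

theorem fnrm_one_ne_zero : X.fnrm 1 ≠ 0 := fun h => by
  obtain ⟨_, ht⟩ := (ae_eq_zero_of_fnrm_eq_zero h).exists
  exact one_ne_zero ht

theorem enorm_eq_nrm (f : X.space) : ‖f‖ₑ = X.nrm f := by
  rw [← ofReal_norm]
  exact ENNReal.ofReal_toReal f.2.ne

theorem enorm_eq_fnrm (f : X.space) (h : ((f : L0) : 𝕋 → ℂ) =ᵐ[m] g) : ‖f‖ₑ = X.fnrm g := by
  rw [enorm_eq_nrm, ← fnrm_coe, fnrm_congr h]

/-- The element of `X` represented by a function of finite norm. -/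
def toSpace (X : FunctionSpace) (f : 𝕋 → ℂ) (h : X.fnrm f < ∞) : X.space :=
  ⟨AEEqFun.mk f (aestronglyMeasurable_of_fnrm_lt_top h), (fnrm_eq_nrm_mk _).symm.trans_lt h⟩

theorem coeFn_toSpace (h : X.fnrm f < ∞) : ((X.toSpace f h : L0) : 𝕋 → ℂ) =ᵐ[m] f :=
  AEEqFun.coeFn_mk _ _

theorem enorm_toSpace (h : X.fnrm f < ∞) : ‖X.toSpace f h‖ₑ = X.fnrm f :=
  enorm_eq_fnrm _ (coeFn_toSpace h)

theorem edist_eq_fnrm_sub {F G : X.space} (hF : ((F : L0) : 𝕋 → ℂ) =ᵐ[m] f)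
    (hG : ((G : L0) : 𝕋 → ℂ) =ᵐ[m] g) : edist F G = X.fnrm (f - g) := by
  rw [edist_eq_enorm_sub]
  exact enorm_eq_fnrm _ ((AEEqFun.coeFn_sub (F : L0) G).trans (hF.sub hG))

end FunctionSpace

open FunctionSpace

variable {X Y : FunctionSpace}

theorem aestronglyMeasurable_ofReal {u : 𝕋 → ℝ} (hu : AEStronglyMeasurable u m) :
    AEStronglyMeasurable (fun t => (u t : ℂ)) m :=
  Complex.continuous_ofReal.comp_aestronglyMeasurable hu

namespace IsBanachFunctionSpace

variable {f g h : 𝕋 → ℂ} {E : Set 𝕋}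

theorem fnrm_mono (hX : IsBanachFunctionSpace X) (hg : AEStronglyMeasurable g m)
    (h : ∀ᵐ t ∂m, ‖g t‖ ≤ ‖f t‖) : X.fnrm g ≤ X.fnrm f := by
  rcases eq_or_ne (X.fnrm f) ∞ with hf | hf
  · exact hf ▸ le_top
  have hfm := aestronglyMeasurable_of_fnrm_lt_top hf.lt_top
  rw [fnrm_eq_nrm_mk hfm] at hf ⊢
  rw [fnrm_eq_nrm_mk hg]
  refine (hX.ideal _ _ hf.lt_top ?_).2
  filter_upwards [h, AEEqFun.coeFn_mk f hfm, AEEqFun.coeFn_mk g hg] with t ht hft hgt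
  rwa [hft, hgt]

theorem fnrm_congr_norm (hX : IsBanachFunctionSpace X) (hf : AEStronglyMeasurable f m)
    (hg : AEStronglyMeasurable g m) (h : ∀ᵐ t ∂m, ‖g t‖ = ‖f t‖) : X.fnrm g = X.fnrm f :=
  le_antisymm (hX.fnrm_mono hg (h.mono fun _ h => h.le)) (hX.fnrm_mono hf (h.mono fun _ h => h.ge))

theorem fnrm_ofReal_norm (hX : IsBanachFunctionSpace X) (hf : AEStronglyMeasurable f m) :
    X.fnrm (fun t => (‖f t‖ : ℂ)) = X.fnrm f :=
  hX.fnrm_congr_norm hf (aestronglyMeasurable_ofReal hf.norm) (ae_of_all _ fun t => by simp)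

theorem fnrm_indicator_le (hX : IsBanachFunctionSpace X) (hE : NullMeasurableSet E m)
    (hf : AEStronglyMeasurable f m) : X.fnrm (E.indicator f) ≤ X.fnrm f :=
  hX.fnrm_mono (hf.indicator₀ hE) (ae_of_all _ fun _ => norm_indicator_le_norm_self _ _)

theorem fnrm_lt_top_of_bound (hX : IsBanachFunctionSpace X) (hf : AEStronglyMeasurable f m) {C : ℝ}
    (hC : ∀ᵐ t ∂m, ‖f t‖ ≤ C) : X.fnrm f < ∞ := by
  rw [fnrm_eq_nrm_mk hf]
  refine hX.linfty_subset _ ⟨C, ?_⟩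
  filter_upwards [hC, AEEqFun.coeFn_mk f hf] with t ht hft
  rwa [hft]

theorem fnrm_one_lt_top (hX : IsBanachFunctionSpace X) : X.fnrm 1 < ∞ :=
  hX.fnrm_lt_top_of_bound aestronglyMeasurable_one (C := 1) (by simp)

theorem fnrm_le_of_bound (hX : IsBanachFunctionSpace X) (hf : AEStronglyMeasurable f m) {C : ℝ}
    (hC : ∀ᵐ t ∂m, ‖f t‖ ≤ C) : X.fnrm f ≤ ENNReal.ofReal C * X.fnrm 1 := by
  obtain ⟨t, ht⟩ := hC.exists
  have hC0 : 0 ≤ C := (norm_nonneg _).trans ht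
  have hnorm : ‖(C : ℂ)‖ₑ = ENNReal.ofReal C := by
    rw [← ofReal_norm, Complex.norm_of_nonneg hC0]
  rw [← hnorm, ← fnrm_const_smul _ aestronglyMeasurable_one]
  exact hX.fnrm_mono hf (hC.mono fun t ht => by simpa [abs_of_nonneg hC0] using ht)

/-! ### Consequences of the Fatou properties -/

theorem fnrm_le_of_increasing (hX : IsBanachFunctionSpace X)
    (hF : HasFatouProperty X ∨ X.fnrm g < ∞) (hg : AEStronglyMeasurable g m) {u : ℕ → 𝕋 → ℝ}
    (hu : ∀ k, AEStronglyMeasurable (u k) m) (hu0 : ∀ k t, 0 ≤ u k t)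
    (hmono : ∀ᵐ t ∂m, Monotone fun k => u k t)
    (hlim : ∀ᵐ t ∂m, Tendsto (fun k => u k t) atTop (𝓝 ‖g t‖)) {K : ℝ≥0∞}
    (hK : ∀ k, X.fnrm (fun t => (u k t : ℂ)) ≤ K) : X.fnrm g ≤ K := by
  rcases eq_or_ne K ∞ with rfl | hKtop
  · exact le_top
  have huc k := aestronglyMeasurable_ofReal (hu k)
  have hgc := aestronglyMeasurable_ofReal hg.norm
  have hinc : IncreasesTo (fun k => AEEqFun.mk _ (huc k)) (AEEqFun.mk _ hgc) := by
    filter_upwards [ae_all_iff.2 fun k => AEEqFun.coeFn_mk _ (huc k), AEEqFun.coeFn_mk _ hgc,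
      hmono, hlim] with t hut hgt hmt hlt
    simp only [hut, hgt]
    exact ⟨fun n => Complex.zero_le_real.2 (hu0 n t), fun i j hij =>
      Complex.real_le_real.2 (hmt hij), (Complex.continuous_ofReal.tendsto _).comp hlt⟩
  simp only [fnrm_eq_nrm_mk (huc _)] at hK
  rw [← hX.fnrm_ofReal_norm hg] at hF ⊢
  rw [fnrm_eq_nrm_mk hgc] at hF ⊢
  have hmem k : AEEqFun.mk _ (huc k) ∈ X.space := (hK k).trans_lt hKtop.lt_top
  have hsup : X.nrm (AEEqFun.mk _ hgc) = ⨆ k, X.nrm (AEEqFun.mk _ (huc k)) :=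
    hF.elim (fun hF => (hF _ _ hmem hinc ((iSup_le hK).trans_lt hKtop.lt_top)).2)
      fun hg => hX.semiFatou _ _ hmem hg hinc
  exact hsup.trans_le (iSup_le hK)

theorem fnrm_le_of_enorm_le_iSup (hX : IsBanachFunctionSpace X)
    (hF : HasFatouProperty X ∨ X.fnrm g < ∞) (hg : AEStronglyMeasurable g m)
    {v : ℕ → 𝕋 → ℝ≥0∞} (hv : ∀ k, AEMeasurable (v k) m) (hmono : ∀ᵐ t ∂m, Monotone fun k => v k t)
    (hsup : ∀ᵐ t ∂m, ‖g t‖ₑ ≤ ⨆ k, v k t) {K : ℝ≥0∞}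
    (hK : ∀ k, ∀ w : 𝕋 → ℂ, AEStronglyMeasurable w m → (∀ᵐ t ∂m, ‖w t‖ₑ ≤ v k t) →
      X.fnrm w ≤ K) : X.fnrm g ≤ K := by
  have htop k t : min (v k t) ‖g t‖ₑ ≠ ∞ := ((min_le_right _ _).trans_lt enorm_lt_top).ne
  have hu k : AEStronglyMeasurable (fun t => (min (v k t) ‖g t‖ₑ).toReal) m :=
    ((hv k).min hg.enorm).ennreal_toReal.aestronglyMeasurable
  refine hX.fnrm_le_of_increasing hF hg hu (fun _ _ => ENNReal.toReal_nonneg)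
    (hmono.mono fun t ht i j hij => ENNReal.toReal_mono (htop j t) (min_le_min_right _ (ht hij)))
    ?_ fun k => hK k _ (aestronglyMeasurable_ofReal (hu k)) (ae_of_all _ fun t => ?_)
  · filter_upwards [hmono, hsup] with t hmt hst
    have hmin := (tendsto_atTop_iSup hmt).min (tendsto_const_nhds (x := ‖g t‖ₑ))
    rw [min_eq_right hst] at hmin
    simpa [Function.comp_def] using (ENNReal.tendsto_toReal enorm_ne_top).comp hmin
  · rw [← ofReal_norm, Complex.norm_of_nonneg ENNReal.toReal_nonneg,
      ENNReal.ofReal_toReal (htop k t)]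
    exact min_le_left _ _

theorem fnrm_le_of_tendsto_ae (hX : IsBanachFunctionSpace X) (hF : HasFatouProperty X)
    (hg : AEStronglyMeasurable g m) {f : ℕ → 𝕋 → ℂ} (hf : ∀ n, AEStronglyMeasurable (f n) m)
    (hlim : ∀ᵐ t ∂m, Tendsto (fun n => f n t) atTop (𝓝 (g t))) {K : ℝ≥0∞}
    (hK : ∀ n, X.fnrm (f n) ≤ K) : X.fnrm g ≤ K := by
  refine hX.fnrm_le_of_enorm_le_iSup (.inl hF) hg (v := fun k t => ⨅ n ≥ k, ‖f n t‖ₑ)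
    (fun k => .biInf _ (Set.to_countable _) fun n _ => (hf n).enorm)
    (ae_of_all _ fun t i j hij => le_iInf₂ fun n hn => iInf₂_le n (hij.trans hn))
    (hlim.mono fun t ht => ?_) fun k w hw hwk => ?_
  · rw [← liminf_eq_iSup_iInf_of_nat]
    exact ht.enorm.liminf_eq.ge
  · exact (hX.fnrm_mono hw (hwk.mono fun t ht =>
      enorm_le_iff_norm_le.1 (ht.trans (iInf₂_le k le_rfl)))).trans (hK k)

theorem fnrm_sum_norm_le (hX : IsBanachFunctionSpace X) {f : ℕ → 𝕋 → ℂ}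
    (hf : ∀ n, AEStronglyMeasurable (f n) m) (k : ℕ) :
    X.fnrm (∑ j ∈ Finset.range k, fun t => (‖f j t‖ : ℂ)) ≤ ∑ j ∈ Finset.range k, X.fnrm (f j) := by
  induction k with
  | zero => simpa using fnrm_zero.le
  | succ k ih =>
    rw [Finset.sum_range_succ, Finset.sum_range_succ, ← hX.fnrm_ofReal_norm (hf k)]
    exact (fnrm_add_le _ _).trans (add_le_add_left ih _)

theorem fnrm_le_tsum (hX : IsBanachFunctionSpace X) (hF : HasFatouProperty X)
    (hg : AEStronglyMeasurable g m) {f : ℕ → 𝕋 → ℂ} (hf : ∀ n, AEStronglyMeasurable (f n) m)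
    (hle : ∀ᵐ t ∂m, ‖g t‖ₑ ≤ ∑' n, ‖f n t‖ₑ) : X.fnrm g ≤ ∑' n, X.fnrm (f n) := by
  refine hX.fnrm_le_of_enorm_le_iSup (.inl hF) hg (v := fun k t => ∑ j ∈ Finset.range k, ‖f j t‖ₑ)
    (fun k => Finset.aemeasurable_fun_sum _ fun n _ => (hf n).enorm)
    (ae_of_all _ fun t i j hij => Finset.sum_le_sum_of_subset (Finset.range_mono hij))
    (hle.mono fun t ht => ht.trans_eq ENNReal.tsum_eq_iSup_nat) fun k w hw hwk => ?_
  refine (hX.fnrm_mono hw (hwk.mono fun t ht => ?_)).trans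
    ((hX.fnrm_sum_norm_le hf k).trans (ENNReal.sum_le_tsum _))
  have hnorm : ‖(∑ j ∈ Finset.range k, fun t => (‖f j t‖ : ℂ)) t‖ =
      ∑ j ∈ Finset.range k, ‖f j t‖ := by
    rw [Finset.sum_apply, ← Complex.ofReal_sum, Complex.norm_of_nonneg (by positivity)]
  rw [hnorm, ← ENNReal.ofReal_le_ofReal_iff (by positivity), ofReal_norm,
    ENNReal.ofReal_sum_of_nonneg fun _ _ => norm_nonneg _]
  simpa only [ofReal_norm] using ht

end IsBanachFunctionSpace

variable {f g : 𝕋 → ℂ}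

/-! ### Absolutely continuous norms -/

/-- A function of `X` has absolutely continuous norm if the norms of its restrictions to the members
of a sequence of sets decreasing to a null set tend to `0`. -/
structure HasAbsContNorm (X : FunctionSpace) (f : 𝕋 → ℂ) : Prop where
  fnrm_lt_top : X.fnrm f < ∞
  tendsto_fnrm_indicator : ∀ E : ℕ → Set 𝕋, (∀ n, NullMeasurableSet (E n) m) → Antitone E →
    m (⋂ n, E n) = 0 → Tendsto (fun n => X.fnrm ((E n).indicator f)) atTop (𝓝 0)

theorem exists_ne_edist_lt {α ι : Type*} [PseudoEMetricSpace α] [TopologicalSpace.SeparableSpace α]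
    [Uncountable ι] (x : ι → α) {δ : ℝ≥0∞} (hδ : δ ≠ 0) : ∃ i j, i ≠ j ∧ edist (x i) (x j) < δ := by
  by_contra! h
  refine not_countable (α := ι) (Pairwise.countable_of_isOpen_disjoint
    (s := fun i => Metric.eball (x i) (δ / 2)) (fun i j hij => Metric.eball_disjoint ?_)
    (fun i => Metric.isOpen_eball) fun i => ⟨x i, Metric.mem_eball_self (ENNReal.half_pos hδ)⟩)
  rw [ENNReal.add_halves]
  exact h i j hij

namespace IsBanachFunctionSpace

theorem exists_fnrm_indicator_lt_of_pairwise_disjoint (hX : IsBanachFunctionSpace X)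
    [TopologicalSpace.SeparableSpace X.space] (hf : X.fnrm f < ∞) {F : ℕ → Set 𝕋}
    (hF : ∀ j, NullMeasurableSet (F j) m) (hdisj : Pairwise (Function.onFun Disjoint F)) {δ : ℝ≥0∞}
    (hδ : δ ≠ 0) : ∃ j, X.fnrm ((F j).indicator f) < δ := by
  have hfm := aestronglyMeasurable_of_fnrm_lt_top hf
  let U (S : Set ℕ) : Set 𝕋 := ⋃ j ∈ S, F j
  have hU S : NullMeasurableSet (U S) m := .biUnion S.to_countable fun j _ => hF j
  have hmemU {S j t} (ht : t ∈ F j) : t ∈ U S ↔ j ∈ S := by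
    simp only [U, Set.mem_iUnion, exists_prop]
    exact ⟨fun ⟨i, hi, hti⟩ => hdisj.eq (Set.not_disjoint_iff.2 ⟨t, hti, ht⟩) ▸ hi,
      fun h => ⟨j, h, ht⟩⟩
  have : Uncountable (Set ℕ) := uncountable_iff_forall_not_surjective.2 Function.cantor_surjective
  have hUf S := (hX.fnrm_indicator_le (hU S) hfm).trans_lt hf
  obtain ⟨S, S', hne, hlt⟩ := exists_ne_edist_lt (fun S => X.toSpace _ (hUf S)) hδ
  rw [edist_eq_fnrm_sub (coeFn_toSpace _) (coeFn_toSpace _)] at hlt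
  obtain ⟨j, hj⟩ := Set.symmDiff_nonempty.2 hne
  refine ⟨j, (hX.fnrm_mono (hfm.indicator₀ (hF j)) (ae_of_all _ fun t => ?_)).trans_lt hlt⟩
  by_cases ht : t ∈ F j
  · rcases hj with ⟨hS, hS'⟩ | ⟨hS', hS⟩ <;>
      simp [ht, (hmemU ht).2, mt (hmemU ht).1, hS, hS']
  · simp [ht]

theorem exists_lt_fnrm_indicator_diff (hX : IsBanachFunctionSpace X) (hf : X.fnrm f < ∞)
    {E : ℕ → Set 𝕋} (hE : ∀ n, NullMeasurableSet (E n) m) (hanti : Antitone E)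
    (hnull : m (⋂ n, E n) = 0) {δ : ℝ≥0∞} (n : ℕ) (hδ : δ < X.fnrm ((E n).indicator f)) :
    ∃ l, n < l ∧ δ < X.fnrm ((E n \ E l).indicator f) := by
  have hfm := aestronglyMeasurable_of_fnrm_lt_top hf
  have hdiff {i j} (hij : i ≤ j) : E n \ E i ⊆ E n \ E j := Set.sdiff_subset_sdiff_right (hanti hij)
  by_contra! hcon
  refine hδ.not_ge (hX.fnrm_le_of_enorm_le_iSup
    (.inr ((hX.fnrm_indicator_le (hE n) hfm).trans_lt hf)) (hfm.indicator₀ (hE n))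
    (v := fun l t => ‖(E n \ E l).indicator f t‖ₑ)
    (fun l => (hfm.indicator₀ ((hE n).diff (hE l))).enorm)
    (ae_of_all _ fun t i j hij => enorm_indicator_le_of_subset (hdiff hij) _ _)
    ?_ fun l w hw hwl => ?_)
  · filter_upwards [measure_eq_zero_iff_ae_notMem.1 hnull] with t ht
    obtain ⟨l, hl⟩ : ∃ l, t ∉ E l := by simpa using ht
    refine le_iSup_of_le l (le_of_eq ?_)
    by_cases htn : t ∈ E n <;> simp [Set.indicator, htn, hl]
  · exact (hX.fnrm_mono hw (hwl.mono fun t ht => enorm_le_iff_norm_le.1 (ht.trans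
      (enorm_indicator_le_of_subset (hdiff (le_max_left _ _)) _ _)))).trans
        (hcon (max l (n + 1)) (by simp))

theorem hasAbsContNorm_of_separableSpace (hX : IsBanachFunctionSpace X)
    [TopologicalSpace.SeparableSpace X.space] (hf : X.fnrm f < ∞) : HasAbsContNorm X f := by
  refine ⟨hf, fun E hE hanti hnull => ?_⟩
  have hfm := aestronglyMeasurable_of_fnrm_lt_top hf
  have hlim := tendsto_atTop_iInf (f := fun n => X.fnrm ((E n).indicator f)) fun i j hij =>
    hX.fnrm_mono (hfm.indicator₀ (hE j)) (ae_of_all _ fun t =>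
      norm_indicator_le_of_subset (hanti hij) _ _)
  suffices h : (⨅ n, X.fnrm ((E n).indicator f)) = 0 by rwa [h] at hlim
  by_contra hne
  obtain ⟨δ, hδ0, hδ⟩ := exists_between (pos_iff_ne_zero.2 hne)
  choose next hnext hlt using fun n =>
    hX.exists_lt_fnrm_indicator_diff hf hE hanti hnull n (hδ.trans_le (iInf_le _ n))
  let k (j : ℕ) : ℕ := next^[j] 0
  have hk j : k (j + 1) = next (k j) := Function.iterate_succ_apply' next j 0
  have hkmono : StrictMono k := strictMono_nat_of_lt_succ fun j => by rw [hk]; exact hnext _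
  have hdisj : Pairwise (Function.onFun Disjoint fun j => E (k j) \ E (k (j + 1))) := by
    refine (pairwise_disjoint_on _).2 fun i j hij => Set.disjoint_left.2 fun t hi hj => hi.2 ?_
    exact hanti (hkmono.monotone (Nat.succ_le_of_lt hij)) hj.1
  obtain ⟨j, hj⟩ := hX.exists_fnrm_indicator_lt_of_pairwise_disjoint hf
    (fun j => (hE (k j)).diff (hE (k (j + 1)))) hdisj hδ0.ne'
  rw [hk] at hj
  exact hj.not_gt (hlt (k j))

theorem fnrm_le_add_fnrm_indicator (hX : IsBanachFunctionSpace X) {E : Set 𝕋}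
    (hE : NullMeasurableSet E m) (hg : AEStronglyMeasurable g m) (hle : ∀ᵐ t ∂m, ‖g t‖ ≤ ‖f t‖)
    {η : ℝ} (hη : 0 ≤ η) (hgη : ∀ t ∉ E, ‖g t‖ ≤ η) :
    X.fnrm g ≤ ENNReal.ofReal η * X.fnrm 1 + X.fnrm (E.indicator f) := by
  rw [← Set.indicator_self_add_compl E g, add_comm]
  refine (fnrm_add_le _ _).trans (add_le_add ?_ ?_)
  · refine hX.fnrm_le_of_bound (hg.indicator₀ hE.compl) (ae_of_all _ fun t => ?_)
    by_cases ht : t ∈ E <;> simp [ht, hη, hgη]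
  · refine hX.fnrm_mono (hg.indicator₀ hE) (hle.mono fun t ht => ?_)
    by_cases htE : t ∈ E <;> simp [htE, ht]

end IsBanachFunctionSpace

theorem HasAbsContNorm.const_smul (hf : HasAbsContNorm X f) (c : ℂ) : HasAbsContNorm X (c • f) := by
  have hfm := aestronglyMeasurable_of_fnrm_lt_top hf.fnrm_lt_top
  refine ⟨?_, fun E hE hanti hnull => ?_⟩
  · rw [fnrm_const_smul c hfm]
    exact ENNReal.mul_lt_top enorm_lt_top hf.fnrm_lt_top
  · have hsmul n : X.fnrm ((E n).indicator (c • f)) = ‖c‖ₑ * X.fnrm ((E n).indicator f) := by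
      rw [← fnrm_const_smul c (hfm.indicator₀ (hE n))]
      exact congrArg _ (Set.indicator_const_smul (E n) c f)
    simp_rw [hsmul]
    simpa using ENNReal.Tendsto.const_mul (hf.tendsto_fnrm_indicator E hE hanti hnull)
      (.inr enorm_ne_top)

theorem HasAbsContNorm.tendsto_fnrm_of_dominated (hf : HasAbsContNorm X f)
    (hX : IsBanachFunctionSpace X) {h : ℕ → 𝕋 → ℂ} (hh : ∀ n, AEStronglyMeasurable (h n) m)
    (hle : ∀ n, ∀ᵐ t ∂m, ‖h n t‖ ≤ ‖f t‖)
    (hlim : ∀ᵐ t ∂m, Tendsto (fun n => h n t) atTop (𝓝 0)) :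
    Tendsto (fun n => X.fnrm (h n)) atTop (𝓝 0) := by
  refine ENNReal.tendsto_nhds_zero.2 fun ε hε => ?_
  have hε2 := ENNReal.half_pos hε.ne'
  obtain ⟨η, hη, hηε⟩ := ENNReal.exists_nnreal_pos_mul_lt hX.fnrm_one_lt_top.ne hε2.ne'
  let E (k : ℕ) : Set 𝕋 := ⋃ n ≥ k, {t | (η : ℝ) < ‖h n t‖}
  have hE k : NullMeasurableSet (E k) m := .biUnion (Set.to_countable _) fun n _ =>
    nullMeasurableSet_lt aemeasurable_const (hh n).norm.aemeasurable
  have hanti : Antitone E := fun i j hij =>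
    Set.biUnion_subset_biUnion_left fun n hn => hij.trans hn
  have hnull : m (⋂ n, E n) = 0 := by
    refine measure_eq_zero_iff_ae_notMem.2 (hlim.mono fun t ht hmem => ?_)
    obtain ⟨k, hk⟩ := eventually_atTop.1 (ht.norm.eventually_lt_const (by
      simpa only [norm_zero] using NNReal.coe_pos.2 hη))
    obtain ⟨n, hn, hn'⟩ := Set.mem_iUnion₂.1 (Set.mem_iInter.1 hmem k)
    exact (hk n hn).not_gt hn'
  filter_upwards [ENNReal.tendsto_nhds_zero.1 (hf.tendsto_fnrm_indicator E hE hanti hnull) _ hε2]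
    with n hn
  calc X.fnrm (h n) ≤ ENNReal.ofReal η * X.fnrm 1 + X.fnrm ((E n).indicator f) :=
        hX.fnrm_le_add_fnrm_indicator (hE n) (hh n) (hle n) η.2 fun t ht =>
          not_lt.1 fun hc => ht (Set.mem_iUnion₂.2 ⟨n, le_rfl, hc⟩)
    _ ≤ ε / 2 + ε / 2 := add_le_add (by simpa using hηε.le) hn
    _ = ε := ENNReal.add_halves _

/-! ### Density of trigonometric polynomials -/

theorem exists_continuous_tendsto_ae {α E : Type*} [TopologicalSpace α] [NormalSpace α]
    [MeasurableSpace α] [BorelSpace α] {μ : Measure α} [IsFiniteMeasure μ] [μ.WeaklyRegular]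
    [NormedAddCommGroup E] [NormedSpace ℝ E] {f : α → E} (hf : AEStronglyMeasurable f μ) {M : ℝ}
    (hM : 0 < M) (hfM : ∀ᵐ t ∂μ, ‖f t‖ ≤ M) :
    ∃ g : ℕ → C(α, E), (∀ n t, ‖g n t‖ ≤ M) ∧
      ∀ᵐ t ∂μ, Tendsto (fun n => g n t) atTop (𝓝 (f t)) := by
  choose g hg hgm using fun n : ℕ =>
    (MemLp.of_bound (p := 1) hf M hfM).exists_boundedContinuous_eLpNorm_sub_le ENNReal.one_ne_top
      (ε := (n : ℝ≥0∞)⁻¹) (by simp)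
  have hgf : Tendsto (fun n => eLpNorm (⇑(g n) - f) 1 μ) atTop (𝓝 0) :=
    tendsto_of_tendsto_of_tendsto_of_le_of_le tendsto_const_nhds ENNReal.tendsto_inv_nat_nhds_zero
      (fun _ => zero_le) fun n => (eLpNorm_sub_comm _ _ _ _).trans_le (hg n)
  obtain ⟨k, -, hk⟩ := (tendstoInMeasure_of_tendsto_eLpNorm one_ne_zero
    (fun n => (hgm n).1) hf hgf).exists_seq_tendsto_ae
  -- the radial retraction onto the ball of radius `M`
  let ρ (z : E) : E := (M / max M ‖z‖) • z
  have hpos (z : E) : 0 < max M ‖z‖ := hM.trans_le (le_max_left _ _)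
  have hρ : Continuous ρ := (continuous_const.div (continuous_const.max continuous_norm)
    fun z => (hpos z).ne').smul continuous_id
  refine ⟨fun n => ⟨fun t => ρ (g (k n) t), hρ.comp (g (k n)).continuous⟩, fun n t => ?_, ?_⟩
  · rw [ContinuousMap.coe_mk, norm_smul, Real.norm_of_nonneg (div_nonneg hM.le (hpos _).le),
      div_mul_eq_mul_div, div_le_iff₀ (hpos _)]
    exact mul_le_mul_of_nonneg_left (le_max_right _ _) hM.le
  · filter_upwards [hk, hfM] with t hkt hft
    have hρf : ρ (f t) = f t := by simp [ρ, max_eq_left hft, hM.ne']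
    exact hρf ▸ (hρ.tendsto (f t)).comp hkt

theorem aestronglyMeasurable_continuousMap (g : C(𝕋, ℂ)) : AEStronglyMeasurable g m :=
  g.continuous.aestronglyMeasurable

theorem integrable_continuousMap (g : C(𝕋, ℂ)) : Integrable g m :=
  g.continuous.integrable_of_hasCompactSupport (HasCompactSupport.of_compactSpace _)

theorem IsBanachFunctionSpace.fnrm_continuousMap_lt_top (hX : IsBanachFunctionSpace X)
    (g : C(𝕋, ℂ)) : X.fnrm g < ∞ :=
  hX.fnrm_lt_top_of_bound (aestronglyMeasurable_continuousMap g) (ae_of_all _ g.norm_coe_le_norm)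

/-- The trigonometric polynomial `∑ cₙ tⁿ` with coefficients `c`. -/
def trigPoly : (ℤ →₀ ℂ) →ₗ[ℂ] C(𝕋, ℂ) := Finsupp.linearCombination ℂ fourier

@[simp]
theorem trigPoly_single (n : ℤ) (a : ℂ) : trigPoly (Finsupp.single n a) = a • fourier n :=
  Finsupp.linearCombination_single ..

theorem denseRange_trigPoly : DenseRange trigPoly := by
  have h := congrArg ((↑) : Submodule ℂ C(𝕋, ℂ) → Set C(𝕋, ℂ))
    (span_fourier_closure_eq_top (T := 2 * Real.pi))
  rw [Submodule.topologicalClosure_coe, ← Finsupp.range_linearCombination] at h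
  exact dense_iff_closure_eq.2 h

theorem exists_norm_sub_trigPoly_lt (g : C(𝕋, ℂ)) {ε : ℝ} (hε : 0 < ε) :
    ∃ c, ‖g - trigPoly c‖ < ε := by
  simpa only [dist_eq_norm] using denseRange_trigPoly.exists_dist_lt g hε

theorem exists_trigPoly_tendsto_ae (hf : AEStronglyMeasurable f m) {M : ℝ}
    (hM : 0 < M) (hfM : ∀ᵐ t ∂m, ‖f t‖ ≤ M) :
    ∃ c : ℕ → ℤ →₀ ℂ, (∀ n t, ‖trigPoly (c n) t‖ ≤ M + 1) ∧
      ∀ᵐ t ∂m, Tendsto (fun n => trigPoly (c n) t) atTop (𝓝 (f t)) := by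
  obtain ⟨g, hg, hglim⟩ := exists_continuous_tendsto_ae hf hM hfM
  choose c hc using fun n => exists_norm_sub_trigPoly_lt (g n) (Nat.one_div_pos_of_nat (α := ℝ))
  have hdist n t : ‖trigPoly (c n) t - g n t‖ ≤ 1 / ((n : ℝ) + 1) :=
    (norm_sub_rev _ _).trans_le (((g n - trigPoly (c n)).norm_coe_le_norm t).trans (hc n).le)
  refine ⟨c, fun n t => ?_, hglim.mono fun t ht => ?_⟩
  · have h1 : 1 / ((n : ℝ) + 1) ≤ 1 := div_le_self zero_le_one (by simp)
    calc ‖trigPoly (c n) t‖ ≤ ‖g n t‖ + ‖trigPoly (c n) t - g n t‖ := norm_le_norm_add_norm_sub' _ _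
      _ ≤ M + 1 := add_le_add (hg n t) ((hdist n t).trans h1)
  · simpa using ht.add (squeeze_zero_norm (hdist · t) tendsto_one_div_add_atTop_nhds_zero_nat)

theorem HasAbsContNorm.exists_fnrm_sub_trigPoly_le_of_bound (h1 : HasAbsContNorm X 1)
    (hX : IsBanachFunctionSpace X) (hf : AEStronglyMeasurable f m) {M : ℝ} (hM : 0 < M)
    (hfM : ∀ᵐ t ∂m, ‖f t‖ ≤ M) {ε : ℝ≥0∞} (hε : 0 < ε) : ∃ c, X.fnrm (f - trigPoly c) ≤ ε := by
  obtain ⟨c, hc, hlim⟩ := exists_trigPoly_tendsto_ae hf hM hfM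
  have hdom := (h1.const_smul ((M + (M + 1) : ℝ) : ℂ)).tendsto_fnrm_of_dominated hX
    (fun n => hf.sub (aestronglyMeasurable_continuousMap (trigPoly (c n))))
    (fun n => hfM.mono fun t ht => ?_) (hlim.mono fun t ht => ?_)
  · exact ((ENNReal.tendsto_nhds_zero.1 hdom ε hε).exists).imp' c fun n hn => hn
  · calc ‖f t - trigPoly (c n) t‖ ≤ ‖f t‖ + ‖trigPoly (c n) t‖ := norm_sub_le _ _
      _ ≤ M + (M + 1) := add_le_add ht (hc n t)
      _ ≤ ‖(((M + (M + 1) : ℝ) : ℂ) • (1 : 𝕋 → ℂ)) t‖ := by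
        simpa [-Complex.ofReal_add, -Complex.ofReal_one] using le_abs_self (M + (M + 1))
  · simpa using (tendsto_const_nhds (x := f t)).sub ht

theorem HasAbsContNorm.exists_bounded_fnrm_sub_le (hf : HasAbsContNorm X f) {ε : ℝ≥0∞}
    (hε : 0 < ε) : ∃ n : ℕ, X.fnrm (f - {t | ‖f t‖ ≤ n}.indicator f) ≤ ε := by
  have hfm := aestronglyMeasurable_of_fnrm_lt_top hf.fnrm_lt_top
  let E (n : ℕ) : Set 𝕋 := {t | ‖f t‖ ≤ n}ᶜ
  have hE n : NullMeasurableSet (E n) m :=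
    (nullMeasurableSet_le hfm.norm.aemeasurable aemeasurable_const).compl
  have hanti : Antitone E := fun i j hij =>
    Set.compl_subset_compl.2 fun t (ht : ‖f t‖ ≤ i) => ht.trans (Nat.cast_le.2 hij)
  have hempty : ⋂ n, E n = ∅ := Set.eq_empty_of_forall_notMem fun t ht =>
    (exists_nat_ge ‖f t‖).elim fun n hn => Set.mem_iInter.1 ht n hn
  obtain ⟨n, hn⟩ := (ENNReal.tendsto_nhds_zero.1
    (hf.tendsto_fnrm_indicator E hE hanti (by simp [hempty])) ε hε).exists
  exact ⟨n, by rwa [← Set.indicator_compl]⟩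

theorem HasAbsContNorm.exists_fnrm_sub_trigPoly_le (hf : HasAbsContNorm X f)
    (h1 : HasAbsContNorm X 1) (hX : IsBanachFunctionSpace X) {ε : ℝ≥0∞} (hε : 0 < ε) :
    ∃ c, X.fnrm (f - trigPoly c) ≤ ε := by
  have hfm := aestronglyMeasurable_of_fnrm_lt_top hf.fnrm_lt_top
  have hε2 := ENNReal.half_pos hε.ne'
  obtain ⟨n, hn⟩ := hf.exists_bounded_fnrm_sub_le hε2
  have hbound t : ‖{t | ‖f t‖ ≤ n}.indicator f t‖ ≤ n + 1 := by
    by_cases ht : ‖f t‖ ≤ n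
    · simpa [ht] using ht.trans (le_add_of_nonneg_right zero_le_one)
    · simpa [ht] using (Nat.cast_add_one_pos (α := ℝ) n).le
  obtain ⟨c, hc⟩ := h1.exists_fnrm_sub_trigPoly_le_of_bound hX
    (hfm.indicator₀ (nullMeasurableSet_le hfm.norm.aemeasurable aemeasurable_const))
    (Nat.cast_add_one_pos n) (ae_of_all _ hbound) hε2
  exact ⟨c, (fnrm_sub_le_add _ _ _).trans ((add_le_add hn hc).trans_eq (ENNReal.add_halves ε))⟩

/-! ### Boundedness of multipliers -/

theorem mul_smul_L0 (a : L0) (c : ℂ) (g : L0) : a * (c • g) = c • (a * g) := by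
  induction a, g using AEEqFun.induction_on₂ with
  | _ f hf g hg =>
    rw [AEEqFun.smul_mk, AEEqFun.mk_mul_mk, AEEqFun.mk_mul_mk, AEEqFun.smul_mk]
    exact AEEqFun.mk_eq_mk.2 (ae_of_all _ fun t => mul_left_comm _ _ _)

theorem mul_add_L0 (a f g : L0) : a * (f + g) = a * f + a * g := by
  induction a, f, g using AEEqFun.induction_on₃ with
  | _ a ha f hf g hg =>
    rw [AEEqFun.mk_add_mk, AEEqFun.mk_mul_mk, AEEqFun.mk_mul_mk, AEEqFun.mk_mul_mk,
      AEEqFun.mk_add_mk]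
    exact AEEqFun.mk_eq_mk.2 (ae_of_all _ fun t => mul_add _ _ _)

theorem IsBanachFunctionSpace.ae_norm_le_of_tendsto (hX : IsBanachFunctionSpace X)
    {u : ℕ → X.space} {F : X.space} (hu : Tendsto u atTop (𝓝 F)) (hg : AEStronglyMeasurable g m)
    (hle : ∀ᶠ n in atTop, ∀ᵐ t ∂m, ‖g t‖ ≤ ‖(u n : L0) t‖) :
    ∀ᵐ t ∂m, ‖g t‖ ≤ ‖(F : L0) t‖ := by
  -- the excess of `‖g‖` over `‖F‖` is dominated by `‖u n - F‖` for large `n`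
  let excess (t : 𝕋) : ℂ := (max (‖g t‖ - ‖(F : L0) t‖) 0 : ℝ)
  have hm : AEStronglyMeasurable excess m := aestronglyMeasurable_ofReal
    ((hg.norm.sub (F : L0).aestronglyMeasurable.norm).sup aestronglyMeasurable_const)
  have hexcess : ∀ᶠ n in atTop, X.fnrm excess ≤ edist (u n) F := hle.mono fun n hn => by
    rw [edist_eq_fnrm_sub (ae_eq_refl _) (ae_eq_refl _)]
    refine hX.fnrm_mono hm (hn.mono fun t ht => ?_)
    rw [Complex.norm_real, Real.norm_of_nonneg (le_max_right _ _)]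
    exact max_le ((sub_le_sub_right ht _).trans (norm_sub_norm_le _ _)) (norm_nonneg _)
  have hzero : X.fnrm excess = 0 :=
    nonpos_iff_eq_zero.1 (ge_of_tendsto (tendsto_iff_edist_tendsto_0.1 hu) hexcess)
  filter_upwards [ae_eq_zero_of_fnrm_eq_zero hzero] with t ht
  simpa [excess] using ht

theorem IsBanachFunctionSpace.exists_forall_norm_le (hX : IsBanachFunctionSpace X)
    {u : ℕ → X.space} (hu : Summable fun n => ‖u n‖) :
    ∃ F : X.space, ∀ n, ∀ᵐ t ∂m, ‖(u n : L0) t‖ ≤ ‖(F : L0) t‖ := by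
  have := hX.complete
  have habs n : X.fnrm (fun t => (‖(u n : L0) t‖ : ℂ)) = ‖u n‖ₑ :=
    (hX.fnrm_ofReal_norm (u n : L0).aestronglyMeasurable).trans
      (enorm_eq_fnrm _ (ae_eq_refl _)).symm
  let v (n : ℕ) : X.space := X.toSpace _ ((habs n).trans_lt enorm_lt_top)
  have hv : Summable v := .of_norm <| hu.congr fun n => by
    rw [← toReal_enorm, ← toReal_enorm (v n), enorm_toSpace, habs]
  have hsum k : ((∑ n ∈ Finset.range k, v n : X.space) : L0) =ᵐ[m]
      fun t => ((∑ n ∈ Finset.range k, ‖(u n : L0) t‖ : ℝ) : ℂ) := by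
    induction k with
    | zero =>
      simp only [Finset.range_zero, Finset.sum_empty, Complex.ofReal_zero]
      exact AEEqFun.coeFn_zero
    | succ k ih =>
      filter_upwards [ih, coeFn_toSpace ((habs k).trans_lt enorm_lt_top),
        AEEqFun.coeFn_add ((∑ n ∈ Finset.range k, v n : X.space) : L0) (v k)] with t ht hvt hadd
      rw [Finset.sum_range_succ, Finset.sum_range_succ, Submodule.coe_add, hadd, Pi.add_apply, ht,
        hvt, Complex.ofReal_add]
  refine ⟨∑' n, v n, fun n => hX.ae_norm_le_of_tendsto hv.hasSum.tendsto_sum_nat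
    (u n : L0).aestronglyMeasurable ((eventually_gt_atTop n).mono fun k hk => ?_)⟩
  filter_upwards [hsum k] with t ht
  rw [ht, Complex.norm_real, Real.norm_of_nonneg (by positivity)]
  exact Finset.single_le_sum (f := fun n => ‖(u n : L0) t‖) (fun _ _ => norm_nonneg _)
    (Finset.mem_range.2 hk)

theorem IsBanachFunctionSpace.multiplierNorm_lt_top (hX : IsBanachFunctionSpace X)
    (hY : IsBanachFunctionSpace Y) {a : L0} (ha : a ∈ multipliers X Y) :
    multiplierNorm X Y a < ∞ := by
  by_contra! htop
  have hbig (n : ℕ) : ∃ g : L0, X.nrm g ≤ 1 ∧ (2 ^ n * n : ℝ≥0∞) < Y.nrm (a * g) := by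
    have h : (2 ^ n * n : ℝ≥0∞) < multiplierNorm X Y a :=
      (ENNReal.mul_lt_top (by simp) (by simp)).trans_le htop
    obtain ⟨g, hg⟩ := lt_iSup_iff.1 h
    obtain ⟨hg1, hg⟩ := lt_iSup_iff.1 hg
    exact ⟨g, hg1, hg⟩
  choose g hg hag using hbig
  let u (n : ℕ) : X.space := ((2 : ℂ)⁻¹ ^ n) • ⟨g n, (hg n).trans_lt ENNReal.one_lt_top⟩
  have hu : Summable fun n => ‖u n‖ := by
    refine .of_nonneg_of_le (fun _ => norm_nonneg _) (fun n => ?_) summable_geometric_two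
    rw [norm_smul, norm_pow, norm_inv, RCLike.norm_ofNat, one_div]
    exact mul_le_of_le_one_right (by positivity) (ENNReal.toReal_le_of_le_ofReal zero_le_one
      (by simpa using hg n))
  obtain ⟨F, hF⟩ := hX.exists_forall_norm_le hu
  have hle (n : ℕ) : (n : ℝ≥0∞) ≤ Y.nrm (a * F) := by
    have hideal : Y.nrm (a * (u n : L0)) ≤ Y.nrm (a * F) := by
      refine (hY.ideal _ _ (ha _ F.2) ?_).2
      filter_upwards [hF n, AEEqFun.coeFn_mul a (u n : L0), AEEqFun.coeFn_mul a (F : L0)]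
        with t ht h1 h2
      rw [h1, h2, Pi.mul_apply, Pi.mul_apply, norm_mul, norm_mul]
      gcongr
    have hsmul : a * (u n : L0) = ((2 : ℂ)⁻¹ ^ n) • (a * g n) := mul_smul_L0 _ _ _
    calc (n : ℝ≥0∞) = (2⁻¹ : ℝ≥0∞) ^ n * (2 ^ n * n) := by
          rw [← mul_assoc, ← mul_pow, ENNReal.inv_mul_cancel two_ne_zero ENNReal.ofNat_ne_top,
            one_pow, one_mul]
      _ ≤ (2⁻¹ : ℝ≥0∞) ^ n * Y.nrm (a * g n) := by gcongr; exact (hag n).le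
      _ = Y.nrm (a * (u n : L0)) := by
          rw [hsmul, Y.nrm_smul, enorm_pow, enorm_inv two_ne_zero, ← ofReal_norm (2 : ℂ)]; simp
      _ ≤ Y.nrm (a * F) := hideal
  obtain ⟨n, hn⟩ := ENNReal.exists_nat_gt (ha _ F.2).ne
  exact (hle n).not_gt hn

theorem nrm_apply_le_iSup_mul {T : L0 → L0} (hT : ∀ (c : ℂ) g, T (c • g) = c • T g) {g : L0}
    (hg : X.nrm g < ∞) : Y.nrm (T g) ≤ (⨆ (g : L0) (_ : X.nrm g ≤ 1), Y.nrm (T g)) * X.nrm g := by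
  rcases eq_or_ne (X.nrm g) 0 with h0 | h0
  · have hT0 : T 0 = 0 := by
      rw [← zero_smul ℂ (0 : L0), hT, zero_smul ℂ (T 0), zero_smul ℂ (0 : L0)]
    rw [X.eq_zero_of_nrm g h0, hT0, Y.nrm_zero]
    exact zero_le
  let c : ℂ := ((X.nrm g).toReal : ℂ)
  have hc : ‖c‖ₑ = X.nrm g := by
    rw [← ofReal_norm, Complex.norm_real, Real.norm_of_nonneg ENNReal.toReal_nonneg]
    exact ENNReal.ofReal_toReal hg.ne
  have hc0 : c ≠ 0 := fun h => h0 (by rw [← hc, h, enorm_zero])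
  have hunit : X.nrm (c⁻¹ • g) ≤ 1 := by
    rw [X.nrm_smul, enorm_inv hc0, hc, ENNReal.inv_mul_cancel h0 hg.ne]
  calc Y.nrm (T g) = Y.nrm (c • T (c⁻¹ • g)) := by rw [← hT, smul_inv_smul₀ hc0]
    _ = Y.nrm (T (c⁻¹ • g)) * X.nrm g := by rw [Y.nrm_smul, hc, mul_comm]
    _ ≤ (⨆ (g : L0) (_ : X.nrm g ≤ 1), Y.nrm (T g)) * X.nrm g := by
      gcongr
      exact le_iSup₂_of_le (f := fun (g : L0) (_ : X.nrm g ≤ 1) => Y.nrm (T g)) _ hunit le_rfl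

theorem nrm_mul_le_multiplierNorm_mul {a g : L0} (hg : g ∈ X.space) :
    Y.nrm (a * g) ≤ multiplierNorm X Y a * X.nrm g :=
  nrm_apply_le_iSup_mul (mul_smul_L0 a) hg

/-- Multiplication by `a ∈ M(X, Y)` as a bounded operator. -/
def mulCLM (hX : IsBanachFunctionSpace X) (hY : IsBanachFunctionSpace Y) {a : L0}
    (ha : a ∈ multipliers X Y) : X.space →L[ℂ] Y.space :=
  LinearMap.mkContinuous
    { toFun := fun g => ⟨a * g, ha g g.2⟩
      map_add' := fun f g => Subtype.ext (mul_add_L0 a f g)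
      map_smul' := fun c g => Subtype.ext (mul_smul_L0 a c g) }
    (multiplierNorm X Y a).toReal fun g => by
      have h := nrm_mul_le_multiplierNorm_mul (Y := Y) (a := a) g.2
      have htop := ENNReal.mul_ne_top (hX.multiplierNorm_lt_top hY ha).ne g.2.ne
      exact (ENNReal.toReal_mono htop h).trans_eq ENNReal.toReal_mul

/-! ### Fourier coefficients -/

theorem pairing_χ (f : L0) (n : ℤ) : pairing f (χ n) = fourierCoeff f n := by
  refine integral_congr_ae ?_
  filter_upwards [coeFn_χ n] with t ht
  rw [ht, fourier_neg, smul_eq_mul, mul_comm]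

theorem norm_fourier_apply (n : ℤ) (t : 𝕋) : ‖fourier n t‖ = 1 := by
  rw [fourier_apply, Circle.norm_coe]

theorem fourierCoeff_fourier_mul (f : 𝕋 → ℂ) (n k : ℤ) :
    fourierCoeff (fun t => fourier n t * f t) k = fourierCoeff f (k - n) := by
  refine integral_congr_ae (ae_of_all _ fun t => ?_)
  simp only [smul_eq_mul]
  rw [← mul_assoc, ← fourier_add, neg_sub, neg_add_eq_sub]

theorem integrable_trigPoly_mul (hf : Integrable f m) (d : ℤ →₀ ℂ) :
    Integrable (fun t => trigPoly d t * f t) m :=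
  hf.bdd_mul (aestronglyMeasurable_continuousMap _)
    (ae_of_all _ fun t => (trigPoly d).norm_coe_le_norm t)

theorem fourierCoeff_trigPoly_mul (hf : Integrable f m) (d : ℤ →₀ ℂ) (k : ℤ) :
    fourierCoeff (fun t => trigPoly d t * f t) k = d.sum fun j z => z * fourierCoeff f (k - j) := by
  induction d using Finsupp.induction_linear with
  | zero => simp [fourierCoeff]
  | add d e hd he =>
    have h : (fun t => trigPoly (d + e) t * f t) =
        (fun t => trigPoly d t * f t) + fun t => trigPoly e t * f t := by
      ext t; simp [add_mul]
    rw [h, fourierCoeff.add (integrable_trigPoly_mul hf d) (integrable_trigPoly_mul hf e),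
      Pi.add_apply, hd, he, Finsupp.sum_add_index' (by simp) (by intros; ring)]
  | single n z =>
    have h : (fun t => trigPoly (Finsupp.single n z) t * f t) =
        z • fun t => fourier n t * f t := by
      ext t; simp [trigPoly_single, mul_assoc]
    rw [h, fourierCoeff.const_smul, fourierCoeff_fourier_mul, Finsupp.sum_single_index (by simp),
      smul_eq_mul]

theorem fourierCoeff_trigPoly (c : ℤ →₀ ℂ) (n : ℤ) : fourierCoeff (trigPoly c) n = c n := by
  have h := fourierCoeff_trigPoly_mul (integrable_continuousMap (fourier 0)) c n
  simp only [fourier_zero, mul_one] at h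
  rw [h, Finsupp.sum, Finset.sum_eq_single n]
  · simp [fourierCoeff_fourier]
  · intro k _ hk
    simp [fourierCoeff_fourier, sub_eq_zero, hk.symm]
  · intro hn
    simp [Finsupp.notMem_support_iff.1 hn]

theorem ae_eq_zero_of_fourierCoeff (hf : Integrable f m) (h : ∀ n, fourierCoeff f n = 0) :
    f =ᵐ[m] 0 := by
  refine hf.ae_eq_zero_of_forall_setIntegral_eq_zero fun s hs _ => ?_
  let e : 𝕋 → ℂ := s.indicator 1
  -- the indicator of `s` is a boundedly convergent limit of trigonometric polynomials
  obtain ⟨c, hc, hlim⟩ := exists_trigPoly_tendsto_ae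
    ((aestronglyMeasurable_one (μ := m)).indicator hs : AEStronglyMeasurable e m) one_pos
    (ae_of_all _ fun t => (norm_indicator_le_norm_self _ _).trans (by simp))
  have hzero n : ∫ t, trigPoly (c n) t * f t ∂m = 0 := by
    have hsum := fourierCoeff_trigPoly_mul hf (c n) 0
    simp only [h, mul_zero, Finsupp.sum, Finset.sum_const_zero] at hsum
    simpa [fourierCoeff] using hsum
  have htend : Tendsto (fun n => ∫ t, trigPoly (c n) t * f t ∂m) atTop (𝓝 (∫ t, e t * f t ∂m)) :=
    tendsto_integral_of_dominated_convergence (fun t => (1 + 1) * ‖f t‖)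
      (fun n => (integrable_trigPoly_mul hf _).aestronglyMeasurable) (hf.norm.const_mul _)
      (fun n => ae_of_all _ fun t => by rw [norm_mul]; gcongr; exact hc n t)
      (hlim.mono fun t ht => ht.mul_const _)
  simp only [hzero] at htend
  rw [← integral_indicator hs, tendsto_nhds_unique tendsto_const_nhds htend]
  congr 1 with t
  by_cases ht : t ∈ s <;> simp [e, ht]

theorem ae_eq_of_fourierCoeff (hf : Integrable f m) (hg : Integrable g m)
    (h : ∀ n, fourierCoeff f n = fourierCoeff g n) : f =ᵐ[m] g := by
  refine (ae_eq_zero_of_fourierCoeff (hf.sub hg) fun n => ?_).mono fun t ht => sub_eq_zero.1 ht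
  rw [sub_eq_add_neg, ← neg_one_smul ℂ g, fourierCoeff.add hf (hg.smul _), Pi.add_apply,
    fourierCoeff.const_smul, h]
  simp

theorem norm_fourierCoeff_le (f : 𝕋 → ℂ) (n : ℤ) : ‖fourierCoeff f n‖ ≤ ∫ t, ‖f t‖ ∂m := by
  refine (norm_integral_le_integral_norm _).trans_eq (integral_congr_ae (ae_of_all _ fun t => ?_))
  simp only [norm_smul, norm_fourier_apply, one_mul]

/-- The `n`-th Fourier coefficient as a continuous functional on `L¹`. -/
def fourierCoeffL1 (n : ℤ) : Lp ℂ 1 m →L[ℂ] ℂ :=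
  LinearMap.mkContinuous
    { toFun := fun f => fourierCoeff f n
      map_add' := fun f g => by
        rw [fourierCoeff_congr_ae (Lp.coeFn_add f g),
          fourierCoeff.add (L1.integrable_coeFn f) (L1.integrable_coeFn g), Pi.add_apply]
      map_smul' := fun c f => by
        rw [fourierCoeff_congr_ae (Lp.coeFn_smul c f), fourierCoeff.const_smul]; rfl }
    1 fun f => by
      rw [one_mul, L1.norm_eq_integral_norm]
      exact norm_fourierCoeff_le _ _

@[simp]
theorem fourierCoeffL1_apply (n : ℤ) (f : Lp ℂ 1 m) : fourierCoeffL1 n f = fourierCoeff f n := rfl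

/-! ### Spaces continuously embedded in `L¹` -/

/-- `X` is continuously embedded in `L¹`. -/
def EmbedsInL1 (X : FunctionSpace) : Prop :=
  ∃ C : NNReal, ∀ f : X.space, eLpNorm (f : L0) 1 m ≤ C * ‖f‖ₑ

namespace EmbedsInL1

theorem integrable (hL : EmbedsInL1 X) (f : X.space) : Integrable (f : L0) m := by
  obtain ⟨C, hC⟩ := hL
  exact memLp_one_iff_integrable.1 ⟨(f : L0).aestronglyMeasurable,
    (hC f).trans_lt (ENNReal.mul_lt_top ENNReal.coe_lt_top enorm_lt_top)⟩

theorem integrable_of_fnrm_lt_top (hL : EmbedsInL1 X) (hf : X.fnrm f < ∞) : Integrable f m :=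
  (hL.integrable (X.toSpace f hf)).congr (coeFn_toSpace hf)

/-- The embedding of `X` in `L¹`. -/
def toL1 (hL : EmbedsInL1 X) : X.space →L[ℂ] Lp ℂ 1 m :=
  LinearMap.mkContinuousOfExistsBound
    { toFun := fun f => ⟨f, (memLp_one_iff_integrable.2 (hL.integrable f)).2⟩
      map_add' := fun _ _ => rfl
      map_smul' := fun _ _ => rfl } <| by
    obtain ⟨C, hC⟩ := hL
    refine ⟨C, fun f => ?_⟩
    have h := ENNReal.toReal_mono (ENNReal.mul_ne_top ENNReal.coe_ne_top enorm_ne_top) (hC f)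
    rwa [ENNReal.toReal_mul, ENNReal.coe_toReal, toReal_enorm] at h

/-- The `n`-th Fourier coefficient as a continuous functional on `X`. -/
def coeff (hL : EmbedsInL1 X) (n : ℤ) : X.space →L[ℂ] ℂ := (fourierCoeffL1 n).comp hL.toL1

theorem coeff_apply (hL : EmbedsInL1 X) (n : ℤ) (f : X.space) :
    hL.coeff n f = fourierCoeff (f : L0) n := rfl

theorem ext (hL : EmbedsInL1 X) {f g : X.space}
    (h : ∀ n, fourierCoeff (f : L0) n = fourierCoeff (g : L0) n) : f = g :=
  Subtype.ext (AEEqFun.ext (ae_eq_of_fourierCoeff (hL.integrable f) (hL.integrable g) h))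

theorem exists_seq_tendsto_ae (hL : EmbedsInL1 X) {u : ℕ → X.space} {f : X.space}
    (hu : Tendsto u atTop (𝓝 f)) :
    ∃ ns : ℕ → ℕ, StrictMono ns ∧
      ∀ᵐ t ∂m, Tendsto (fun i => (u (ns i) : L0) t) atTop (𝓝 ((f : L0) t)) :=
  (tendstoInMeasure_of_tendsto_Lp ((hL.toL1.continuous.tendsto f).comp hu)).exists_seq_tendsto_ae

theorem of_le (hL : EmbedsInL1 Y) (hX : IsBanachFunctionSpace X) (hY : IsBanachFunctionSpace Y)
    (hXY : X.space ≤ Y.space) : EmbedsInL1 X := by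
  have hone : (1 : L0) ∈ multipliers X Y := fun g hg => by rw [one_mul]; exact hXY hg
  have htop := (hX.multiplierNorm_lt_top hY hone).ne
  obtain ⟨C, hC⟩ := hL
  refine ⟨C * (multiplierNorm X Y 1).toNNReal, fun f => (hC ⟨f, hXY f.2⟩).trans ?_⟩
  rw [ENNReal.coe_mul, ENNReal.coe_toNNReal htop, mul_assoc, enorm_eq_nrm, enorm_eq_nrm]
  gcongr
  simpa only [one_mul] using nrm_mul_le_multiplierNorm_mul (Y := Y) (a := 1) f.2

end EmbedsInL1

/-! ### Trigonometric polynomials in a Banach function space -/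

/-- A continuous function as an element of `X`. -/
def ofContinuous (hX : IsBanachFunctionSpace X) : C(𝕋, ℂ) →ₗ[ℂ] X.space :=
  (ContinuousMap.toAEEqFunLinearMap m).codRestrict X.space fun g =>
    ((fnrm_coe _).symm.trans (fnrm_congr (ContinuousMap.coeFn_toAEEqFun m g))).trans_lt
      (hX.fnrm_continuousMap_lt_top g)

theorem coeFn_ofContinuous (hX : IsBanachFunctionSpace X) (g : C(𝕋, ℂ)) :
    ((ofContinuous hX g : L0) : 𝕋 → ℂ) =ᵐ[m] g := ContinuousMap.coeFn_toAEEqFun m g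

/-- The trigonometric polynomial with coefficients `c` as an element of `X`. -/
def trigSpace (hX : IsBanachFunctionSpace X) : (ℤ →₀ ℂ) →ₗ[ℂ] X.space :=
  (ofContinuous hX).comp trigPoly

theorem coeFn_trigSpace (hX : IsBanachFunctionSpace X) (c : ℤ →₀ ℂ) :
    ((trigSpace hX c : L0) : 𝕋 → ℂ) =ᵐ[m] trigPoly c := coeFn_ofContinuous hX _

theorem coe_trigSpace_single (hX : IsBanachFunctionSpace X) (n : ℤ) :
    (trigSpace hX (Finsupp.single n 1) : L0) = χ n := by
  simp only [trigSpace, LinearMap.comp_apply, trigPoly_single, one_smul]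
  rfl

theorem enorm_trigSpace (hX : IsBanachFunctionSpace X) (c : ℤ →₀ ℂ) :
    ‖trigSpace hX c‖ₑ = X.fnrm (trigPoly c) := enorm_eq_fnrm _ (coeFn_trigSpace hX c)

theorem fourierCoeff_trigSpace (hX : IsBanachFunctionSpace X) (c : ℤ →₀ ℂ) (n : ℤ) :
    fourierCoeff (trigSpace hX c : L0) n = c n := by
  rw [fourierCoeff_congr_ae (coeFn_trigSpace hX c), fourierCoeff_trigPoly]

theorem denseRange_trigSpace [TopologicalSpace.SeparableSpace X.space]
    (hX : IsBanachFunctionSpace X) : DenseRange (trigSpace hX) := by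
  intro f
  refine EMetric.mem_closure_iff.2 fun ε hε => ?_
  obtain ⟨δ, hδ, hδε⟩ := exists_between hε
  obtain ⟨c, hc⟩ :=
    (hX.hasAbsContNorm_of_separableSpace (fnrm_lt_top f)).exists_fnrm_sub_trigPoly_le
      (hX.hasAbsContNorm_of_separableSpace hX.fnrm_one_lt_top) hX hδ
  refine ⟨trigSpace hX c, ⟨c, rfl⟩, ?_⟩
  rw [edist_eq_fnrm_sub (ae_eq_refl _) (coeFn_trigSpace hX c)]
  exact hc.trans_lt hδε

/-! ### Dilations and the Boyd indices -/

/-- The angle divided by `2π`, a point of `[0, 1)`. -/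
def unitAngle (t : 𝕋) : ℝ := angle t / (2 * Real.pi)

theorem measurable_unitAngle : Measurable unitAngle := measurable_angle.div_const _

theorem unitAngle_mem (t : 𝕋) : unitAngle t ∈ Set.Ico (0 : ℝ) 1 := by
  have h := (AddCircle.equivIco (2 * Real.pi) 0 t).2
  exact ⟨div_nonneg h.1 Real.two_pi_pos.le,
    (div_lt_one Real.two_pi_pos).2 (h.2.trans_eq (zero_add _))⟩

/-- The point `e^{2πix}` of the circle. -/
def ofUnitAngle (x : ℝ) : 𝕋 := (2 * Real.pi * x : ℝ)

theorem unitAngle_ofUnitAngle {x : ℝ} (hx : x ∈ Set.Ico (0 : ℝ) 1) :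
    unitAngle (ofUnitAngle x) = x := by
  have hx' : 2 * Real.pi * x ∈ Set.Ico 0 (0 + 2 * Real.pi) :=
    ⟨by have := hx.1; positivity, by
      rw [zero_add]; exact mul_lt_of_lt_one_right Real.two_pi_pos hx.2⟩
  rw [unitAngle, ofUnitAngle, angle, AddCircle.equivIco_coe_eq hx']
  exact mul_div_cancel_left₀ _ Real.two_pi_pos.ne'

theorem ofUnitAngle_unitAngle (t : 𝕋) : ofUnitAngle (unitAngle t) = t := by
  rw [ofUnitAngle, unitAngle, mul_div_cancel₀ _ Real.two_pi_pos.ne']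
  exact (AddCircle.equivIco (2 * Real.pi) 0).symm_apply_apply t

theorem measurePreserving_ofUnitAngle :
    MeasurePreserving ofUnitAngle (volume.restrict (Set.Ico 0 1)) m := by
  have hpi := Real.two_pi_pos
  have hscale : Measure.map (2 * Real.pi * ·) (volume.restrict (Set.Ioc 0 1)) =
      ENNReal.ofReal (2 * Real.pi)⁻¹ • volume.restrict (Set.Ioc 0 (0 + 2 * Real.pi)) := by
    have hpre : (2 * Real.pi * ·) ⁻¹' Set.Ioc 0 (0 + 2 * Real.pi) = Set.Ioc (0 : ℝ) 1 := by
      ext x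
      simp [hpi]
    rw [← hpre, ← Measure.restrict_map (measurable_const_mul _) measurableSet_Ioc,
      Real.map_volume_mul_left hpi.ne', abs_of_pos (inv_pos.2 hpi), Measure.restrict_smul]
  have hmk := (AddCircle.measurePreserving_mk (2 * Real.pi) 0).map_eq
  rw [AddCircle.volume_eq_smul_haarAddCircle] at hmk
  refine ⟨AddCircle.measurable_mk'.comp (measurable_const_mul _), ?_⟩
  rw [restrict_Ico_eq_restrict_Ioc, show ofUnitAngle = (↑) ∘ (2 * Real.pi * ·) from rfl,
    ← Measure.map_map AddCircle.measurable_mk' (measurable_const_mul _), hscale, Measure.map_smul,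
    hmk, smul_smul, ← ENNReal.ofReal_mul (inv_pos.2 hpi).le, inv_mul_cancel₀ hpi.ne',
    ENNReal.ofReal_one, one_smul]

theorem measurePreserving_unitAngle :
    MeasurePreserving unitAngle m (volume.restrict (Set.Ico 0 1)) := by
  refine ⟨measurable_unitAngle, ?_⟩
  rw [← measurePreserving_ofUnitAngle.map_eq,
    Measure.map_map measurable_unitAngle measurePreserving_ofUnitAngle.measurable]
  refine (Measure.map_congr ?_).trans Measure.map_id
  exact (ae_restrict_mem measurableSet_Ico).mono fun x hx => unitAngle_ofUnitAngle hx

/-- The arc of measure `x` starting at `1`. -/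
def initialArc (x : ℝ) : Set 𝕋 := {t | unitAngle t < x}

theorem measurableSet_initialArc (x : ℝ) : MeasurableSet (initialArc x) :=
  measurable_unitAngle measurableSet_Iio

theorem measure_initialArc {x : ℝ} (hx : x ≤ 1) : m (initialArc x) = ENNReal.ofReal x := by
  have h := measurePreserving_unitAngle.measure_preimage (s := Set.Iio x)
    measurableSet_Iio.nullMeasurableSet
  have hinter : Set.Iio x ∩ Set.Ico 0 1 = Set.Ico 0 x := by
    rw [Set.inter_comm, Set.Ico_inter_Iio, min_eq_right hx]
  rwa [Measure.restrict_apply measurableSet_Iio, hinter, Real.volume_Ico, sub_zero] at h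

theorem dilationFun_eq {s : ℝ} (hs : 0 < s) (f : 𝕋 → ℂ) (t : 𝕋) :
    dilationFun s f t = if s * unitAngle t < 1 then f (ofUnitAngle (s * unitAngle t)) else 0 := by
  have hangle : s * angle t = 2 * Real.pi * (s * unitAngle t) := by
    rw [unitAngle]; field_simp
  have hpos : 0 ≤ s * angle t := by
    rw [hangle]
    exact mul_nonneg Real.two_pi_pos.le (mul_nonneg hs.le (unitAngle_mem t).1)
  have hiff : s * angle t ∈ Set.Ico 0 (2 * Real.pi) ↔ s * unitAngle t < 1 := by
    rw [Set.mem_Ico, and_iff_right hpos, hangle, mul_lt_iff_lt_one_right Real.two_pi_pos]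
  rw [dilationFun, ofUnitAngle, ← hangle]
  exact if_congr hiff rfl rfl

theorem dilationFun_comp_unitAngle {s : ℝ} (hs : 0 < s) (φ : ℝ → ℂ) (t : 𝕋) :
    dilationFun s (fun t => φ (unitAngle t)) t =
      if s * unitAngle t < 1 then φ (s * unitAngle t) else 0 := by
  rw [dilationFun_eq hs]
  split_ifs with h
  · rw [unitAngle_ofUnitAngle ⟨mul_nonneg hs.le (unitAngle_mem t).1, h⟩]
  · rfl

theorem dilationFun_congr {s : ℝ} (hs : 0 < s) (h : f =ᵐ[m] g) :
    dilationFun s f =ᵐ[m] dilationFun s g := by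
  have hunit : ∀ᵐ x : ℝ, x ∈ Set.Ico (0 : ℝ) 1 → f (ofUnitAngle x) = g (ofUnitAngle x) :=
    (ae_restrict_iff' measurableSet_Ico).1
      (measurePreserving_ofUnitAngle.quasiMeasurePreserving.ae h)
  have hmul : Measure.QuasiMeasurePreserving (s * · : ℝ → ℝ) volume volume :=
    ⟨measurable_const_mul s, by
      rw [Real.map_volume_mul_left hs.ne']; exact Measure.smul_absolutelyContinuous⟩
  have hscale : ∀ᵐ x : ℝ, s * x ∈ Set.Ico (0 : ℝ) 1 →
      f (ofUnitAngle (s * x)) = g (ofUnitAngle (s * x)) := hmul.ae hunit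
  filter_upwards [measurePreserving_unitAngle.quasiMeasurePreserving.ae
    (ae_restrict_of_ae hscale)] with t ht
  rw [dilationFun_eq hs, dilationFun_eq hs]
  split_ifs with hlt
  · exact ht ⟨mul_nonneg hs.le (unitAngle_mem t).1, hlt⟩
  · rfl

theorem coeFn_dilation {s : ℝ} (hs : 0 < s) {F : L0} (h : F =ᵐ[m] f) :
    dilation s F =ᵐ[m] dilationFun s f :=
  (AEEqFun.coeFn_mk _ _).trans (dilationFun_congr hs h)

theorem dilation_smul {s : ℝ} (hs : 0 < s) (c : ℂ) (F : L0) :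
    dilation s (c • F) = c • dilation s F := by
  refine AEEqFun.ext ((coeFn_dilation hs (AEEqFun.coeFn_smul c F)).trans ?_)
  filter_upwards [AEEqFun.coeFn_smul c (dilation s F), coeFn_dilation hs (ae_eq_refl F)]
    with t h1 h2
  rw [h1, Pi.smul_apply, h2, dilationFun, dilationFun]
  split_ifs
  · rfl
  · exact (smul_zero c).symm

theorem fnrm_dilationFun_le {s : ℝ} (hs : 0 < s) (hf : X.fnrm f < ∞) :
    X.fnrm (dilationFun s f) ≤ dilationNorm X s * X.fnrm f := by
  have hfm := aestronglyMeasurable_of_fnrm_lt_top hf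
  rw [← fnrm_congr (coeFn_dilation hs (AEEqFun.coeFn_mk f hfm)), fnrm_coe]
  rw [fnrm_eq_nrm_mk hfm] at hf ⊢
  exact nrm_apply_le_iSup_mul (dilation_smul hs) hf

theorem le_ofReal_rpow_of_log_le {N : ℝ≥0∞} {s c : ℝ} (hs : 0 < s) (hN : Real.log N.toReal ≠ 0)
    (h : Real.log N.toReal ≤ c * Real.log s) : N ≤ ENNReal.ofReal (s ^ c) := by
  have hpos : 0 < N.toReal := ENNReal.toReal_nonneg.lt_of_ne fun h0 => hN (by simp [← h0])
  refine (ENNReal.le_ofReal_iff_toReal_le (ENNReal.toReal_pos_iff.1 hpos).2.ne (by positivity)).2 ?_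
  rwa [← Real.log_le_log_iff hpos (by positivity), Real.log_rpow hs]

theorem HasNontrivialBoydIndices.exists_dilationNorm_le_atTop (hB : HasNontrivialBoydIndices X) :
    ∃ b ∈ Set.Ioo (0 : ℝ) 1, ∀ᶠ s : ℝ in atTop,
      dilationNorm X (1 / s) ≤ ENNReal.ofReal (s ^ b) := by
  obtain ⟨-, -, β, hβ, -, hlim⟩ := hB
  obtain ⟨b, hβb, hb⟩ := exists_between hβ.2
  refine ⟨b, ⟨hβ.1.trans hβb, hb⟩, ?_⟩
  filter_upwards [hlim.eventually (Ioo_mem_nhds hβ.1 hβb), eventually_gt_atTop 1] with s hs hs1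
  have hlog := Real.log_pos hs1
  exact le_ofReal_rpow_of_log_le (one_pos.trans hs1)
    ((div_pos_iff_of_pos_right hlog).1 hs.1).ne' ((div_lt_iff₀ hlog).1 hs.2).le

theorem HasNontrivialBoydIndices.exists_dilationNorm_le_nhdsGT (hB : HasNontrivialBoydIndices X) :
    ∃ a ∈ Set.Ioo (0 : ℝ) 1, ∀ᶠ s : ℝ in 𝓝[>] 0,
      dilationNorm X (1 / s) ≤ ENNReal.ofReal (s ^ a) := by
  obtain ⟨α, hα, -, -, hlim, -⟩ := hB
  obtain ⟨a, ha, haα⟩ := exists_between hα.1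
  refine ⟨a, ⟨ha, haα.trans hα.2⟩, ?_⟩
  filter_upwards [hlim.eventually (lt_mem_nhds haα), Ioo_mem_nhdsGT one_pos] with s hs hs1
  have hlog := Real.log_neg hs1.1 hs1.2
  have hle := (lt_div_iff_of_neg hlog).1 hs
  exact le_ofReal_rpow_of_log_le hs1.1 (hle.trans (mul_neg_of_pos_of_neg ha hlog)).ne hle.le

/-! ### Decreasing rearrangements -/

section DecreasingRearrangement

variable {α E : Type*} [MeasurableSpace α] {μ : Measure α} [NormedAddCommGroup E] {u v : α → E}

/-- The decreasing rearrangement `f*` of `‖f‖ₑ`; its value at `0` is the essential supremum. -/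
def decreasingRearrangement (μ : Measure α) (u : α → E) (x : ℝ≥0∞) : ℝ≥0∞ :=
  sInf {r | μ {t | r < ‖u t‖ₑ} ≤ x}

theorem measure_decreasingRearrangement_lt_le (μ : Measure α) (u : α → E) (x : ℝ≥0∞) :
    μ {t | decreasingRearrangement μ u x < ‖u t‖ₑ} ≤ x := by
  obtain ⟨r, hr, hlim, hmem⟩ := exists_seq_tendsto_sInf
    (S := {r | μ {t | r < ‖u t‖ₑ} ≤ x}) ⟨⊤, by simp⟩ (OrderBot.bddBelow _)
  have hsub : {t | decreasingRearrangement μ u x < ‖u t‖ₑ} ⊆ ⋃ n, {t | r n < ‖u t‖ₑ} :=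
    fun t ht => Set.mem_iUnion.2 (hlim.eventually (gt_mem_nhds ht)).exists
  have hmono : Monotone fun n => {t | r n < ‖u t‖ₑ} := fun i j hij t ht => (hr hij).trans_lt ht
  exact (measure_mono hsub).trans (hmono.measure_iUnion.trans_le (iSup_le hmem))

theorem decreasingRearrangement_le_iff {x r : ℝ≥0∞} :
    decreasingRearrangement μ u x ≤ r ↔ μ {t | r < ‖u t‖ₑ} ≤ x :=
  ⟨fun h => (measure_mono fun _ ht => h.trans_lt ht).trans
    (measure_decreasingRearrangement_lt_le μ u x), fun h => sInf_le h⟩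

theorem decreasingRearrangement_antitone : Antitone (decreasingRearrangement μ u) :=
  fun _ _ hxy => decreasingRearrangement_le_iff.2
    ((measure_decreasingRearrangement_lt_le μ u _).trans hxy)

theorem decreasingRearrangement_congr (h : u =ᵐ[μ] v) (x : ℝ≥0∞) :
    decreasingRearrangement μ u x = decreasingRearrangement μ v x := by
  have hset (r : ℝ≥0∞) : μ {t | r < ‖u t‖ₑ} = μ {t | r < ‖v t‖ₑ} :=
    measure_congr (h.fun_comp fun y => r < ‖y‖ₑ)
  simp only [decreasingRearrangement, hset]

theorem decreasingRearrangement_add_le (x y : ℝ≥0∞) :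
    decreasingRearrangement μ (u + v) (x + y) ≤
      decreasingRearrangement μ u x + decreasingRearrangement μ v y := by
  refine decreasingRearrangement_le_iff.2 ?_
  refine (measure_mono fun t ht => ?_).trans ((measure_union_le _ _).trans
    (add_le_add (measure_decreasingRearrangement_lt_le μ u x)
      (measure_decreasingRearrangement_lt_le μ v y)))
  by_contra! hcon
  simp only [Set.mem_union, Set.mem_ofPred_eq, not_or, not_lt] at hcon
  exact ht.not_ge ((enorm_add_le _ _).trans (add_le_add hcon.1 hcon.2))

theorem decreasingRearrangement_eq_zero {x : ℝ≥0∞} (hx : μ Set.univ ≤ x) :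
    decreasingRearrangement μ u x = 0 :=
  nonpos_iff_eq_zero.1 (decreasingRearrangement_le_iff.2
    ((measure_mono (Set.subset_univ _)).trans hx))

theorem decreasingRearrangement_ne_top [IsFiniteMeasure μ] (hu : AEStronglyMeasurable u μ)
    {x : ℝ≥0∞} (hx : x ≠ 0) : decreasingRearrangement μ u x ≠ ∞ := by
  have hlim := tendsto_measure_iInter_atTop (μ := μ) (s := fun n : ℕ => {t | (n : ℝ≥0∞) < ‖u t‖ₑ})
    (fun n => nullMeasurableSet_lt aemeasurable_const hu.enorm)
    (fun i j hij t (ht : (j : ℝ≥0∞) < _) => (Nat.cast_le.2 hij).trans_lt ht) ⟨0, measure_ne_top _ _⟩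
  have hempty : ⋂ n : ℕ, {t | (n : ℝ≥0∞) < ‖u t‖ₑ} = ∅ := by
    ext t
    obtain ⟨n, hn⟩ := ENNReal.exists_nat_gt (enorm_ne_top (x := u t))
    simpa using ⟨n, hn.le⟩
  rw [hempty, measure_empty] at hlim
  obtain ⟨n, hn⟩ := (hlim.eventually (gt_mem_nhds (pos_iff_ne_zero.2 hx))).exists
  exact ne_top_of_le_ne_top (ENNReal.natCast_ne_top n) (decreasingRearrangement_le_iff.2 hn.le)

theorem rpow_mul_decreasingRearrangement_le {p : ℝ} (hp : 0 < p) {K : ℝ≥0∞}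
    (h : ∀ r, r * μ {t | r < ‖u t‖ₑ} ^ (1 / p) ≤ K) (x : ℝ≥0∞) :
    x ^ (1 / p) * decreasingRearrangement μ u x ≤ K := by
  refine ENNReal.mul_le_of_forall_lt fun y hy r hr => ?_
  have hx : x < μ {t | r < ‖u t‖ₑ} := by
    rwa [← not_le, decreasingRearrangement_le_iff, not_le] at hr
  calc y * r ≤ μ {t | r < ‖u t‖ₑ} ^ (1 / p) * r := by
        gcongr
        exact hy.le.trans (ENNReal.rpow_le_rpow hx.le (by positivity))
    _ ≤ K := (mul_comm _ _).trans_le (h r)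

theorem tsum_rpow_le_rpow_tsum {ι : Type*} {p : ℝ} (hp : 1 ≤ p) (a : ι → ℝ≥0∞) :
    ∑' i, a i ^ p ≤ (∑' i, a i) ^ p := by
  have hsplit (x : ℝ≥0∞) : x ^ p = x * x ^ (p - 1) := by
    simpa using ENNReal.rpow_add_of_nonneg (x := x) 1 (p - 1) zero_le_one (by linarith)
  simp only [hsplit]
  rw [← ENNReal.tsum_mul_right]
  refine ENNReal.tsum_le_tsum fun i => mul_le_mul_right ?_ _
  exact ENNReal.rpow_le_rpow (ENNReal.le_tsum i) (sub_nonneg.2 hp)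

theorem eLpNorm'_le_tsum_of_forall_exists {p : ℝ} (hp : 1 ≤ p) {A : ℕ → Set α}
    (hA : ∀ j, NullMeasurableSet (A j) μ) {c : ℕ → ℝ≥0∞}
    (h : ∀ᵐ t ∂μ, u t ≠ 0 → ∃ j, t ∈ A j ∧ ‖u t‖ₑ ≤ c j) :
    eLpNorm' u p μ ≤ ∑' j, c j * μ (A j) ^ (1 / p) := by
  have hp0 : 0 < p := one_pos.trans_le hp
  rw [eLpNorm'_eq_lintegral_enorm, one_div, ENNReal.rpow_inv_le_iff hp0]
  calc ∫⁻ t, ‖u t‖ₑ ^ p ∂μ ≤ ∫⁻ t, ∑' j, (A j).indicator (fun _ => c j ^ p) t ∂μ := by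
        refine lintegral_mono_ae (h.mono fun t ht => ?_)
        by_cases h0 : u t = 0
        · simp [h0, hp0]
        obtain ⟨j, hj, hle⟩ := ht h0
        refine le_trans ?_ (ENNReal.le_tsum j)
        rw [Set.indicator_of_mem hj]
        exact ENNReal.rpow_le_rpow hle hp0.le
    _ = ∑' j, (c j * μ (A j) ^ p⁻¹) ^ p := by
        rw [lintegral_tsum fun j => aemeasurable_const.indicator₀ (hA j)]
        refine tsum_congr fun j => ?_
        rw [lintegral_indicator_const₀ (hA j), ENNReal.mul_rpow_of_nonneg _ _ hp0.le,
          ENNReal.rpow_inv_rpow hp0.ne']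
    _ ≤ _ := tsum_rpow_le_rpow_tsum hp _

theorem eLpNorm'_indicator_lt_le_tsum {p : ℝ} (hp : 1 ≤ p) (hu : AEStronglyMeasurable u μ)
    {R x : ℝ≥0∞} (hR : 1 < R) (hx : x ≠ ∞) :
    eLpNorm' ({t | decreasingRearrangement μ u x < ‖u t‖ₑ}.indicator u) p μ ≤
      ∑' j : ℕ, decreasingRearrangement μ u (R⁻¹ ^ (j + 1) * x) * (R⁻¹ ^ j * x) ^ (1 / p) := by
  set d : ℕ → ℝ≥0∞ := fun j => decreasingRearrangement μ u (R⁻¹ ^ j * x)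
  have hμ (j : ℕ) : μ {t | d j < ‖u t‖ₑ} ≤ R⁻¹ ^ j * x :=
    measure_decreasingRearrangement_lt_le μ u _
  have hnull : μ (⋂ j, {t | d j < ‖u t‖ₑ}) = 0 := by
    have hlim := ENNReal.Tendsto.mul_const
      (ENNReal.tendsto_pow_atTop_nhds_zero_of_lt_one (ENNReal.inv_lt_one.2 hR)) (.inr hx)
    rw [zero_mul] at hlim
    exact nonpos_iff_eq_zero.1 (ge_of_tendsto' hlim fun j =>
      (measure_mono (Set.iInter_subset _ j)).trans (hμ j))
  refine (eLpNorm'_le_tsum_of_forall_exists hp (A := fun j => {t | d j < ‖u t‖ₑ})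
    (fun j => nullMeasurableSet_lt aemeasurable_const hu.enorm) (c := fun j => d (j + 1)) ?_).trans
      (ENNReal.tsum_le_tsum fun j => mul_le_mul_right
        (ENNReal.rpow_le_rpow (hμ j) (by positivity)) _)
  filter_upwards [measure_eq_zero_iff_ae_notMem.1 hnull] with t ht h0
  have hlt : t ∈ {t | decreasingRearrangement μ u x < ‖u t‖ₑ} := Set.mem_of_indicator_ne_zero h0
  obtain ⟨j, hj, hj'⟩ := Nat.exists_not_and_succ_of_not_zero_of_exists
    (p := fun j => ‖u t‖ₑ ≤ d j) (by simpa [d] using hlt) (by simpa using ht)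
  exact ⟨j, not_le.1 hj, by rwa [Set.indicator_of_mem hlt]⟩

theorem eLpNorm'_indicator_le_le_tsum [IsFiniteMeasure μ] {p : ℝ} (hp : 1 ≤ p)
    (hu : AEStronglyMeasurable u μ) {R x : ℝ≥0∞} (hR : 1 < R) (hx : x ≠ 0) :
    eLpNorm' ({t | ‖u t‖ₑ ≤ decreasingRearrangement μ u x}.indicator u) p μ ≤
      ∑' j : ℕ, decreasingRearrangement μ u (R ^ j * x) * (R ^ (j + 1) * x) ^ (1 / p) := by
  set d : ℕ → ℝ≥0∞ := fun j => decreasingRearrangement μ u (R ^ j * x)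
  have hlim : Tendsto (fun j : ℕ => R ^ j * x) atTop (𝓝 ∞) := by
    have := ENNReal.Tendsto.mul_const (ENNReal.tendsto_pow_atTop_nhds_top_iff.2 hR) (b := x)
      (.inl ENNReal.top_ne_zero)
    rwa [ENNReal.top_mul hx] at this
  obtain ⟨n, hn⟩ := (hlim.eventually (lt_mem_nhds (measure_lt_top μ Set.univ))).exists
  refine (eLpNorm'_le_tsum_of_forall_exists hp (A := fun j => {t | d (j + 1) < ‖u t‖ₑ})
    (fun j => nullMeasurableSet_lt aemeasurable_const hu.enorm) (c := d) ?_).trans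
      (ENNReal.tsum_le_tsum fun j => mul_le_mul_right (ENNReal.rpow_le_rpow
        (measure_decreasingRearrangement_lt_le μ u _) (by positivity)) _)
  filter_upwards with t h0
  have hle : t ∈ {t | ‖u t‖ₑ ≤ decreasingRearrangement μ u x} := Set.mem_of_indicator_ne_zero h0
  rw [Set.indicator_of_mem hle] at h0 ⊢
  obtain ⟨j, hj, hj'⟩ := Nat.exists_not_and_succ_of_not_zero_of_exists
    (p := fun j => d j < ‖u t‖ₑ) (by simpa [d] using hle)
    ⟨n, by simpa only [d, decreasingRearrangement_eq_zero hn.le] using enorm_pos.2 h0⟩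
  exact ⟨j, hj', not_lt.1 hj⟩

end DecreasingRearrangement

/-! ### Weak-type estimates and the embedding into `L¹` -/

section WeakType

variable {α E : Type*} [MeasurableSpace α] {μ : Measure α} [NormedAddCommGroup E] {u : α → E}

theorem lintegral_Ioi_ofReal_rpow_neg {r T : ℝ} (hr : 1 < r) (hT : 0 < T) :
    ∫⁻ l in Set.Ioi T, ENNReal.ofReal (l ^ (-r)) =
      ENNReal.ofReal (T ^ (1 - r) * (1 / (r - 1))) := by
  rw [← ofReal_integral_eq_lintegral_ofReal (integrableOn_Ioi_rpow_of_lt (by linarith) hT),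
    integral_Ioi_rpow_of_lt (by linarith) hT, show -r + 1 = -(r - 1) by ring, neg_div_neg_eq,
    mul_one_div, neg_sub]
  filter_upwards [ae_restrict_mem measurableSet_Ioi] with l hl
  exact Real.rpow_nonneg (hT.le.trans (le_of_lt hl)) _

theorem setLIntegral_lt_enorm_le_of_weakType (hu : AEStronglyMeasurable u μ) {r : ℝ} (hr : 1 < r)
    {A : ℝ≥0∞} (h : ∀ l : ℝ, 0 < l → μ {t | l < ‖u t‖} ≤ (A / ENNReal.ofReal l) ^ r)
    {T : ℝ} (hT : 0 < T) : ∫⁻ t in {t | T < ‖u t‖}, ‖u t‖ₑ ∂μ ≤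
      A ^ r * ENNReal.ofReal (T ^ (1 - r) * (1 + 1 / (r - 1))) := by
  set E := {t | T < ‖u t‖}
  have hA {l : ℝ} (hl : 0 < l) :
      (A / ENNReal.ofReal l) ^ r = A ^ r * ENNReal.ofReal (l ^ (-r)) := by
    rw [ENNReal.div_rpow_of_nonneg _ _ (by linarith), ENNReal.ofReal_rpow_of_pos hl,
      Real.rpow_neg hl.le, ENNReal.ofReal_inv_of_pos (by positivity), div_eq_mul_inv]
  have hsmall : ∫⁻ l in Set.Ioc 0 T, (μ.restrict E) {t | l < ‖u t‖} ≤
      A ^ r * ENNReal.ofReal (T ^ (1 - r)) := by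
    calc _ ≤ ∫⁻ _ in Set.Ioc 0 T, μ E :=
          lintegral_mono fun l => (measure_mono (Set.subset_univ _)).trans_eq
            (Measure.restrict_apply_univ E)
      _ ≤ A ^ r * ENNReal.ofReal (T ^ (-r)) * ENNReal.ofReal T := by
          rw [setLIntegral_const, Real.volume_Ioc, sub_zero]
          gcongr
          exact (h T hT).trans_eq (hA hT)
      _ = _ := by
          rw [mul_assoc, ← ENNReal.ofReal_mul (by positivity), sub_eq_neg_add,
            Real.rpow_add_one hT.ne']
  have hlarge : ∫⁻ l in Set.Ioi T, (μ.restrict E) {t | l < ‖u t‖} ≤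
      A ^ r * ENNReal.ofReal (T ^ (1 - r) * (1 / (r - 1))) := by
    calc _ ≤ ∫⁻ l in Set.Ioi T, A ^ r * ENNReal.ofReal (l ^ (-r)) :=
          setLIntegral_mono (by fun_prop) fun l hl => (Measure.restrict_apply_le _ _).trans
            ((h l (hT.trans hl)).trans_eq (hA (hT.trans hl)))
      _ = _ := by rw [lintegral_const_mul _ (by fun_prop), lintegral_Ioi_ofReal_rpow_neg hr hT]
  calc ∫⁻ t in E, ‖u t‖ₑ ∂μ = ∫⁻ l in Set.Ioi 0, (μ.restrict E) {t | l < ‖u t‖} := by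
        simp_rw [← ofReal_norm]
        exact lintegral_eq_lintegral_meas_lt _ (ae_of_all _ fun _ => norm_nonneg _)
          hu.norm.aemeasurable.restrict
    _ ≤ _ + _ := by
        rw [← Set.Ioc_union_Ioi_eq_Ioi hT.le]
        exact lintegral_union_le _ _ _
    _ ≤ _ := add_le_add hsmall hlarge
    _ = _ := by
        rw [← mul_add, ← ENNReal.ofReal_add (by positivity) (by have := sub_pos.2 hr; positivity),
          mul_add, mul_one]

theorem lintegral_enorm_le_ofReal_add [IsProbabilityMeasure μ] (hu : AEStronglyMeasurable u μ)
    (T : ℝ) : ∫⁻ t, ‖u t‖ₑ ∂μ ≤ ENNReal.ofReal T + ∫⁻ t in {t | T < ‖u t‖}, ‖u t‖ₑ ∂μ := by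
  have hE : NullMeasurableSet {t | T < ‖u t‖} μ := nullMeasurableSet_lt aemeasurable_const
    hu.norm.aemeasurable
  have hsplit := lintegral_union_le (μ := μ) (fun t => ‖u t‖ₑ) {t | T < ‖u t‖}ᶜ {t | T < ‖u t‖}
  rw [Set.compl_union_self, setLIntegral_univ] at hsplit
  refine hsplit.trans (add_le_add_left ?_ _)
  calc ∫⁻ t in {t | T < ‖u t‖}ᶜ, ‖u t‖ₑ ∂μ ≤ ∫⁻ _ in {t | T < ‖u t‖}ᶜ, ENNReal.ofReal T ∂μ := by
        refine lintegral_mono_ae ((ae_restrict_mem₀ hE.compl).mono fun t ht => ?_)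
        rw [← ofReal_norm]
        exact ENNReal.ofReal_le_ofReal (not_lt.1 ht)
    _ ≤ ENNReal.ofReal T := by
        rw [setLIntegral_const]
        exact mul_le_of_le_one_right' prob_le_one

end WeakType

namespace IsRearrangementInvariant

theorem fnrm_eq (hri : IsRearrangementInvariant X) (hf : AEStronglyMeasurable f m)
    (hg : AEStronglyMeasurable g m)
    (h : ∀ r : ℝ≥0∞, m {t | r < ‖f t‖ₑ} = m {t | r < ‖g t‖ₑ}) : X.fnrm f = X.fnrm g := by
  have hdist {f : 𝕋 → ℂ} (hf : AEStronglyMeasurable f m) {r : ℝ} (hr : 0 ≤ r) :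
      distribution (AEEqFun.mk f hf) r = m {t | ENNReal.ofReal r < ‖f t‖ₑ} := by
    refine measure_congr ((AEEqFun.coeFn_mk f hf).mono fun t ht => propext ?_)
    change r < ‖_‖ ↔ ENNReal.ofReal r < _
    rw [ht, ← ofReal_norm, ENNReal.ofReal_lt_ofReal_iff_of_nonneg hr]
  have heq : Equimeasurable (AEEqFun.mk f hf) (AEEqFun.mk g hg) := fun r hr => by
    rw [hdist hf hr, hdist hg hr, h]
  rw [fnrm_eq_nrm_mk hf, fnrm_eq_nrm_mk hg]
  rcases lt_or_ge (X.nrm (AEEqFun.mk f hf)) ∞ with hf' | hf'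
  · exact (hri _ _ heq hf').2
  rcases lt_or_ge (X.nrm (AEEqFun.mk g hg)) ∞ with hg' | hg'
  · exact (hri _ _ (fun r hr => (heq r hr).symm) hg').2.symm
  · rw [top_le_iff.1 hf', top_le_iff.1 hg']

theorem fnrm_indicator_one_congr (hri : IsRearrangementInvariant X) {E F : Set 𝕋}
    (hE : NullMeasurableSet E m) (hF : NullMeasurableSet F m) (h : m E = m F) :
    X.fnrm (E.indicator 1) = X.fnrm (F.indicator 1) := by
  have hset (E : Set 𝕋) (r : ℝ≥0∞) :
      {t | r < ‖E.indicator (1 : 𝕋 → ℂ) t‖ₑ} = if r < 1 then E else ∅ := by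
    ext t
    by_cases ht : t ∈ E <;> by_cases hr : r < 1 <;> simp [ht, hr]
  refine hri.fnrm_eq (aestronglyMeasurable_one.indicator₀ hE)
    (aestronglyMeasurable_one.indicator₀ hF) fun r => ?_
  rw [hset, hset]
  split_ifs
  exacts [h, rfl]

end IsRearrangementInvariant

namespace IsBanachFunctionSpace

theorem fnrm_one_le_dilationNorm_mul (hX : IsBanachFunctionSpace X) {x : ℝ} (hx0 : 0 < x)
    (hx1 : x ≤ 1) :
    X.fnrm 1 ≤ dilationNorm X x * X.fnrm ((initialArc x).indicator 1) := by
  have hone : dilationFun x ((initialArc x).indicator 1) = 1 := by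
    ext t
    have hlt : x * unitAngle t < x := mul_lt_of_lt_one_right hx0 (unitAngle_mem t).2
    have hcomp : (initialArc x).indicator (1 : 𝕋 → ℂ) =
        fun t => (Set.Iio x).indicator (1 : ℝ → ℂ) (unitAngle t) := rfl
    rw [hcomp, dilationFun_comp_unitAngle hx0, if_pos (hlt.trans_le hx1), Pi.one_apply]
    exact Set.indicator_of_mem (Set.mem_Iio.2 hlt) _
  rw [← hone]
  refine (fnrm_dilationFun_le hx0 ?_).trans_eq (by rw [hone])
  exact (hX.fnrm_indicator_le (measurableSet_initialArc x).nullMeasurableSet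
    aestronglyMeasurable_one).trans_lt hX.fnrm_one_lt_top

theorem fnrm_indicator_initialArc_mono (hX : IsBanachFunctionSpace X) {x y : ℝ} (h : x ≤ y) :
    X.fnrm ((initialArc x).indicator 1) ≤ X.fnrm ((initialArc y).indicator 1) := by
  have hind : (initialArc x).indicator (1 : 𝕋 → ℂ) =
      (initialArc x).indicator ((initialArc y).indicator 1) := by
    have hsub : initialArc x ⊆ initialArc y := fun t ht => lt_of_lt_of_le ht h
    rw [Set.indicator_indicator, Set.inter_eq_left.2 hsub]
  rw [hind]
  exact hX.fnrm_indicator_le (measurableSet_initialArc _).nullMeasurableSet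
    (aestronglyMeasurable_one.indicator (measurableSet_initialArc _))

theorem exists_mul_rpow_le_fnrm_indicator (hX : IsBanachFunctionSpace X)
    (hri : IsRearrangementInvariant X) (hB : HasNontrivialBoydIndices X) :
    ∃ b ∈ Set.Ioo (0 : ℝ) 1, ∃ c : ℝ≥0∞, c ≠ 0 ∧ ∀ E : Set 𝕋, NullMeasurableSet E m →
      c * m E ^ b ≤ X.fnrm (E.indicator 1) := by
  obtain ⟨b, hb, hdil⟩ := hB.exists_dilationNorm_le_atTop
  obtain ⟨R, hR1, hR⟩ :=
    ((eventually_ge_atTop (1 : ℝ)).and (eventually_forall_ge_atTop.2 hdil)).exists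
  have hR0 : 0 < R := one_pos.trans_le hR1
  refine ⟨b, hb, X.fnrm 1 * ENNReal.ofReal (R⁻¹ ^ b),
    mul_ne_zero fnrm_one_ne_zero (ENNReal.ofReal_pos.2 (by positivity)).ne', fun E hE => ?_⟩
  obtain ⟨x, hx0, hx⟩ : ∃ x : ℝ, 0 ≤ x ∧ m E = ENNReal.ofReal x :=
    ⟨_, ENNReal.toReal_nonneg, (ENNReal.ofReal_toReal (measure_ne_top m E)).symm⟩
  have hx1 : x ≤ 1 := ENNReal.ofReal_le_one.1 (hx ▸ prob_le_one)
  rcases hx0.eq_or_lt with rfl | hx0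
  · simp [hx, hb.1]
  have hy1 : x / R ≤ x := div_le_self hx0.le hR1
  have hnorm : X.fnrm 1 ≤ ENNReal.ofReal ((R / x) ^ b) * X.fnrm (E.indicator 1) := by
    refine (hX.fnrm_one_le_dilationNorm_mul (div_pos hx0 hR0) (hy1.trans hx1)).trans ?_
    gcongr ?_ * ?_
    · have := hR (R / x) ((le_div_iff₀ hx0).2 (mul_le_of_le_one_right hR0.le hx1))
      rwa [one_div_div] at this
    · rw [hri.fnrm_indicator_one_congr hE (measurableSet_initialArc x).nullMeasurableSet
        (hx.trans (measure_initialArc hx1).symm)]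
      exact hX.fnrm_indicator_initialArc_mono hy1
  have hinv : ENNReal.ofReal ((R / x) ^ b) * (ENNReal.ofReal (R⁻¹ ^ b) * m E ^ b) = 1 := by
    rw [hx, ENNReal.ofReal_rpow_of_pos hx0, ← ENNReal.ofReal_mul (by positivity),
      ← ENNReal.ofReal_mul (by positivity), ← Real.mul_rpow (by positivity) hx0.le,
      ← Real.mul_rpow (by positivity) (by positivity)]
    have hone : R / x * (R⁻¹ * x) = 1 := by field_simp
    rw [hone, Real.one_rpow, ENNReal.ofReal_one]
  calc _ = X.fnrm 1 * (ENNReal.ofReal (R⁻¹ ^ b) * m E ^ b) := mul_assoc _ _ _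
    _ ≤ ENNReal.ofReal ((R / x) ^ b) * X.fnrm (E.indicator 1) *
        (ENNReal.ofReal (R⁻¹ ^ b) * m E ^ b) := by gcongr
    _ = X.fnrm (E.indicator 1) := by rw [mul_right_comm, hinv, one_mul]

theorem ofReal_mul_fnrm_indicator_le (hX : IsBanachFunctionSpace X)
    (hf : AEStronglyMeasurable f m) {l : ℝ} (hl : 0 ≤ l) :
    ENNReal.ofReal l * X.fnrm ({t | l < ‖f t‖}.indicator 1) ≤ X.fnrm f := by
  have hone : AEStronglyMeasurable ({t | l < ‖f t‖}.indicator (1 : 𝕋 → ℂ)) m :=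
    aestronglyMeasurable_one.indicator₀
      (nullMeasurableSet_lt aemeasurable_const hf.norm.aemeasurable)
  have hnorm : ‖(l : ℂ)‖ₑ = ENNReal.ofReal l := by
    rw [← ofReal_norm, Complex.norm_of_nonneg hl]
  rw [← hnorm, ← fnrm_const_smul _ hone]
  refine hX.fnrm_mono (hone.const_smul _) (ae_of_all _ fun t => ?_)
  by_cases ht : l < ‖f t‖
  · simpa [Set.indicator_of_mem (show t ∈ {t | l < ‖f t‖} from ht), abs_of_nonneg hl] using ht.le
  · simp [Set.indicator_of_notMem (show t ∉ {t | l < ‖f t‖} from ht)]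

theorem exists_measure_lt_norm_le (hX : IsBanachFunctionSpace X)
    (hri : IsRearrangementInvariant X) (hB : HasNontrivialBoydIndices X) :
    ∃ r : ℝ, 1 < r ∧ ∃ B : ℝ≥0∞, B ≠ 0 ∧ B ≠ ∞ ∧ ∀ f : 𝕋 → ℂ,
      AEStronglyMeasurable f m → ∀ l : ℝ, 0 < l →
        m {t | l < ‖f t‖} ≤ (B * X.fnrm f / ENNReal.ofReal l) ^ r := by
  obtain ⟨b, hb, c, hc, hle⟩ := hX.exists_mul_rpow_le_fnrm_indicator hri hB
  have hctop : c ≠ ∞ := by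
    have h1 := (hle Set.univ .univ).trans_lt (by simpa using hX.fnrm_one_lt_top)
    simpa using h1.ne
  refine ⟨b⁻¹, (one_lt_inv₀ hb.1).2 hb.2, c⁻¹, ENNReal.inv_ne_zero.2 hctop,
    ENNReal.inv_ne_top.2 hc, fun f hf l hl => ?_⟩
  rw [ENNReal.le_rpow_inv_iff hb.1, ENNReal.le_div_iff_mul_le (by simp [hl]) (by simp)]
  set E := {t | l < ‖f t‖}
  have hE : NullMeasurableSet E m := nullMeasurableSet_lt aemeasurable_const hf.norm.aemeasurable
  rw [mul_comm c⁻¹, ← div_eq_mul_inv, ENNReal.le_div_iff_mul_le (.inl hc) (.inl hctop)]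
  calc m E ^ b * ENNReal.ofReal l * c = ENNReal.ofReal l * (c * m E ^ b) := by ring
    _ ≤ ENNReal.ofReal l * X.fnrm (E.indicator 1) := by gcongr; exact hle E hE
    _ ≤ X.fnrm f := hX.ofReal_mul_fnrm_indicator_le hf hl.le

theorem embedsInL1 (hX : IsBanachFunctionSpace X) (hri : IsRearrangementInvariant X)
    (hB : HasNontrivialBoydIndices X) : EmbedsInL1 X := by
  obtain ⟨r, hr, B, hB0, hBtop, hweak⟩ := hX.exists_measure_lt_norm_le hri hB
  have := sub_pos.2 hr
  lift B to NNReal using hBtop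
  refine ⟨B * (1 + Real.toNNReal (1 + 1 / (r - 1))), fun f => ?_⟩
  have hfm := (f : L0).aestronglyMeasurable
  rcases eq_or_ne f 0 with rfl | hf0
  · rw [Submodule.coe_zero, eLpNorm_congr_ae AEEqFun.coeFn_zero]
    simp
  have h0 : B * X.fnrm (f : L0) ≠ 0 := mul_ne_zero hB0 <| by
    rwa [← enorm_eq_fnrm f (ae_eq_refl _), enorm_ne_zero]
  rw [enorm_eq_fnrm f (ae_eq_refl _), eLpNorm_one_eq_lintegral_enorm]
  obtain ⟨T, hT, hTeq⟩ : ∃ T : ℝ, 0 < T ∧ B * X.fnrm (f : L0) = ENNReal.ofReal T := by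
    have hA : B * X.fnrm (f : L0) ≠ ∞ := ENNReal.mul_ne_top ENNReal.coe_ne_top (fnrm_lt_top f).ne
    exact ⟨_, ENNReal.toReal_pos h0 hA, (ENNReal.ofReal_toReal hA).symm⟩
  calc ∫⁻ t, ‖(f : L0) t‖ₑ ∂m
      ≤ ENNReal.ofReal T + ENNReal.ofReal T ^ r *
          ENNReal.ofReal (T ^ (1 - r) * (1 + 1 / (r - 1))) := by
        refine (lintegral_enorm_le_ofReal_add hfm T).trans (add_le_add_right ?_ _)
        refine setLIntegral_lt_enorm_le_of_weakType hfm hr (fun l hl => ?_) hT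
        simpa only [hTeq] using hweak _ hfm l hl
    _ = ENNReal.ofReal T * (1 + ENNReal.ofReal (1 + 1 / (r - 1))) := by
        rw [ENNReal.ofReal_rpow_of_pos hT, ← ENNReal.ofReal_mul (by positivity), ← mul_assoc,
          ← Real.rpow_add hT, add_sub_cancel, Real.rpow_one, ENNReal.ofReal_mul hT.le, mul_add,
          mul_one]
    _ = _ := by
        rw [← hTeq]
        push_cast
        rw [mul_right_comm]
        rfl

end IsBanachFunctionSpace

/-! ### Strong and weak types -/

section StrongType

variable {α : Type*} [MeasurableSpace α] {μ : Measure α} {T : Lp ℂ 2 μ → Lp ℂ 2 μ} {p q : ℝ}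

/-- `T` is of strong type `(p, p)`. The operator is defined on `L²`, so that the condition makes
sense for every exponent without an extension of `T`. -/
def HasStrongType (T : Lp ℂ 2 μ → Lp ℂ 2 μ) (p : ℝ) : Prop :=
  ∃ C : ℝ≥0∞, C ≠ ∞ ∧ ∀ f, eLpNorm' (T f) p μ ≤ C * eLpNorm' f p μ

/-- `T` is of weak type `(p, p)`: the quasi-norm of weak `L^p` is expressed by the decreasing
rearrangement. -/
def HasWeakType (T : Lp ℂ 2 μ → Lp ℂ 2 μ) (p : ℝ) : Prop :=
  ∃ C : ℝ≥0∞, C ≠ ∞ ∧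
    ∀ f x, x ^ (1 / p) * decreasingRearrangement μ (T f) x ≤ C * eLpNorm' f p μ

theorem HasStrongType.hasWeakType (hp : 0 < p) (hT : HasStrongType T p) : HasWeakType T p := by
  obtain ⟨C, hC, hle⟩ := hT
  refine ⟨C, hC, fun f => rpow_mul_decreasingRearrangement_le hp fun r => (?_ : _ ≤ _).trans
    (hle f)⟩
  rw [eLpNorm'_eq_lintegral_enorm, one_div, ENNReal.le_rpow_inv_iff hp,
    ENNReal.mul_rpow_of_nonneg _ _ hp.le, ENNReal.rpow_inv_rpow hp.ne']
  calc r ^ p * μ {t | r < ‖T f t‖ₑ} ≤ r ^ p * μ {t | r ^ p ≤ ‖T f t‖ₑ ^ p} :=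
        mul_le_mul_right (measure_mono fun t ht => ENNReal.rpow_le_rpow (le_of_lt ht) hp.le) _
    _ ≤ ∫⁻ t, ‖T f t‖ₑ ^ p ∂μ :=
        mul_meas_ge_le_lintegral₀ ((Lp.aestronglyMeasurable (T f)).enorm.pow_const _) _

theorem enorm_inner_le_eLpNorm'_mul (hpq : p.HolderConjugate q) (f g : Lp ℂ 2 μ) :
    ‖(inner ℂ f g : ℂ)‖ₑ ≤ eLpNorm' f p μ * eLpNorm' g q μ := by
  rw [L2.inner_def]
  refine (enorm_integral_le_lintegral_enorm _).trans ((lintegral_mono fun t => ?_).trans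
    (ENNReal.lintegral_mul_le_Lp_mul_Lq μ hpq (Lp.aestronglyMeasurable f).enorm
      (Lp.aestronglyMeasurable g).enorm))
  rw [Pi.mul_apply, RCLike.inner_apply, enorm_mul, mul_comm, RCLike.enorm_conj]

theorem exists_enorm_inner_eq_setLIntegral [IsFiniteMeasure μ] (u : Lp ℂ 2 μ) {E : Set α}
    (hE : MeasurableSet E) : ∃ g : Lp ℂ 2 μ, ‖(inner ℂ g u : ℂ)‖ₑ = ∫⁻ t in E, ‖u t‖ₑ ∂μ ∧
      ∀ q, 0 < q → eLpNorm' g q μ ≤ μ E ^ (1 / q) := by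
  set s : α → ℂ := E.indicator fun t => u t / ‖u t‖ with hs
  have hnorm : ∀ t, ‖s t‖ ≤ ‖E.indicator (fun _ => (1 : ℝ)) t‖ := fun t => by
    rw [hs, norm_indicator_eq_indicator_norm, norm_indicator_eq_indicator_norm]
    refine Set.indicator_le_indicator ?_
    rw [norm_div, Complex.norm_real, norm_norm, norm_one]
    exact div_self_le_one _
  have hu : AEStronglyMeasurable u μ := Lp.aestronglyMeasurable u
  have hmem : MemLp s 2 μ := ((memLp_const (1 : ℝ)).indicator hE).of_le
    (((hu.aemeasurable.div hu.norm.aemeasurable.complex_ofReal).indicator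
      hE).aestronglyMeasurable) (.of_forall hnorm)
  refine ⟨hmem.toLp s, ?_, fun q hq => ?_⟩
  · have hinner : ∀ᵐ t ∂μ, (inner ℂ (hmem.toLp s t) (u t) : ℂ) =
        ((E.indicator (fun t => ‖u t‖) t : ℝ) : ℂ) := by
      filter_upwards [hmem.coeFn_toLp] with t ht
      by_cases hmE : t ∈ E
      · rw [ht, hs, Set.indicator_of_mem hmE, Set.indicator_of_mem hmE, RCLike.inner_apply,
          map_div₀, Complex.conj_ofReal, mul_div_assoc', RCLike.mul_conj, sq]
        exact mul_self_div_self _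
      · rw [ht, hs, Set.indicator_of_notMem hmE, Set.indicator_of_notMem hmE, inner_zero_left,
          Complex.ofReal_zero]
    rw [L2.inner_def, integral_congr_ae hinner, integral_complex_ofReal, ← ofReal_norm,
      Complex.norm_real, integral_indicator hE, Real.norm_of_nonneg
      (integral_nonneg fun t => norm_nonneg _), ofReal_integral_norm_eq_lintegral_enorm]
    exact ((Lp.memLp u).integrable one_le_two).integrableOn
  · rw [eLpNorm'_congr_ae hmem.coeFn_toLp]
    refine (eLpNorm'_mono_ae hq.le (.of_forall hnorm)).trans_eq ?_
    have h := eLpNorm_indicator_const (μ := μ) (c := (1 : ℝ)) hE (ENNReal.ofReal_pos.2 hq).ne'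
      ENNReal.ofReal_ne_top
    rwa [eLpNorm_eq_eLpNorm' (ENNReal.ofReal_pos.2 hq).ne' ENNReal.ofReal_ne_top,
      ENNReal.toReal_ofReal hq.le, enorm_one, one_mul] at h

theorem HasStrongType.hasWeakType_of_isSymmetric [IsFiniteMeasure μ] {T : Lp ℂ 2 μ →ₗ[ℂ] Lp ℂ 2 μ}
    (hsymm : T.IsSymmetric) (hpq : p.HolderConjugate q) (hT : HasStrongType T q) :
    HasWeakType T p := by
  obtain ⟨C, hC, hle⟩ := hT
  refine ⟨C, hC, fun f => rpow_mul_decreasingRearrangement_le hpq.pos fun r => ?_⟩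
  set E : Set α := {t | r < ‖T f t‖ₑ}
  have hE : MeasurableSet E :=
    measurableSet_lt measurable_const (Lp.stronglyMeasurable (T f)).measurable.enorm
  obtain ⟨g, hg, hgE⟩ := exists_enorm_inner_eq_setLIntegral (T f) hE
  have hmain : r * μ E ≤ C * eLpNorm' f p μ * μ E ^ (1 / q) :=
    calc r * μ E = ∫⁻ _ in E, r ∂μ := (setLIntegral_const E r).symm
      _ ≤ ∫⁻ t in E, ‖T f t‖ₑ ∂μ := setLIntegral_mono' hE fun t ht => le_of_lt ht
      _ = ‖(inner ℂ (T g) f : ℂ)‖ₑ := by rw [← hg, hsymm g f]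
      _ ≤ C * μ E ^ (1 / q) * eLpNorm' f p μ :=
        (enorm_inner_le_eLpNorm'_mul hpq.symm _ _).trans
          (mul_le_mul_left ((hle g).trans (mul_le_mul_right (hgE q hpq.symm.pos) C)) _)
      _ = _ := by ring
  rcases eq_or_ne (μ E) 0 with h0 | h0
  · rw [h0, ENNReal.zero_rpow_of_pos (one_div_pos.2 hpq.pos), mul_zero]
    exact zero_le
  refine (ENNReal.mul_le_mul_iff_left (c := μ E ^ (1 / q)) ?_ ?_).1 ?_
  · exact (ENNReal.rpow_pos h0.bot_lt (measure_ne_top _ _)).ne'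
  · exact ENNReal.rpow_ne_top_of_nonneg (one_div_pos.2 hpq.symm.pos).le (measure_ne_top _ _)
  · rwa [mul_assoc, ← ENNReal.rpow_add _ _ h0 (measure_ne_top _ _), one_div p,
      one_div q, hpq.inv_add_inv_eq_one, ENNReal.rpow_one, ← one_div]

end StrongType

/-! ### The Riesz projection on `L²` and the theorem of M. Riesz -/

/-- The Hardy space `H²`, as the orthogonal complement of the negative exponentials. -/
def hardyL2 : Submodule ℂ (Lp ℂ 2 m) :=
  (Submodule.span ℂ (fourierLp 2 '' Set.Iio (0 : ℤ)))ᗮ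

instance : hardyL2.HasOrthogonalProjection := by unfold hardyL2; infer_instance

/-- The Riesz projection on `L²`, as the orthogonal projection onto `H²`. -/
def rieszL2 : Lp ℂ 2 m →L[ℂ] Lp ℂ 2 m := hardyL2.starProjection

theorem fourierCoeff_eq_inner (f : Lp ℂ 2 m) (n : ℤ) :
    fourierCoeff f n = inner ℂ (fourierLp 2 n) f := by
  rw [← fourierBasis_repr, HilbertBasis.repr_apply_apply, coe_fourierBasis]

theorem isSymmetric_rieszL2 : (rieszL2 : Lp ℂ 2 m →ₗ[ℂ] Lp ℂ 2 m).IsSymmetric :=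
  hardyL2.starProjection_isSymmetric

theorem rieszL2_fourierLp (n : ℤ) :
    rieszL2 (fourierLp 2 n) = if 0 ≤ n then fourierLp 2 n else 0 := by
  split_ifs with hn
  · have hortho : Submodule.span ℂ {fourierLp 2 n} ⟂
        Submodule.span ℂ (fourierLp (T := 2 * Real.pi) 2 '' Set.Iio (0 : ℤ)) := by
      refine Submodule.isOrtho_span.2 ?_
      rintro _ rfl _ ⟨k, hk, rfl⟩
      exact orthonormal_fourier.2 (lt_of_lt_of_le hk hn).ne'
    exact Submodule.starProjection_eq_self_iff.2 (hortho.le (Submodule.mem_span_singleton_self _))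
  · exact Submodule.starProjection_orthogonal_apply_eq_zero
      (Submodule.subset_span ⟨n, not_le.1 hn, rfl⟩)

theorem fourierCoeff_rieszL2 (f : Lp ℂ 2 m) (n : ℤ) :
    fourierCoeff (rieszL2 f) n = if 0 ≤ n then fourierCoeff f n else 0 := by
  have h : fourierCoeff (rieszL2 f) n = inner ℂ (rieszL2 (fourierLp 2 n)) f :=
    (fourierCoeff_eq_inner _ n).trans (isSymmetric_rieszL2 _ f).symm
  rw [h, rieszL2_fourierLp, fourierCoeff_eq_inner, apply_ite (inner ℂ · f), inner_zero_left]

theorem integral_toAddCircle (p : Polynomial ℂ) : ∫ t, p.toAddCircle t ∂m = p.coeff 0 := by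
  rw [← Polynomial.fourierCoeff_toAddCircle_natCast, fourierCoeff]
  simp only [Nat.cast_zero, neg_zero, fourier_zero, one_smul]

theorem exists_toAddCircle_single (n : ℤ) (a : ℂ) : ∃ g h : Polynomial ℂ,
    trigPoly ((Finsupp.single n a).filter (0 ≤ ·)) = g.toAddCircle ∧
      trigPoly (Finsupp.single n a) = g.toAddCircle + star h.toAddCircle ∧ h.coeff 0 = 0 := by
  by_cases hn : 0 ≤ n
  · obtain ⟨k, rfl⟩ := Int.eq_ofNat_of_zero_le hn
    refine ⟨Polynomial.monomial k a, 0, ?_, ?_, rfl⟩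
    · rw [Finsupp.filter_single_of_pos _ hn, Polynomial.toAddCircle_monomial_eq_smul_fourier,
        trigPoly_single]
    · rw [Polynomial.toAddCircle_monomial_eq_smul_fourier, trigPoly_single, map_zero, star_zero,
        add_zero]
  · obtain ⟨k, hk⟩ := Int.eq_ofNat_of_zero_le (a := -n) (by omega)
    obtain rfl : n = -(k : ℤ) := by omega
    refine ⟨0, Polynomial.monomial k (conj a), ?_, ?_, ?_⟩
    · rw [Finsupp.filter_single_of_neg _ hn, map_zero, map_zero]
    · rw [Polynomial.toAddCircle_monomial_eq_smul_fourier, trigPoly_single, map_zero, zero_add]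
      ext t
      rw [ContinuousMap.star_apply, ContinuousMap.smul_apply, ContinuousMap.smul_apply,
        fourier_neg, Complex.star_def, smul_eq_mul, smul_eq_mul, map_mul, Complex.conj_conj]
    · exact Polynomial.coeff_monomial_of_ne _ (by omega)

theorem exists_toAddCircle (c : ℤ →₀ ℂ) : ∃ g h : Polynomial ℂ,
    trigPoly (c.filter (0 ≤ ·)) = g.toAddCircle ∧
      trigPoly c = g.toAddCircle + star h.toAddCircle ∧ h.coeff 0 = 0 := by
  induction c using Finsupp.induction_linear with
  | zero => simpa using exists_toAddCircle_single 0 0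
  | add c d hc hd =>
    obtain ⟨g, h, hg, hgh, h0⟩ := hc
    obtain ⟨g', h', hg', hgh', h0'⟩ := hd
    refine ⟨g + g', h + h', ?_, ?_, by rw [Polynomial.coeff_add, h0, h0', add_zero]⟩
    · rw [Finsupp.filter_add, map_add, hg, hg', map_add]
    · rw [map_add, hgh, hgh', map_add, map_add, star_add, add_add_add_comm]
  | single n a => exact exists_toAddCircle_single n a

theorem norm_pow_sub_pow_le_mul {R : Type*} [NormedCommRing R] [NormOneClass R] [NormMulClass R]
    {a b : R} {M : ℝ} (ha : ‖a‖ ≤ M) (hb : ‖b‖ ≤ M) (n : ℕ) :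
    ‖a ^ n - b ^ n‖ ≤ n * M ^ (n - 1) * ‖a - b‖ := by
  rw [← (Commute.all a b).geom_sum₂_mul, norm_mul]
  refine mul_le_mul_of_nonneg_right ((norm_sum_le _ _).trans ?_) (norm_nonneg _)
  refine (Finset.sum_le_card_nsmul _ _ (M ^ (n - 1)) fun i hi => ?_).trans (by simp)
  have hM : 0 ≤ M := (norm_nonneg _).trans ha
  have hi' : n - 1 = i + (n - 1 - i) := by have := Finset.mem_range.1 hi; omega
  calc ‖a ^ i * b ^ (n - 1 - i)‖ = ‖a‖ ^ i * ‖b‖ ^ (n - 1 - i) := by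
        rw [norm_mul, norm_pow, norm_pow]
    _ ≤ M ^ i * M ^ (n - 1 - i) := by gcongr
    _ = M ^ (n - 1) := by rw [← pow_add, ← hi']

theorem norm_pow_le_two_mul_re_pow {k : ℕ} (hk : 0 < k) {z v : ℂ}
    (h : k * 2 ^ k * ‖conj z - v‖ ≤ ‖z‖) : ‖z‖ ^ (2 * k) ≤ 2 * (z ^ k * v ^ k).re := by
  obtain ⟨j, rfl⟩ : ∃ j, k = j + 1 := ⟨k - 1, by omega⟩
  have hle : ‖conj z - v‖ ≤ ‖z‖ := by
    refine (le_mul_of_one_le_left (norm_nonneg _) ?_).trans h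
    exact one_le_mul_of_one_le_of_one_le (by exact_mod_cast hk) (one_le_pow₀ one_le_two)
  have hv : ‖v‖ ≤ 2 * ‖z‖ := by
    have := norm_le_norm_sub_add v (conj z)
    rw [norm_sub_rev, Complex.norm_conj] at this
    linarith
  have hpow : ‖conj z ^ (j + 1) - v ^ (j + 1)‖ ≤
      (j + 1 : ℕ) * (2 * ‖z‖) ^ j * ‖conj z - v‖ :=
    norm_pow_sub_pow_le_mul (by rw [Complex.norm_conj]; linarith [norm_nonneg z]) hv _
  have hsplit : ‖z‖ ^ (2 * (j + 1)) =
      (z ^ (j + 1) * (conj z ^ (j + 1) - v ^ (j + 1))).re + (z ^ (j + 1) * v ^ (j + 1)).re := by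
    rw [← Complex.add_re, ← mul_add, sub_add_cancel, ← mul_pow, Complex.mul_conj, pow_mul,
      Complex.normSq_eq_norm_sq, ← Complex.ofReal_pow, Complex.ofReal_re]
  have hhalf : 2 * (z ^ (j + 1) * (conj z ^ (j + 1) - v ^ (j + 1))).re ≤ ‖z‖ ^ (2 * (j + 1)) :=
    calc 2 * (z ^ (j + 1) * (conj z ^ (j + 1) - v ^ (j + 1))).re
        ≤ 2 * (‖z‖ ^ (j + 1) * ((j + 1 : ℕ) * (2 * ‖z‖) ^ j * ‖conj z - v‖)) := by
          gcongr
          refine (Complex.re_le_norm _).trans ?_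
          rw [norm_mul, norm_pow]
          gcongr
      _ = ‖z‖ ^ (2 * j + 1) * ((j + 1 : ℕ) * 2 ^ (j + 1) * ‖conj z - v‖) := by ring
      _ ≤ ‖z‖ ^ (2 * j + 1) * ‖z‖ := by gcongr
      _ = ‖z‖ ^ (2 * (j + 1)) := by ring
  linarith

theorem norm_pow_le_add_re_pow {k : ℕ} (hk : 0 < k) (z v : ℂ) :
    ‖z‖ ^ (2 * k) ≤
      3 * (k * 2 ^ k + 1) ^ (2 * k) * ‖conj z - v‖ ^ (2 * k) + 2 * (z ^ k * v ^ k).re := by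
  set M : ℝ := k * 2 ^ k
  have hv : ‖v‖ ≤ ‖conj z - v‖ + ‖z‖ := by
    have := norm_le_norm_sub_add v (conj z)
    rwa [norm_sub_rev, Complex.norm_conj] at this
  rcases le_total (M * ‖conj z - v‖) ‖z‖ with hle | hle
  · exact (norm_pow_le_two_mul_re_pow hk hle).trans (le_add_of_nonneg_left (by positivity))
  · have hz : ‖z‖ ^ (2 * k) ≤ ((M + 1) * ‖conj z - v‖) ^ (2 * k) := by
      gcongr
      linarith [norm_nonneg (conj z - v)]
    have hre : -((M + 1) * ‖conj z - v‖) ^ (2 * k) ≤ (z ^ k * v ^ k).re := by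
      refine (neg_le_neg ?_).trans (neg_le_of_abs_le (Complex.abs_re_le_norm _))
      rw [norm_mul, norm_pow, norm_pow, two_mul k, pow_add]
      gcongr <;> linarith [norm_nonneg (conj z - v)]
    rw [mul_assoc, ← mul_pow]
    linarith

theorem integrable_norm_pow_continuousMap (u : C(𝕋, ℂ)) (n : ℕ) :
    Integrable (fun t => ‖u t‖ ^ n) m :=
  (u.continuous.norm.pow _).integrable_of_hasCompactSupport (HasCompactSupport.of_compactSpace _)

theorem eLpNorm'_continuousMap (u : C(𝕋, ℂ)) (n : ℕ) :
    eLpNorm' u n m = ENNReal.ofReal (∫ t, ‖u t‖ ^ n ∂m) ^ (1 / (n : ℝ)) := by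
  rw [eLpNorm', ofReal_integral_eq_lintegral_ofReal (integrable_norm_pow_continuousMap u n)
    (ae_of_all _ fun t => by positivity)]
  simp only [ENNReal.rpow_natCast, ENNReal.ofReal_pow (norm_nonneg _), ofReal_norm]

theorem integral_norm_toAddCircle_pow_le {k : ℕ} (hk : 0 < k) (g : Polynomial ℂ)
    {h : Polynomial ℂ} (h0 : h.coeff 0 = 0) :
    ∫ t, ‖g.toAddCircle t‖ ^ (2 * k) ∂m ≤ 3 * (k * 2 ^ k + 1) ^ (2 * k) *
      ∫ t, ‖(g.toAddCircle + star h.toAddCircle) t‖ ^ (2 * k) ∂m := by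
  have hint := fun u : C(𝕋, ℂ) => integrable_norm_pow_continuousMap u (2 * k)
  set q : Polynomial ℂ := g ^ k * (-h) ^ k with hq
  have hqi : Integrable (fun t => (q.toAddCircle t).re) m := (integrable_continuousMap _).re
  have hcross : ∫ t, (q.toAddCircle t).re ∂m = 0 := by
    refine (integral_re (integrable_continuousMap q.toAddCircle)).trans ?_
    rw [integral_toAddCircle, hq, Polynomial.mul_coeff_zero, neg_pow, Polynomial.mul_coeff_zero,
      Polynomial.coeff_zero_eq_eval_zero (h ^ k), Polynomial.eval_pow,
      ← Polynomial.coeff_zero_eq_eval_zero, h0, zero_pow hk.ne', mul_zero, mul_zero, map_zero]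
  have hpt : ∀ t, ‖g.toAddCircle t‖ ^ (2 * k) ≤ 3 * (k * 2 ^ k + 1) ^ (2 * k) *
      ‖(g.toAddCircle + star h.toAddCircle) t‖ ^ (2 * k) + 2 * (q.toAddCircle t).re := fun t => by
    have := norm_pow_le_add_re_pow hk (g.toAddCircle t) (-h.toAddCircle t)
    rw [← Complex.norm_conj (conj _ - _), map_sub, Complex.conj_conj, map_neg, sub_neg_eq_add]
      at this
    rw [hq, map_mul, map_pow, map_pow, map_neg]
    exact this
  calc ∫ t, ‖g.toAddCircle t‖ ^ (2 * k) ∂m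
      ≤ ∫ t, (3 * (k * 2 ^ k + 1) ^ (2 * k) * ‖(g.toAddCircle + star h.toAddCircle) t‖ ^ (2 * k) +
          2 * (q.toAddCircle t).re) ∂m :=
        integral_mono (hint _) (((hint _).const_mul _).add (hqi.const_mul 2)) hpt
    _ = _ := by
        rw [integral_add ((hint _).const_mul _) (hqi.const_mul 2), integral_const_mul,
          integral_const_mul, hcross, mul_zero, add_zero]

theorem exists_eLpNorm'_trigPoly_filter_le {k : ℕ} (hk : 0 < k) : ∃ C : ℝ≥0∞, C ≠ ∞ ∧
    ∀ c : ℤ →₀ ℂ, eLpNorm' (trigPoly (c.filter (0 ≤ ·))) (2 * k : ℕ) m ≤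
      C * eLpNorm' (trigPoly c) (2 * k : ℕ) m := by
  set A : ℝ := 3 * (k * 2 ^ k + 1) ^ (2 * k)
  have hA : 0 ≤ A := by positivity
  refine ⟨ENNReal.ofReal A ^ (1 / (2 * k : ℕ) : ℝ), by finiteness, fun c => ?_⟩
  obtain ⟨g, h, hg, hgh, h0⟩ := exists_toAddCircle c
  rw [eLpNorm'_continuousMap, eLpNorm'_continuousMap,
    ← ENNReal.mul_rpow_of_nonneg _ _ (by positivity), ← ENNReal.ofReal_mul hA, hg, hgh]
  gcongr
  exact integral_norm_toAddCircle_pow_le hk g h0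

/-- A trigonometric polynomial as an element of `L²`. -/
def trigL2 (c : ℤ →₀ ℂ) : Lp ℂ 2 m := (trigPoly c).toLp 2 m ℂ

theorem coeFn_trigL2 (c : ℤ →₀ ℂ) : trigL2 c =ᵐ[m] trigPoly c := ContinuousMap.coeFn_toLp m _

theorem rieszL2_trigL2 (c : ℤ →₀ ℂ) : rieszL2 (trigL2 c) = trigL2 (c.filter (0 ≤ ·)) := by
  have hint : ∀ f : Lp ℂ 2 m, Integrable f m := fun f =>
    (Lp.memLp f).integrable (by norm_num)
  refine Lp.ext (ae_eq_of_fourierCoeff (hint _) (hint _) fun n => ?_)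
  rw [fourierCoeff_rieszL2, fourierCoeff_congr_ae (coeFn_trigL2 _),
    fourierCoeff_congr_ae (coeFn_trigL2 _), fourierCoeff_trigPoly, fourierCoeff_trigPoly,
    Finsupp.filter_apply]

theorem exists_trigPoly_tendsto_eLpNorm {p : ℝ≥0∞} [Fact (1 ≤ p)] (hp : p ≠ ∞)
    (hf : MemLp f p m) : ∃ c : ℕ → ℤ →₀ ℂ,
      Tendsto (fun n => eLpNorm (⇑(trigPoly (c n)) - f) p m) atTop (𝓝 0) := by
  have hdense : DenseRange fun c => (trigPoly c).toLp p m ℂ :=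
    (ContinuousMap.toLp_denseRange ℂ m ℂ hp).comp denseRange_trigPoly
      (ContinuousMap.toLp p m ℂ).continuous
  obtain ⟨u, hu, hlim⟩ := mem_closure_iff_seq_limit.1 (hdense (hf.toLp f))
  choose c hc using hu
  refine ⟨c, ((Lp.tendsto_Lp_iff_tendsto_eLpNorm' u _).1 hlim).congr fun n => ?_⟩
  rw [← hc]
  exact eLpNorm_congr_ae ((ContinuousMap.coeFn_toLp m _).sub hf.coeFn_toLp)

theorem eLpNorm_map_le_of_trigL2 (T : Lp ℂ 2 m →L[ℂ] Lp ℂ 2 m) {p C : ℝ≥0∞} (h2 : 2 ≤ p)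
    (hp : p ≠ ∞) (hC : C ≠ ∞)
    (h : ∀ c, eLpNorm (T (trigL2 c)) p m ≤ C * eLpNorm (trigPoly c) p m) {f : Lp ℂ 2 m}
    (hf : eLpNorm f p m ≠ ∞) : eLpNorm (T f) p m ≤ C * eLpNorm f p m := by
  have : Fact (1 ≤ p) := ⟨one_le_two.trans h2⟩
  obtain ⟨c, hc⟩ := exists_trigPoly_tendsto_eLpNorm hp ⟨Lp.aestronglyMeasurable f, hf.lt_top⟩
  have hsub : ∀ n, AEStronglyMeasurable (⇑(trigPoly (c n)) - ⇑f) m := fun n =>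
    (aestronglyMeasurable_continuousMap _).sub (Lp.aestronglyMeasurable f)
  have hL2 : Tendsto (fun n => trigL2 (c n)) atTop (𝓝 f) := by
    refine (Lp.tendsto_Lp_iff_tendsto_eLpNorm' _ _).2 (tendsto_of_tendsto_of_tendsto_of_le_of_le
      tendsto_const_nhds hc (fun _ => zero_le) fun n => ?_)
    rw [eLpNorm_congr_ae ((coeFn_trigL2 (c n)).sub (EventuallyEq.refl _ f))]
    exact eLpNorm_le_eLpNorm_of_exponent_le h2 (hsub n)
  have hmeas : TendstoInMeasure m (fun n => T (trigL2 (c n))) atTop (T f) :=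
    tendstoInMeasure_of_tendsto_Lp ((T.continuous.tendsto f).comp hL2)
  have hlim : Tendsto (fun ε => C * (eLpNorm f p m + ε)) (𝓝[>] 0) (𝓝 (C * eLpNorm f p m)) := by
    have h0 : Tendsto (fun ε => eLpNorm f p m + ε) (𝓝[>] 0) (𝓝 (eLpNorm f p m + 0)) :=
      tendsto_const_nhds.add (tendsto_nhdsWithin_of_tendsto_nhds tendsto_id)
    rw [add_zero] at h0
    exact ENNReal.Tendsto.const_mul h0 (Or.inr hC)
  refine ge_of_tendsto hlim (eventually_mem_nhdsWithin.mono fun ε hε => ?_)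
  refine eLpNorm_le_of_tendstoInMeasure ?_ hmeas fun n => Lp.aestronglyMeasurable _
  filter_upwards [hc.eventually_lt_const hε] with n hn
  refine (h _).trans (mul_le_mul_right ?_ C)
  rw [← add_sub_cancel (f : 𝕋 → ℂ) (trigPoly (c n))]
  exact (eLpNorm_add_le (Lp.aestronglyMeasurable f) (hsub n) this.out).trans (by gcongr)

theorem hasStrongType_rieszL2 {k : ℕ} (hk : 0 < k) : HasStrongType rieszL2 (2 * k : ℕ) := by
  obtain ⟨C, hC, hle⟩ := exists_eLpNorm'_trigPoly_filter_le hk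
  have h2 : (2 : ℝ≥0∞) ≤ (2 * k : ℕ) := by exact_mod_cast Nat.le_mul_of_pos_right 2 hk
  have hp : ((2 * k : ℕ) : ℝ≥0∞) ≠ ∞ := ENNReal.natCast_ne_top _
  have hnorm : ∀ u : 𝕋 → ℂ, eLpNorm' u (2 * k : ℕ) m = eLpNorm u (2 * k : ℕ) m := fun u => by
    rw [eLpNorm_eq_eLpNorm' (two_pos.trans_le h2).ne' hp, ENNReal.toReal_natCast]
  refine ⟨C + 1, by finiteness, fun f => ?_⟩
  rw [hnorm, hnorm]
  rcases eq_or_ne (eLpNorm f (2 * k : ℕ) m) ∞ with hf | hf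
  · rw [hf, ENNReal.mul_top (by simp)]
    exact le_top
  refine eLpNorm_map_le_of_trigL2 rieszL2 h2 hp (by finiteness) (fun c => ?_) hf
  rw [rieszL2_trigL2, eLpNorm_congr_ae (coeFn_trigL2 _), ← hnorm, ← hnorm]
  exact (hle c).trans (mul_le_mul_left le_self_add _)

theorem frequently_hasWeakType_rieszL2_atTop : ∃ᶠ q in atTop, HasWeakType rieszL2 q := by
  refine frequently_atTop.2 fun a => ?_
  obtain ⟨k, hk⟩ := exists_nat_ge (max a 1)
  have hk0 : 0 < k := by exact_mod_cast one_pos.trans_le ((le_max_right a 1).trans hk)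
  refine ⟨(2 * k : ℕ), ?_, (hasStrongType_rieszL2 hk0).hasWeakType (by positivity)⟩
  push_cast
  linarith [le_max_left a 1]

theorem frequently_hasWeakType_rieszL2_nhdsGT : ∃ᶠ p in 𝓝[>] 1, HasWeakType rieszL2 p := by
  have hconj : ∀ k : ℕ, 0 < k →
      (1 - ((2 * k : ℕ) : ℝ)⁻¹)⁻¹.HolderConjugate (2 * k : ℕ) := fun k hk => by
    have h := Real.HolderConjugate.one_sub_inv_inv (a := ((2 * k : ℕ) : ℝ)⁻¹) (by positivity)
      (inv_lt_one_of_one_lt₀ (by norm_cast; omega))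
    rwa [inv_inv] at h
  have hlim : Tendsto (fun k : ℕ => (1 - ((2 * k : ℕ) : ℝ)⁻¹)⁻¹) atTop (𝓝[>] 1) := by
    refine tendsto_nhdsWithin_iff.2
      ⟨?_, (eventually_gt_atTop 0).mono fun k hk => (hconj k hk).lt⟩
    have h : Tendsto (fun k : ℕ => ((2 * k : ℕ) : ℝ)⁻¹) atTop (𝓝 0) :=
      tendsto_inv_atTop_zero.comp (tendsto_natCast_atTop_atTop.comp
        (tendsto_id.const_mul_atTop' two_pos))
    simpa using (h.const_sub 1).inv₀ (by norm_num)
  refine hlim.frequently ((eventually_gt_atTop 0).mono fun k hk => ?_).frequently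
  exact (hasStrongType_rieszL2 hk).hasWeakType_of_isSymmetric isSymmetric_rieszL2 (hconj k hk)

/-! ### Boyd interpolation -/

/-- The function `t ↦ f*(s x)` on the circle, where `x ∈ [0, 1)` is the normalised angle of `t`;
for `s = 1` it is equimeasurable with `f`. -/
def dilatedRearrangement (f : 𝕋 → ℂ) (s : ℝ) (t : 𝕋) : ℂ :=
  ((decreasingRearrangement m f (ENNReal.ofReal (s * unitAngle t))).toReal : ℂ)

theorem aestronglyMeasurable_dilatedRearrangement (f : 𝕋 → ℂ) (s : ℝ) :
    AEStronglyMeasurable (dilatedRearrangement f s) m :=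
  aestronglyMeasurable_ofReal (decreasingRearrangement_antitone.measurable.comp
    (measurable_unitAngle.const_mul s).ennreal_ofReal).ennreal_toReal.aestronglyMeasurable

theorem ae_unitAngle_pos : ∀ᵐ t ∂m, 0 < unitAngle t := by
  have h : ∀ᵐ x ∂volume.restrict (Set.Ico (0 : ℝ) 1), x ≠ 0 :=
    ae_restrict_of_ae (Measure.ae_ne volume 0)
  filter_upwards [measurePreserving_unitAngle.quasiMeasurePreserving.ae h] with t ht
  exact (unitAngle_mem t).1.lt_of_ne' ht

theorem enorm_dilatedRearrangement (hf : AEStronglyMeasurable f m) {s : ℝ} (hs : 0 < s) :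
    ∀ᵐ t ∂m, ‖dilatedRearrangement f s t‖ₑ =
      decreasingRearrangement m f (ENNReal.ofReal (s * unitAngle t)) := by
  filter_upwards [ae_unitAngle_pos] with t ht
  have htop := decreasingRearrangement_ne_top hf (ENNReal.ofReal_pos.2 (mul_pos hs ht)).ne'
  rw [dilatedRearrangement, ← ofReal_norm, Complex.norm_real,
    Real.norm_of_nonneg ENNReal.toReal_nonneg, ENNReal.ofReal_toReal htop]

theorem IsRearrangementInvariant.fnrm_dilatedRearrangement_one (hri : IsRearrangementInvariant X)
    (hf : AEStronglyMeasurable f m) : X.fnrm (dilatedRearrangement f 1) = X.fnrm f := by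
  refine hri.fnrm_eq (aestronglyMeasurable_dilatedRearrangement f 1) hf fun r => ?_
  have hset : {t | r < ‖dilatedRearrangement f 1 t‖ₑ} =ᵐ[m]
      initialArc (m {t | r < ‖f t‖ₑ}).toReal := by
    filter_upwards [enorm_dilatedRearrangement hf one_pos] with t ht
    refine propext ?_
    change r < ‖_‖ₑ ↔ unitAngle t < _
    rw [ht, one_mul, ← not_le, decreasingRearrangement_le_iff, not_le,
      ENNReal.ofReal_lt_iff_lt_toReal (unitAngle_mem t).1 (measure_ne_top _ _)]
  rw [measure_congr hset, measure_initialArc (ENNReal.toReal_mono ENNReal.one_ne_top prob_le_one),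
    ENNReal.ofReal_toReal (measure_ne_top _ _)]

theorem IsRearrangementInvariant.fnrm_dilatedRearrangement_le (hri : IsRearrangementInvariant X)
    (hf : X.fnrm f < ∞) {s : ℝ} (hs : 0 < s) :
    X.fnrm (dilatedRearrangement f s) ≤ dilationNorm X s * X.fnrm f := by
  have hone := hri.fnrm_dilatedRearrangement_one (aestronglyMeasurable_of_fnrm_lt_top hf)
  have hdil : dilatedRearrangement f s = dilationFun s (dilatedRearrangement f 1) := by
    ext t
    unfold dilatedRearrangement
    rw [dilationFun_comp_unitAngle hs
      fun x => ((decreasingRearrangement m f (ENNReal.ofReal (1 * x))).toReal : ℂ), one_mul]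
    refine (ite_eq_left_iff.2 fun h => ?_).symm
    rw [decreasingRearrangement_eq_zero (measure_univ.trans_le (ENNReal.one_le_ofReal.2
      (not_lt.1 h))), ENNReal.toReal_zero, Complex.ofReal_zero]
  rw [hdil, ← hone]
  exact fnrm_dilationFun_le hs (hone.trans_lt hf)

theorem IsBanachFunctionSpace.fnrm_le_of_decreasingRearrangement_le_tsum
    (hX : IsBanachFunctionSpace X) (hri : IsRearrangementInvariant X) (hF : HasFatouProperty X)
    (hf : X.fnrm f < ∞) (hg : AEStronglyMeasurable g m) {ι : Type*} [Denumerable ι]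
    {c : ι → ℝ≥0∞} (hc : ∀ i, c i ≠ ∞) {s : ι → ℝ} (hs : ∀ i, 0 < s i)
    (h : ∀ x : ℝ, 0 < x → decreasingRearrangement m g (ENNReal.ofReal x) ≤
      ∑' i, c i * decreasingRearrangement m f (ENNReal.ofReal (s i * x))) :
    X.fnrm g ≤ (∑' i, c i * dilationNorm X (s i)) * X.fnrm f := by
  have hmeas i := aestronglyMeasurable_dilatedRearrangement f (s i)
  have hfm := aestronglyMeasurable_of_fnrm_lt_top hf
  have henorm i : ‖((c i).toReal : ℂ)‖ₑ = c i := by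
    rw [← ofReal_norm, Complex.norm_real, Real.norm_of_nonneg ENNReal.toReal_nonneg,
      ENNReal.ofReal_toReal (hc i)]
  set e : ι ≃ ℕ := Denumerable.eqv ι
  rw [← hri.fnrm_dilatedRearrangement_one hg, ← ENNReal.tsum_mul_right, ← e.symm.tsum_eq]
  refine (hX.fnrm_le_tsum hF (aestronglyMeasurable_dilatedRearrangement g 1)
    (f := fun n => ((c (e.symm n)).toReal : ℂ) • dilatedRearrangement f (s (e.symm n)))
    (fun n => (hmeas _).const_smul _) ?_).trans (ENNReal.tsum_le_tsum fun n => ?_)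
  · filter_upwards [enorm_dilatedRearrangement hg one_pos, ae_unitAngle_pos,
      ae_all_iff.2 fun n => enorm_dilatedRearrangement hfm (hs (e.symm n))] with t ht hpos hts
    simp only [Pi.smul_apply, enorm_smul, henorm, ht, hts, one_mul]
    exact (h _ hpos).trans_eq (e.symm.tsum_eq _).symm
  · rw [fnrm_const_smul _ (hmeas _), henorm, mul_assoc]
    exact mul_le_mul_right (hri.fnrm_dilatedRearrangement_le hf (hs _)) _

theorem dilationNorm_one_le (X : FunctionSpace) : dilationNorm X 1 ≤ 1 := by
  refine iSup₂_le fun f hf => (congrArg X.nrm (AEEqFun.ext ?_)).trans_le hf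
  refine (coeFn_dilation one_pos (ae_eq_refl _)).trans (.of_forall fun t => ?_)
  rw [dilationFun_eq one_pos, one_mul, if_pos (unitAngle_mem t).2, ofUnitAngle_unitAngle]

theorem HasNontrivialBoydIndices.exists_dilationNorm_pow_le (hB : HasNontrivialBoydIndices X) :
    ∃ a > (0 : ℝ), ∃ b < (1 : ℝ), ∃ R > (1 : ℝ), ∀ j : ℕ,
      dilationNorm X (R⁻¹ ^ j) ≤ ENNReal.ofReal ((R ^ j) ^ b) ∧
      dilationNorm X (R ^ j) ≤ ENNReal.ofReal ((R⁻¹ ^ j) ^ a) := by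
  obtain ⟨a, ha, hsmall⟩ := hB.exists_dilationNorm_le_nhdsGT
  obtain ⟨b, hb, hlarge⟩ := hB.exists_dilationNorm_le_atTop
  obtain ⟨R, hR, hR1⟩ := (((eventually_forall_ge_atTop.2 hlarge).and
    (eventually_forall_ge_atTop.2 (tendsto_inv_atTop_nhdsGT_zero.eventually hsmall))).and
    (eventually_gt_atTop 1)).exists
  refine ⟨a, ha.1, b, hb.2, R, hR1, fun j => ?_⟩
  rcases Nat.eq_zero_or_pos j with rfl | hj
  · simpa using dilationNorm_one_le X
  have hRj : R ≤ R ^ j := le_self_pow₀ hR1.le hj.ne'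
  refine ⟨?_, ?_⟩
  · simpa using hR.1 _ hRj
  · simpa using hR.2 _ hRj

section WeakType

variable {α : Type*} [MeasurableSpace α] {μ : Measure α}
  {T : Lp ℂ 2 μ → Lp ℂ 2 μ} {p q : ℝ}

theorem decreasingRearrangement_half_le_of_rpow_mul_le {u : α → ℂ} {N C x : ℝ≥0∞}
    (hp : 1 ≤ p) (hx0 : x ≠ 0) (hx : x ≠ ∞)
    (hu : (x / 2) ^ (1 / p) * decreasingRearrangement μ u (x / 2) ≤ C * N) {a r : ℕ → ℝ≥0∞}
    (hN : N ≤ ∑' j, a j * (r j * x) ^ (1 / p)) :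
    decreasingRearrangement μ u (x / 2) ≤ 2 * C * ∑' j, r j ^ (1 / p) * a j := by
  have hp0 : 0 ≤ 1 / p := one_div_nonneg.2 (zero_le_one.trans hp)
  have hhalf : (x / 2) ^ (1 / p) ≠ 0 :=
    (ENNReal.rpow_pos (ENNReal.half_pos hx0) (ENNReal.div_ne_top hx two_ne_zero)).ne'
  have hhalf' : (x / 2) ^ (1 / p) ≠ ∞ :=
    ENNReal.rpow_ne_top_of_nonneg hp0 (ENNReal.div_ne_top hx two_ne_zero)
  have hdouble : x ^ (1 / p) ≤ 2 * (x / 2) ^ (1 / p) :=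
    calc x ^ (1 / p) = (2 * (x / 2)) ^ (1 / p) := by
          rw [ENNReal.mul_div_cancel two_ne_zero ENNReal.ofNat_ne_top]
      _ = 2 ^ (1 / p) * (x / 2) ^ (1 / p) := ENNReal.mul_rpow_of_nonneg _ _ hp0
      _ ≤ 2 * (x / 2) ^ (1 / p) := mul_le_mul_left
        ((ENNReal.rpow_le_rpow_of_exponent_le one_le_two
          ((div_le_one (one_pos.trans_le hp)).2 hp)).trans_eq (ENNReal.rpow_one 2)) _
  refine (ENNReal.mul_le_mul_iff_right hhalf hhalf').1 (hu.trans ?_)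
  calc C * N ≤ C * ∑' j, a j * (r j * x) ^ (1 / p) := mul_le_mul_right hN C
    _ = C * x ^ (1 / p) * ∑' j, r j ^ (1 / p) * a j := by
      rw [mul_assoc, ← ENNReal.tsum_mul_left (a := x ^ (1 / p))]
      refine congrArg (C * ·) (tsum_congr fun j => ?_)
      rw [ENNReal.mul_rpow_of_nonneg _ _ hp0]
      ring
    _ ≤ C * (2 * (x / 2) ^ (1 / p)) * ∑' j, r j ^ (1 / p) * a j := by gcongr
    _ = _ := by ring

theorem HasWeakType.exists_decreasingRearrangement_le [IsFiniteMeasure μ] (hp : 1 ≤ p)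
    (hT : HasWeakType T p) (hq : 1 ≤ q) (hT' : HasWeakType T q)
    (hadd : ∀ f g, T (f + g) = T f + T g) {R : ℝ≥0∞} (hR : 1 < R) :
    ∃ C : ℝ≥0∞, C ≠ ∞ ∧ ∀ f : Lp ℂ 2 μ, ∀ x : ℝ≥0∞, x ≠ 0 → x ≠ ∞ →
      decreasingRearrangement μ (T f) x ≤
        C * (∑' j : ℕ, (R⁻¹ ^ j) ^ (1 / p) * decreasingRearrangement μ f (R⁻¹ ^ (j + 1) * x) +
          ∑' j : ℕ, (R ^ (j + 1)) ^ (1 / q) * decreasingRearrangement μ f (R ^ j * x)) := by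
  obtain ⟨C, hC, hle⟩ := hT
  obtain ⟨D, hD, hle'⟩ := hT'
  refine ⟨2 * C + 2 * D, by finiteness, fun f x hx0 hx => ?_⟩
  have hf := Lp.aestronglyMeasurable f
  set E : Set α := {t | decreasingRearrangement μ f x < ‖f t‖ₑ}
  have hE : MeasurableSet E :=
    measurableSet_lt measurable_const (Lp.stronglyMeasurable f).measurable.enorm
  have hcompl : Eᶜ = {t | ‖f t‖ₑ ≤ decreasingRearrangement μ f x} :=
    Set.ext fun t => by simp [E]
  have hmem := (Lp.memLp f).indicator hE
  have hmem' := (Lp.memLp f).indicator hE.compl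
  have hsplit : T f = T hmem.toLp + T hmem'.toLp := by
    rw [← hadd, ← MemLp.toLp_add]
    refine congrArg T ((Lp.toLp_coeFn f (Lp.memLp f)).symm.trans ?_)
    exact MemLp.toLp_congr _ _ (.of_eq (Set.indicator_self_add_compl E f).symm)
  have hlarge := decreasingRearrangement_half_le_of_rpow_mul_le hp hx0 hx (hle hmem.toLp (x / 2))
    ((eLpNorm'_congr_ae hmem.coeFn_toLp).trans_le (eLpNorm'_indicator_lt_le_tsum hp hf hR hx))
  have hsmall := decreasingRearrangement_half_le_of_rpow_mul_le hq hx0 hx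
    (hle' hmem'.toLp (x / 2)) ((eLpNorm'_congr_ae hmem'.coeFn_toLp).trans_le
      ((congrArg (fun S : Set α => eLpNorm' (S.indicator f) q μ) hcompl).trans_le
        (eLpNorm'_indicator_le_le_tsum hq hf hR hx0)))
  rw [hsplit, decreasingRearrangement_congr (Lp.coeFn_add _ _), ← ENNReal.add_halves x]
  refine (decreasingRearrangement_add_le _ _).trans ((add_le_add hlarge hsmall).trans ?_)
  rw [ENNReal.add_halves, mul_add]
  exact add_le_add (mul_le_mul_left le_self_add _) (mul_le_mul_left le_add_self _)

end WeakType

/-- The ratios of the dilations of `f*` that control `(T f)*` when `T` is of two weak types. -/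
def dilationRatio (R : ℝ) : ℕ ⊕ ℕ → ℝ := Sum.elim (fun j => R⁻¹ ^ (j + 1)) (fun j => R ^ j)

/-- The coefficients of the dilations of `f*` by `dilationRatio R` in the estimate for `(T f)*`
when `T` is of weak types `(p, p)` and `(q, q)`. -/
def dilationWeight (p q R : ℝ) : ℕ ⊕ ℕ → ℝ :=
  Sum.elim (fun j => (R⁻¹ ^ j) ^ (1 / p)) fun j => (R ^ (j + 1)) ^ (1 / q)

theorem tsum_natSum (a : ℕ ⊕ ℕ → ℝ≥0∞) :
    ∑' i, a i = ∑' j, a (.inl j) + ∑' j, a (.inr j) :=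
  ENNReal.summable.tsum_sum ENNReal.summable

theorem HasWeakType.exists_decreasingRearrangement_le_tsum {p q : ℝ} {T : Lp ℂ 2 m → Lp ℂ 2 m}
    (hp : 1 ≤ p) (hT : HasWeakType T p) (hq : 1 ≤ q) (hT' : HasWeakType T q)
    (hadd : ∀ f g, T (f + g) = T f + T g) {R : ℝ} (hR : 1 < R) :
    ∃ C : ℝ≥0∞, C ≠ ∞ ∧ ∀ f : Lp ℂ 2 m, ∀ x : ℝ, 0 < x →
      decreasingRearrangement m (T f) (ENNReal.ofReal x) ≤
        ∑' i, C * ENNReal.ofReal (dilationWeight p q R i) *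
          decreasingRearrangement m f (ENNReal.ofReal (dilationRatio R i * x)) := by
  have hR0 : 0 < R := one_pos.trans hR
  obtain ⟨C, hC, hle⟩ := hT.exists_decreasingRearrangement_le hp hq hT' hadd
    (ENNReal.one_lt_ofReal.2 hR)
  refine ⟨C, hC, fun f x hx => (hle f _ (ENNReal.ofReal_pos.2 hx).ne' ENNReal.ofReal_ne_top).trans
    (le_of_eq ?_)⟩
  simp only [mul_assoc]
  rw [ENNReal.tsum_mul_left, tsum_natSum]
  simp only [dilationWeight, dilationRatio, Sum.elim_inl, Sum.elim_inr]
  congr 3 with j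
  all_goals
    rw [← ENNReal.ofReal_rpow_of_pos (by positivity), ENNReal.ofReal_mul (by positivity),
      ENNReal.ofReal_pow (by positivity), ENNReal.ofReal_pow (by positivity)]
    try rw [ENNReal.ofReal_inv_of_pos hR0]

theorem tsum_ofReal_rpow_ne_top {R d : ℝ} (hR : 1 < R) (hd : d < 0) (e : ℝ) :
    ∑' j : ℕ, ENNReal.ofReal (R ^ (d * j + e)) ≠ ∞ := by
  have hR0 : 0 < R := one_pos.trans hR
  have hsum : Summable fun j : ℕ => R ^ (d * j + e) := by
    simp only [Real.rpow_add hR0, Real.rpow_mul hR0.le, Real.rpow_natCast]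
    exact (summable_geometric_of_lt_one (by positivity)
      (Real.rpow_lt_one_of_one_lt_of_neg hR hd)).mul_right _
  exact hsum.tsum_ofReal_ne_top

theorem tsum_dilationWeight_mul_ne_top {R a b p q : ℝ} (hR : 1 < R) (hp : b < 1 / p)
    (hq : 1 / q < a) {N : ℝ → ℝ≥0∞}
    (hN : ∀ j : ℕ, N (R⁻¹ ^ j) ≤ ENNReal.ofReal ((R ^ j) ^ b) ∧
      N (R ^ j) ≤ ENNReal.ofReal ((R⁻¹ ^ j) ^ a)) :
    ∑' i, ENNReal.ofReal (dilationWeight p q R i) * N (dilationRatio R i) ≠ ∞ := by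
  have hR0 : 0 < R := one_pos.trans hR
  rw [tsum_natSum]
  refine ENNReal.add_ne_top.2
    ⟨ne_top_of_le_ne_top (tsum_ofReal_rpow_ne_top hR (sub_neg.2 hp) b)
      (ENNReal.tsum_le_tsum fun j => (mul_le_mul_right (hN (j + 1)).1 _).trans_eq ?_),
    ne_top_of_le_ne_top (tsum_ofReal_rpow_ne_top hR (sub_neg.2 hq) (1 / q))
      (ENNReal.tsum_le_tsum fun j => (mul_le_mul_right (hN j).2 _).trans_eq ?_)⟩
  all_goals
    simp only [dilationWeight, Sum.elim_inl, Sum.elim_inr]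
    rw [← ENNReal.ofReal_mul (by positivity), inv_pow, ← Real.rpow_natCast, ← Real.rpow_natCast,
      ← Real.rpow_neg hR0.le, ← Real.rpow_mul hR0.le, ← Real.rpow_mul hR0.le,
      ← Real.rpow_add hR0]
    congr 2
    push_cast
    ring

theorem IsBanachFunctionSpace.exists_fnrm_map_le (hX : IsBanachFunctionSpace X)
    (hri : IsRearrangementInvariant X) (hF : HasFatouProperty X)
    (hB : HasNontrivialBoydIndices X) {T : Lp ℂ 2 m → Lp ℂ 2 m}
    (hadd : ∀ f g, T (f + g) = T f + T g) (hp : ∃ᶠ p in 𝓝[>] 1, HasWeakType T p)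
    (hq : ∃ᶠ q in atTop, HasWeakType T q) :
    ∃ C : ℝ≥0∞, C ≠ ∞ ∧ ∀ f : Lp ℂ 2 m, X.fnrm f < ∞ → X.fnrm (T f) ≤ C * X.fnrm f := by
  obtain ⟨a, ha, b, hb, R, hR, hdil⟩ := hB.exists_dilationNorm_pow_le
  have : 0 < R := one_pos.trans hR
  have hpb : ∀ᶠ p : ℝ in 𝓝[>] 1, b < 1 / p := by
    have h : Tendsto (fun p : ℝ => 1 / p) (𝓝 1) (𝓝 (1 / 1)) :=
      tendsto_const_nhds.div tendsto_id one_ne_zero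
    exact (h.mono_left nhdsWithin_le_nhds).eventually_const_lt (by rwa [one_div_one])
  have hqa : ∀ᶠ q : ℝ in atTop, 1 / q < a :=
    (tendsto_const_nhds.div_atTop tendsto_id).eventually_lt_const ha
  obtain ⟨p, hTp, hpb, hp1⟩ := (hp.and_eventually (hpb.and self_mem_nhdsWithin)).exists
  obtain ⟨q, hTq, hqa, hq1⟩ := (hq.and_eventually (hqa.and (eventually_ge_atTop 1))).exists
  obtain ⟨C, hC, hle⟩ := hTp.exists_decreasingRearrangement_le_tsum hp1.le hq1 hTq hadd hR
  refine ⟨∑' i, C * ENNReal.ofReal (dilationWeight p q R i) * dilationNorm X (dilationRatio R i),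
    ?_, fun f hf => hX.fnrm_le_of_decreasingRearrangement_le_tsum hri hF hf
      (Lp.aestronglyMeasurable _) (fun i => by finiteness) (fun i => ?_) (hle f)⟩
  · simp only [mul_assoc]
    rw [ENNReal.tsum_mul_left]
    exact ENNReal.mul_ne_top hC (tsum_dilationWeight_mul_ne_top hR hpb hqa hdil)
  · rcases i with j | j <;> simp only [dilationRatio, Sum.elim_inl, Sum.elim_inr] <;> positivity

/-! ### Weak limits -/

section WeakLimit

variable {ι E H : Type*} [NormedAddCommGroup E] [NormedSpace ℂ E]

theorem exists_tendsto_apply_of_norm_le (U : Ultrafilter ι) {ψ : ι → StrongDual ℂ E} {K : ℝ}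
    (hψ : ∀ i, ‖ψ i‖ ≤ K) :
    ∃ ℓ : StrongDual ℂ E, ∀ v, Tendsto (fun i => ψ i v) U (𝓝 (ℓ v)) := by
  obtain ⟨ℓ, -, hℓ⟩ := (WeakDual.isCompact_closedBall (𝕜 := ℂ) (E := E) 0 K).ultrafilter_le_nhds
    (U.map fun i => StrongDual.toWeakDual (ψ i)) (le_principal_iff.2 (Eventually.of_forall
      (f := (U : Filter ι)) fun i => by simpa using hψ i))
  exact ⟨WeakDual.toStrongDual ℓ, fun v => ((WeakDual.eval_continuous v).tendsto ℓ).comp hℓ⟩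

theorem exists_weakLimit_of_norm_le [NormedAddCommGroup H] [InnerProductSpace ℂ H]
    [CompleteSpace H] (U : Ultrafilter ι) {x : ι → H} {K : ℝ} (hx : ∀ i, ‖x i‖ ≤ K) :
    ∃ a : H, ∀ φ : StrongDual ℂ H, Tendsto (fun i => φ (x i)) U (𝓝 (φ a)) := by
  obtain ⟨ℓ, hℓ⟩ := exists_tendsto_apply_of_norm_le U
    (ψ := fun i => InnerProductSpace.toDual ℂ H (x i)) (K := K) (by simpa using hx)
  refine ⟨(InnerProductSpace.toDual ℂ H).symm ℓ, fun φ => ?_⟩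
  have hφ (z : H) : φ z = conj (inner ℂ z ((InnerProductSpace.toDual ℂ H).symm φ)) := by
    rw [inner_conj_symm, InnerProductSpace.toDual_symm_apply]
  simp only [hφ, InnerProductSpace.toDual_symm_apply]
  exact (Complex.continuous_conj.tendsto _).comp (hℓ _)

theorem exists_weakLimit_of_forall_exists_norm_sub_le [CompleteSpace E] (U : Ultrafilter ι)
    {x : ι → E} {K : ℝ} (hx : ∀ i, ‖x i‖ ≤ K)
    (h : ∀ ε > 0, ∃ (y : ι → E) (a : E),
      (∀ φ : StrongDual ℂ E, Tendsto (fun i => φ (y i)) U (𝓝 (φ a))) ∧ ∀ i, ‖x i - y i‖ ≤ ε) :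
    ∃ a : E, ∀ φ : StrongDual ℂ E, Tendsto (fun i => φ (x i)) U (𝓝 (φ a)) := by
  let J := NormedSpace.inclusionInDoubleDualLi (E := E) ℂ
  obtain ⟨ℓ, hℓ⟩ := exists_tendsto_apply_of_norm_le U (ψ := fun i => J (x i)) (K := K)
    (by simpa only [J.norm_map] using hx)
  -- the weak limit exists in the bidual, and `E` is closed there
  have hmem : ℓ ∈ Set.range J := by
    rw [← J.isometry.isClosedEmbedding.isClosed_range.closure_eq, Metric.mem_closure_range_iff]
    intro ε hε
    obtain ⟨y, a, hya, hxy⟩ := h (ε / 2) (half_pos hε)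
    refine ⟨a, lt_of_le_of_lt ?_ (half_lt_self hε)⟩
    rw [dist_eq_norm]
    refine ContinuousLinearMap.opNorm_le_bound _ (half_pos hε).le fun φ => ?_
    refine le_of_tendsto ((hℓ φ).sub (hya φ)).norm (Eventually.of_forall fun i => ?_)
    calc ‖φ (x i) - φ (y i)‖ = ‖φ (x i - y i)‖ := by rw [map_sub]
      _ ≤ ‖φ‖ * ‖x i - y i‖ := φ.le_opNorm _
      _ ≤ ε / 2 * ‖φ‖ := by rw [mul_comm]; gcongr; exact hxy i
  obtain ⟨a, rfl⟩ := hmem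
  exact ⟨a, hℓ⟩

theorem mem_of_weakLimit {l : Filter ι} [l.NeBot] {x : ι → E} {a : E}
    (hlim : ∀ φ : StrongDual ℂ E, Tendsto (fun i => φ (x i)) l (𝓝 (φ a))) {S : Set E}
    (hconv : Convex ℝ S) (hclosed : IsClosed S) (hx : ∀ i, x i ∈ S) : a ∈ S := by
  by_contra ha
  obtain ⟨φ, u, hφS, hφa⟩ := RCLike.geometric_hahn_banach_closed_point (𝕜 := ℂ) hconv hclosed ha
  have hre : Tendsto (fun i => RCLike.re (φ (x i))) l (𝓝 (RCLike.re (φ a))) :=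
    (RCLike.continuous_re.tendsto _).comp (hlim φ)
  exact (le_of_tendsto' hre fun i => (hφS _ (hx i)).le).not_gt hφa

variable {α : Type*} [MeasurableSpace α] {μ : Measure α} [IsFiniteMeasure μ]

variable (E μ) in
/-- The inclusion of `L^q` into `L^p`, for `p ≤ q` and a finite measure. -/
def lpInclusion {p q : ℝ≥0∞} [Fact (1 ≤ p)] [Fact (1 ≤ q)] (hpq : p ≤ q) :
    Lp E q μ →L[ℂ] Lp E p μ :=
  LinearMap.mkContinuous
    { toFun := fun f => ⟨f, Lp.antitone hpq f.2⟩
      map_add' := fun _ _ => rfl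
      map_smul' := fun _ _ => rfl }
    (μ Set.univ ^ (1 / p.toReal - 1 / q.toReal)).toReal fun f => by
      have hp : p ≠ 0 := (one_pos.trans_le Fact.out).ne'
      have hexp : 0 ≤ 1 / p.toReal - 1 / q.toReal := by
        simp only [one_div, ← ENNReal.toReal_inv]
        exact sub_nonneg.2
          (ENNReal.toReal_mono (ENNReal.inv_ne_top.2 hp) (ENNReal.inv_le_inv.2 hpq))
      rw [mul_comm]
      refine (ENNReal.toReal_mono (ENNReal.mul_ne_top (Lp.eLpNorm_ne_top f)
        (ENNReal.rpow_ne_top_of_nonneg hexp (measure_ne_top _ _)))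
        (eLpNorm_le_eLpNorm_mul_rpow_measure_univ hpq (Lp.aestronglyMeasurable f))).trans_eq ?_
      exact ENNReal.toReal_mul

theorem coeFn_lpInclusion {p q : ℝ≥0∞} [Fact (1 ≤ p)] [Fact (1 ≤ q)] (hpq : p ≤ q)
    (f : Lp E q μ) : (lpInclusion E μ hpq f : α → E) = f := rfl

theorem exists_weakLimit_of_uniformIntegrable (U : Ultrafilter ι) {x : ι → Lp ℂ 1 μ}
    (hx : UniformIntegrable (fun i => (x i : α → ℂ)) 1 μ) :
    ∃ a : Lp ℂ 1 μ, ∀ φ : StrongDual ℂ (Lp ℂ 1 μ), Tendsto (fun i => φ (x i)) U (𝓝 (φ a)) := by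
  obtain ⟨K, hK⟩ := hx.2.2
  refine exists_weakLimit_of_forall_exists_norm_sub_le U (K := K) (fun i => ?_) fun ε hε => ?_
  · exact ENNReal.toReal_le_of_le_ofReal K.2 (by simpa using hK i)
  obtain ⟨C, hC⟩ := hx.spec one_ne_zero ENNReal.one_ne_top hε
  have hE (i) : MeasurableSet {t | C ≤ ‖x i t‖₊} :=
    measurableSet_le measurable_const (Lp.stronglyMeasurable (x i)).measurable.nnnorm
  have hy (i t) : ‖{t | C ≤ ‖x i t‖₊}ᶜ.indicator (x i) t‖ ≤ C := by
    by_cases ht : C ≤ ‖x i t‖₊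
    · simp [ht]
    · simpa [ht] using NNReal.coe_le_coe.2 (not_le.1 ht).le
  have hmem (i) : MemLp ({t | C ≤ ‖x i t‖₊}ᶜ.indicator (x i)) 2 μ :=
    .of_bound ((Lp.aestronglyMeasurable (x i)).indicator (hE i).compl) C (.of_forall (hy i))
  obtain ⟨a, ha⟩ := exists_weakLimit_of_norm_le U (x := fun i => (hmem i).toLp)
    (K := measureUnivNNReal μ ^ (2 : ℝ≥0∞).toReal⁻¹ * C) fun i =>
      Lp.norm_le_of_ae_bound C.2 ((hmem i).coeFn_toLp.mono fun t ht => ht ▸ hy i t)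
  refine ⟨fun i => lpInclusion ℂ μ one_le_two (hmem i).toLp, lpInclusion ℂ μ one_le_two a,
    fun φ => ha (φ.comp (lpInclusion ℂ μ one_le_two)), fun i => ?_⟩
  refine ENNReal.toReal_le_of_le_ofReal hε.le (le_trans (le_of_eq (eLpNorm_congr_ae ?_)) (hC i))
  filter_upwards [Lp.coeFn_sub (x i) (lpInclusion ℂ μ one_le_two (hmem i).toLp),
    (hmem i).coeFn_toLp] with t hsub ht
  rw [hsub, Pi.sub_apply, coeFn_lpInclusion, ht, Set.indicator_compl, Pi.sub_apply, sub_sub_cancel]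

end WeakLimit

/-! ### The Riesz projection -/

theorem tendsto_fourierCoeff_of_dominated (hf : Integrable f m) {u : ℕ → 𝕋 → ℂ}
    (hu : ∀ k, AEStronglyMeasurable (u k) m) (hle : ∀ k t, ‖u k t‖ ≤ ‖f t‖)
    (hlim : ∀ t, Tendsto (fun k => u k t) atTop (𝓝 (f t))) (n : ℤ) :
    Tendsto (fun k => fourierCoeff (u k) n) atTop (𝓝 (fourierCoeff f n)) := by
  refine tendsto_integral_of_dominated_convergence (fun t => ‖f t‖) (fun k => ?_) hf.norm
    (fun k => .of_forall fun t => ?_) (.of_forall fun t => (hlim t).const_smul _)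
  · exact (fourier (-n)).continuous.aestronglyMeasurable.smul (hu k)
  · simpa only [norm_smul, norm_fourier_apply, one_mul] using hle k t

theorem FunctionSpace.convex_fnrm_le (X : FunctionSpace) (p : ℝ≥0∞) (K : ℝ≥0∞) :
    Convex ℝ {h : Lp ℂ p m | X.fnrm h ≤ K} := by
  intro f hf g hg r s hr hs hrs
  have hsmul {r : ℝ} (hr : 0 ≤ r) (f : Lp ℂ p m) :
      X.fnrm ((r • f : Lp ℂ p m) : 𝕋 → ℂ) = ENNReal.ofReal r * X.fnrm f := by
    rw [fnrm_congr (Lp.coeFn_smul r f), show r • (f : 𝕋 → ℂ) = (r : ℂ) • (f : 𝕋 → ℂ) by ext; simp,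
      fnrm_const_smul _ (Lp.aestronglyMeasurable f), ← ofReal_norm, Complex.norm_real,
      Real.norm_of_nonneg hr]
  calc X.fnrm ((r • f + s • g : Lp ℂ p m) : 𝕋 → ℂ)
      ≤ ENNReal.ofReal r * X.fnrm f + ENNReal.ofReal s * X.fnrm g := by
        rw [fnrm_congr (Lp.coeFn_add _ _), ← hsmul hr, ← hsmul hs]
        exact fnrm_add_le _ _
    _ ≤ ENNReal.ofReal r * K + ENNReal.ofReal s * K :=
        add_le_add (mul_le_mul_right hf _) (mul_le_mul_right hg _)
    _ = K := by rw [← add_mul, ← ENNReal.ofReal_add hr hs, hrs, ENNReal.ofReal_one, one_mul]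

namespace IsBanachFunctionSpace

theorem uniformIntegrable_of_fnrm_le (hX : IsBanachFunctionSpace X)
    (hri : IsRearrangementInvariant X) (hB : HasNontrivialBoydIndices X) {ι : Type*}
    {b : ι → 𝕋 → ℂ} (hbm : ∀ i, AEStronglyMeasurable (b i) m) {K : ℝ≥0∞} (hK : K ≠ ∞)
    (hb : ∀ i, X.fnrm (b i) ≤ K) : UniformIntegrable b 1 m := by
  obtain ⟨r, hr, B, -, hBtop, hweak⟩ := hX.exists_measure_lt_norm_le hri hB
  have htop : (B * K) ^ r ≠ ∞ :=
    ENNReal.rpow_ne_top_of_nonneg (one_pos.trans hr).le (ENNReal.mul_ne_top hBtop hK)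
  have hlim : Tendsto (fun T : ℝ => (B * K) ^ r *
      ENNReal.ofReal (T ^ (1 - r) * (1 + 1 / (r - 1)))) atTop (𝓝 0) := by
    have h := (tendsto_rpow_neg_atTop (sub_pos.2 hr)).mul_const (1 + 1 / (r - 1))
    simpa using ENNReal.Tendsto.const_mul (ENNReal.tendsto_ofReal h) (.inr htop)
  refine uniformIntegrable_of le_rfl ENNReal.one_ne_top hbm fun ε hε => ?_
  obtain ⟨T, hTε, hT⟩ := ((hlim.eventually_le_const (ENNReal.ofReal_pos.2 hε)).and
    (eventually_gt_atTop 0)).exists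
  refine ⟨(T + 1).toNNReal, fun i => ?_⟩
  have hE : NullMeasurableSet {t | T < ‖b i t‖} m :=
    nullMeasurableSet_lt aemeasurable_const (hbm i).norm.aemeasurable
  calc eLpNorm ({t | (T + 1).toNNReal ≤ ‖b i t‖₊}.indicator (b i)) 1 m
      ≤ eLpNorm ({t | T < ‖b i t‖}.indicator (b i)) 1 m := by
        refine eLpNorm_mono fun t => norm_indicator_le_of_subset (fun t ht => ?_) _ _
        exact (lt_add_one T).trans_le (Real.toNNReal_le_iff_le_coe.1 ht)
    _ = ∫⁻ t in {t | T < ‖b i t‖}, ‖b i t‖ₑ ∂m := by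
        simp only [eLpNorm_one_eq_lintegral_enorm, enorm_indicator_eq_indicator_enorm,
          lintegral_indicator₀ hE]
    _ ≤ (B * K) ^ r * ENNReal.ofReal (T ^ (1 - r) * (1 + 1 / (r - 1))) := by
        refine setLIntegral_lt_enorm_le_of_weakType (hbm i) hr (fun l hl => ?_) hT
        refine (hweak (b i) (hbm i) l hl).trans ?_
        gcongr
        exact hb i
    _ ≤ ENNReal.ofReal ε := hTε

theorem isClosed_fnrm_le (hX : IsBanachFunctionSpace X) (hF : HasFatouProperty X) (p : ℝ≥0∞)
    [Fact (1 ≤ p)] (K : ℝ≥0∞) : IsClosed {h : Lp ℂ p m | X.fnrm h ≤ K} := by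
  refine IsSeqClosed.isClosed fun u v hu huv => ?_
  obtain ⟨ns, -, hns⟩ := (tendstoInMeasure_of_tendsto_Lp huv).exists_seq_tendsto_ae
  exact hX.fnrm_le_of_tendsto_ae hF (Lp.aestronglyMeasurable v)
    (fun n => Lp.aestronglyMeasurable (u (ns n))) hns fun n => hu (ns n)

theorem exists_fourierCoeff_eq_of_tendsto (hX : IsBanachFunctionSpace X)
    (hri : IsRearrangementInvariant X) (hB : HasNontrivialBoydIndices X)
    (hF : HasFatouProperty X) {ι : Type*} {l : Filter ι} [l.NeBot] {b : ι → 𝕋 → ℂ}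
    (hbm : ∀ i, AEStronglyMeasurable (b i) m) {K : ℝ≥0∞} (hK : K ≠ ∞)
    (hb : ∀ i, X.fnrm (b i) ≤ K) {c : ℤ → ℂ}
    (hc : ∀ n, Tendsto (fun i => fourierCoeff (b i) n) l (𝓝 (c n))) :
    ∃ a : 𝕋 → ℂ, X.fnrm a ≤ K ∧ ∀ n, fourierCoeff a n = c n := by
  have hui := hX.uniformIntegrable_of_fnrm_le hri hB hbm hK hb
  have hx (i) := (hui.memLp i).coeFn_toLp
  obtain ⟨a, ha⟩ := exists_weakLimit_of_uniformIntegrable (Ultrafilter.of l)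
    (hui.ae_eq fun i => (hx i).symm)
  refine ⟨a, ?_, fun n => ?_⟩
  · exact mem_of_weakLimit ha (convex_fnrm_le X 1 K) (hX.isClosed_fnrm_le hF 1 K)
      fun i => (fnrm_congr (hx i)).trans_le (hb i)
  · refine tendsto_nhds_unique (ha (fourierCoeffL1 n))
      (((hc n).mono_left (Ultrafilter.of_le l)).congr fun i => ?_)
    rw [fourierCoeffL1_apply, fourierCoeff_congr_ae (hx i)]

theorem exists_fnrm_le_mul_and_fourierCoeff_eq (hX : IsBanachFunctionSpace X)
    (hri : IsRearrangementInvariant X) (hB : HasNontrivialBoydIndices X)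
    (hF : HasFatouProperty X) : ∃ C : ℝ≥0∞, C ≠ ∞ ∧ ∀ f : 𝕋 → ℂ, X.fnrm f < ∞ →
      ∃ h : 𝕋 → ℂ, X.fnrm h ≤ C * X.fnrm f ∧
        ∀ n, fourierCoeff h n = if 0 ≤ n then fourierCoeff f n else 0 := by
  obtain ⟨C, hC, hle⟩ := hX.exists_fnrm_map_le hri hF hB (map_add rieszL2)
    frequently_hasWeakType_rieszL2_nhdsGT frequently_hasWeakType_rieszL2_atTop
  refine ⟨C, hC, fun f hf => ?_⟩
  have hfi := (hX.embedsInL1 hri hB).integrable_of_fnrm_lt_top hf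
  let E (k : ℕ) : Set 𝕋 := {t | ‖f t‖ ≤ k}
  have hE (k) : NullMeasurableSet (E k) m :=
    nullMeasurableSet_le hfi.1.norm.aemeasurable aemeasurable_const
  have hmem (k) : MemLp ((E k).indicator f) 2 m :=
    .of_bound (hfi.1.indicator₀ (hE k)) k <| .of_forall fun t => by
      by_cases ht : t ∈ E k
      · rw [Set.indicator_of_mem ht]
        exact (show ‖f t‖ ≤ k from ht)
      · simp [ht]
  have hfnrm (k) : X.fnrm (hmem k).toLp ≤ X.fnrm f :=
    (fnrm_congr (hmem k).coeFn_toLp).trans_le (hX.fnrm_indicator_le (hE k) hfi.1)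
  refine hX.exists_fourierCoeff_eq_of_tendsto hri hB hF (l := atTop)
    (b := fun k => rieszL2 (hmem k).toLp) (fun k => Lp.aestronglyMeasurable _)
    (ENNReal.mul_ne_top hC hf.ne)
    (fun k => (hle _ ((hfnrm k).trans_lt hf)).trans (mul_le_mul_right (hfnrm k) C)) fun n => ?_
  simp only [fourierCoeff_rieszL2, fourierCoeff_congr_ae (hmem _).coeFn_toLp]
  split_ifs
  · refine tendsto_fourierCoeff_of_dominated hfi (fun k => hfi.1.indicator₀ (hE k))
      (fun k t => norm_indicator_le_norm_self _ _) (fun t => tendsto_const_nhds.congr' ?_) n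
    filter_upwards [eventually_ge_atTop ⌈‖f t‖⌉₊] with k hk
    exact (Set.indicator_of_mem (s := E k) (Nat.ceil_le.1 hk) f).symm
  · exact tendsto_const_nhds

theorem exists_isRieszProjection (hX : IsBanachFunctionSpace X)
    (hri : IsRearrangementInvariant X) (hB : HasNontrivialBoydIndices X)
    (hF : HasFatouProperty X) : ∃ P : X.space →L[ℂ] X.space, IsRieszProjection P := by
  have hL := hX.embedsInL1 hri hB
  obtain ⟨C, hC, h⟩ := hX.exists_fnrm_le_mul_and_fourierCoeff_eq hri hB hF
  have hex (f : X.space) : ∃ h : X.space, ‖h‖ ≤ C.toReal * ‖f‖ ∧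
      ∀ n, hL.coeff n h = if 0 ≤ n then hL.coeff n f else 0 := by
    obtain ⟨h, hle, hcoeff⟩ := h (f : L0) (fnrm_lt_top f)
    have hh : X.fnrm h < ∞ := hle.trans_lt (ENNReal.mul_lt_top hC.lt_top (fnrm_lt_top f))
    refine ⟨X.toSpace h hh, ?_, fun n => ?_⟩
    · have hnorm : ‖X.toSpace h hh‖ₑ ≤ C * ‖f‖ₑ := by
        rwa [enorm_toSpace, enorm_eq_fnrm f (ae_eq_refl _)]
      simpa using ENNReal.toReal_mono (ENNReal.mul_ne_top hC enorm_ne_top) hnorm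
    · simp only [hL.coeff_apply, fourierCoeff_congr_ae (coeFn_toSpace hh), hcoeff]
  choose P hP hcoeff using hex
  have hext {f g : X.space} (h : ∀ n, hL.coeff n f = hL.coeff n g) : f = g := hL.ext h
  refine ⟨LinearMap.mkContinuous
    { toFun := P
      map_add' := fun f g => hext fun n => ?_
      map_smul' := fun c f => hext fun n => ?_ } C.toReal hP,
    fun f => ⟨hL.integrable f, hL.integrable (P f), hcoeff f⟩⟩
  · simp only [map_add, hcoeff]
    split_ifs <;> simp
  · simp only [map_smul, hcoeff, RingHom.id_apply]
    split_ifs <;> simp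

end IsBanachFunctionSpace

/-! ### Density of the analytic polynomials -/

theorem IsRearrangementInvariant.fnrm_translate (hri : IsRearrangementInvariant X) (g : C(𝕋, ℂ))
    (s : 𝕋) : X.fnrm (fun t => g (t + s)) = X.fnrm g := by
  refine hri.fnrm_eq (g.continuous.comp (continuous_add_const s)).aestronglyMeasurable
    (aestronglyMeasurable_continuousMap g) fun r => ?_
  exact (measurePreserving_add_right m s).measure_preimage (s := {t | r < ‖g t‖ₑ})
    (measurableSet_lt measurable_const g.continuous.enorm.measurable).nullMeasurableSet

/-- Translation of trigonometric polynomials by `s`, acting on their coefficients. -/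
def translate (s : 𝕋) : (ℤ →₀ ℂ) →ₗ[ℂ] (ℤ →₀ ℂ) :=
  Finsupp.linearCombination ℂ fun n => Finsupp.single n (fourier n s)

theorem translate_zero : translate 0 = LinearMap.id := by
  ext n : 1
  ext
  simp [translate]

theorem trigPoly_translate (s : 𝕋) (c : ℤ →₀ ℂ) (t : 𝕋) :
    trigPoly (translate s c) t = trigPoly c (t + s) := by
  induction c using Finsupp.induction_linear with
  | zero => simp
  | add c d hc hd => simp only [map_add, ContinuousMap.add_apply, hc, hd]
  | single n a =>
    have hadd : fourier n (t + s) = fourier n t * fourier n s := by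
      simp only [fourier_apply, smul_add, AddCircle.toCircle_add, Circle.coe_mul]
    simp only [translate, Finsupp.linearCombination_single, map_smul, trigPoly_single,
      ContinuousMap.smul_apply, hadd, smul_eq_mul]
    ring

theorem norm_trigSpace_translate (hX : IsBanachFunctionSpace X) (hri : IsRearrangementInvariant X)
    (s : 𝕋) (c : ℤ →₀ ℂ) : ‖trigSpace hX (translate s c)‖ = ‖trigSpace hX c‖ := by
  refine enorm_eq_iff_norm_eq.1 ?_
  rw [enorm_trigSpace, enorm_trigSpace, ← hri.fnrm_translate (trigPoly c) s]
  congr 1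
  ext t
  exact trigPoly_translate s c t

/-- The Fourier multiplier with symbol `w` on the trigonometric polynomials. -/
def fourierMultiplier (w : ℤ → ℂ) : (ℤ →₀ ℂ) →ₗ[ℂ] C(𝕋, ℂ) :=
  Finsupp.linearCombination ℂ fun n => w n • fourier n

theorem fourierCoeff_fourierMultiplier (w : ℤ → ℂ) (c : ℤ →₀ ℂ) (n : ℤ) :
    fourierCoeff (fourierMultiplier w c) n = c n * w n := by
  induction c using Finsupp.induction_linear with
  | zero => simp [fourierCoeff]
  | add c d hc hd =>
    rw [map_add, ContinuousMap.coe_add, fourierCoeff.add (integrable_continuousMap _)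
      (integrable_continuousMap _), Pi.add_apply, hc, hd, Finsupp.add_apply, add_mul]
  | single k a =>
    rw [fourierMultiplier, Finsupp.linearCombination_single, ContinuousMap.coe_smul,
      ContinuousMap.coe_smul, fourierCoeff.const_smul, fourierCoeff.const_smul,
      fourierCoeff_fourier, Finsupp.single_apply, Pi.single_apply]
    by_cases h : k = n
    · simp [h]
    · simp [h, Ne.symm h]

theorem fourierMultiplier_apply (φ : (ℤ →₀ ℂ) →ₗ[ℂ] ℂ) (c : ℤ →₀ ℂ) (s : 𝕋) :
    fourierMultiplier (fun n => φ (Finsupp.single n 1)) c s = φ (translate s c) := by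
  induction c using Finsupp.induction_linear with
  | zero => simp
  | add c d hc hd => simp only [map_add, ContinuousMap.add_apply, hc, hd]
  | single n a =>
    have hsingle : Finsupp.single n (fourier n s) = fourier n s • Finsupp.single n (1 : ℂ) := by
      simp
    simp only [translate, fourierMultiplier, Finsupp.linearCombination_single, map_smul, hsingle,
      ContinuousMap.smul_apply, smul_eq_mul]
    ring

theorem continuous_fourierCoeff_continuousMap (n : ℤ) :
    Continuous fun g : C(𝕋, ℂ) => fourierCoeff g n := by
  refine ((fourierCoeffL1 n).continuous.comp
    (ContinuousMap.toLp (E := ℂ) 1 m ℂ).continuous).congr fun g => ?_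
  exact congrFun (fourierCoeff_congr_ae (ContinuousMap.coeFn_toLp m g)) n

/-- `Ψ f` is the function `s ↦ φ (f (· + s))`. -/
theorem exists_translation_transform [TopologicalSpace.SeparableSpace X.space]
    (hX : IsBanachFunctionSpace X) (hri : IsRearrangementInvariant X) (hL : EmbedsInL1 X)
    (φ : X.space →L[ℂ] ℂ) :
    ∃ Ψ : X.space →L[ℂ] C(𝕋, ℂ), (∀ f, Ψ f 0 = φ f) ∧ ∀ f n, fourierCoeff (Ψ f) n =
      fourierCoeff (f : L0) n * φ (trigSpace hX (Finsupp.single n 1)) := by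
  set S := fourierMultiplier fun n => φ (trigSpace hX (Finsupp.single n 1)) with hS
  have hSφ (c s) : S c s = φ (trigSpace hX (translate s c)) :=
    fourierMultiplier_apply (φ.toLinearMap ∘ₗ trigSpace hX) c s
  have hbound : ∃ K, ∀ c, ‖S c‖ ≤ K * ‖trigSpace hX c‖ := by
    refine ⟨‖φ‖, fun c => (ContinuousMap.norm_le _ (by positivity)).2 fun s => ?_⟩
    rw [hSφ, ← norm_trigSpace_translate hX hri s]
    exact φ.le_opNorm _
  have hdense := denseRange_trigSpace hX
  have hext := LinearMap.extendOfNorm_eq hdense hbound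
  set Ψ := S.extendOfNorm (trigSpace hX)
  refine ⟨Ψ, congrFun (hdense.equalizer (g := fun f => Ψ f 0)
    ((continuous_eval_const 0).comp Ψ.continuous) φ.continuous (funext fun c => ?_)), fun f n =>
    congrFun (hdense.equalizer (g := fun f => fourierCoeff (Ψ f) n)
      ((continuous_fourierCoeff_continuousMap n).comp Ψ.continuous)
      ((hL.coeff n).continuous.mul continuous_const) (funext fun c => ?_)) f⟩
  · simp only [Function.comp_apply]
    rw [hext, hSφ, translate_zero, LinearMap.id_apply]
  · simp only [Function.comp_apply]
    rw [hext, Pi.mul_apply, hL.coeff_apply, fourierCoeff_trigSpace, hS,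
      fourierCoeff_fourierMultiplier]

theorem eq_zero_of_hardyχ [TopologicalSpace.SeparableSpace X.space] (hX : IsBanachFunctionSpace X)
    (hri : IsRearrangementInvariant X) (hL : EmbedsInL1 X) {E : Type*} [NormedAddCommGroup E]
    [NormedSpace ℂ E] {B : hardy X →L[ℂ] E} (hB : ∀ j : ℕ, B (hardyχ hX j) = 0) : B = 0 := by
  ext f
  refine SeparatingDual.eq_zero_of_forall_dual_eq_zero (R := ℂ) fun ψ => ?_
  obtain ⟨φ, hφ, -⟩ := exists_extension_norm_eq (hardy X) (ψ.comp B)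
  obtain ⟨Ψ, hΨ0, hΨ⟩ := exists_translation_transform hX hri hL φ
  have hcoeff (n : ℤ) : fourierCoeff (Ψ f) n = 0 := by
    rw [hΨ]
    obtain hn | hn := lt_or_ge n 0
    · rw [f.2.2 n hn, zero_mul]
    · lift n to ℕ using hn
      have hχ : trigSpace hX (Finsupp.single (n : ℤ) 1) = (hardyχ hX n : X.space) :=
        Subtype.ext (coe_trigSpace_single hX n)
      rw [hχ, hφ]
      simp [hB]
  have hΨf : ⇑(Ψ f) = 0 := (Continuous.ae_eq_iff_eq m (Ψ f).continuous continuous_zero).1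
    (ae_eq_zero_of_fourierCoeff (integrable_continuousMap _) hcoeff)
  calc ψ (B f) = φ f := (hφ f).symm
    _ = Ψ f 0 := (hΨ0 f).symm
    _ = 0 := congrFun hΨf 0

/-! ### Symbols of operators with a Toeplitz matrix -/

theorem IsBanachFunctionSpace.fnrm_fourier_mul (hX : IsBanachFunctionSpace X) (n : ℤ)
    (hf : AEStronglyMeasurable f m) : X.fnrm (fun t => fourier n t * f t) = X.fnrm f :=
  hX.fnrm_congr_norm hf ((aestronglyMeasurable_continuousMap (fourier n)).mul hf) <|
    .of_forall fun t => by rw [norm_mul, norm_fourier_apply, one_mul]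

theorem fourierCoeff_χ (n k : ℤ) : fourierCoeff (χ n : L0) k = if k = n then 1 else 0 := by
  rw [fourierCoeff_congr_ae (coeFn_χ n), fourierCoeff_fourier, Pi.single_apply]

/-- The analytic polynomial `χₙ f`, for the trigonometric polynomial `f` with coefficients `d`.
This is meaningful only if `d` is supported in `[-n, ∞)`, because of the truncation `Int.toNat`. -/
def shiftedPoly (hX : IsBanachFunctionSpace X) (n : ℤ) : (ℤ →₀ ℂ) →ₗ[ℂ] hardy X :=
  Finsupp.linearCombination ℂ fun j => hardyχ hX (j + n).toNat

theorem map_shiftedPoly (hX : IsBanachFunctionSpace X) (φ : hardy X →L[ℂ] ℂ) (n : ℤ)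
    (d : ℤ →₀ ℂ) :
    φ (shiftedPoly hX n d) = d.sum fun j z => z * φ (hardyχ hX (j + n).toNat) := by
  simp [shiftedPoly, Finsupp.linearCombination_apply, map_finsuppSum]

theorem coeFn_shiftedPoly (hX : IsBanachFunctionSpace X) (hL : EmbedsInL1 X) {n : ℤ}
    {d : ℤ →₀ ℂ} (hd : ∀ j ∈ d.support, 0 ≤ j + n) :
    (((shiftedPoly hX n d : X.space) : L0) : 𝕋 → ℂ) =ᵐ[m] fun t => fourier n t * trigPoly d t := by
  have hi : Integrable (fun t => fourier n t * trigPoly d t) m := by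
    have h := integrable_continuousMap (fourier n * trigPoly d)
    rwa [ContinuousMap.coe_mul] at h
  refine ae_eq_of_fourierCoeff (hL.integrable _) hi fun k => ?_
  have hterm (j) (hj : j ∈ d.support) :
      d j * fourierCoeff ((hardyχ hX (j + n).toNat : X.space) : L0) k =
        if j = k - n then d j else 0 := by
    rw [hardyχ, fourierCoeff_χ, Int.toNat_of_nonneg (hd j hj)]
    simp only [mul_ite, mul_one, mul_zero, eq_sub_iff_add_eq, eq_comm]
  calc fourierCoeff ((shiftedPoly hX n d : X.space) : L0) k
      = d.sum fun j z => z * fourierCoeff ((hardyχ hX (j + n).toNat : X.space) : L0) k := by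
        simpa only [ContinuousLinearMap.comp_apply, Submodule.subtypeL_apply, hL.coeff_apply]
          using map_shiftedPoly hX ((hL.coeff k).comp (hardy X).subtypeL) n d
    _ = d (k - n) := by
        rw [Finsupp.sum, Finset.sum_congr rfl hterm, Finset.sum_ite_eq', ite_eq_left_iff]
        exact fun h => (Finsupp.notMem_support_iff.1 h).symm
    _ = fourierCoeff (fun t => fourier n t * trigPoly d t) k := by
        rw [fourierCoeff_fourier_mul, fourierCoeff_trigPoly]

theorem enorm_shiftedPoly (hX : IsBanachFunctionSpace X) (hL : EmbedsInL1 X) {n : ℤ}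
    {d : ℤ →₀ ℂ} (hd : ∀ j ∈ d.support, 0 ≤ j + n) :
    ‖shiftedPoly hX n d‖ₑ = X.fnrm (trigPoly d) := by
  calc ‖shiftedPoly hX n d‖ₑ = ‖(shiftedPoly hX n d : X.space)‖ₑ := rfl
    _ = X.fnrm (trigPoly d) := by
      rw [enorm_eq_fnrm _ (coeFn_shiftedPoly hX hL hd),
        hX.fnrm_fourier_mul n (aestronglyMeasurable_continuousMap _)]

theorem exists_forall_mem_support_le_add (d : ℤ →₀ ℂ) :
    ∃ N : ℕ, ∀ j ∈ d.support, 0 ≤ j + N := by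
  refine ⟨∑ j ∈ d.support, j.natAbs, fun j hj => ?_⟩
  have := Finset.single_le_sum (f := Int.natAbs) (fun _ _ => Nat.zero_le _) hj
  omega

/-- The matrix of `A` in the bases `χ₀, χ₁, …` is the Toeplitz matrix `(c (k - j))`, where `j`
numbers the columns. -/
def HasToeplitzMatrix (hX : IsBanachFunctionSpace X) (A : hardy X →L[ℂ] hardy Y) (c : ℤ → ℂ) :
    Prop :=
  ∀ j k : ℕ, fourierCoeff ((A (hardyχ hX j) : Y.space) : L0) k = c ((k : ℤ) - (j : ℤ))

/-- The Laurent operator with coefficients `c` is the limit of the operators `χ₋ₙ A χₙ`. -/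
theorem HasToeplitzMatrix.exists_laurent {hX : IsBanachFunctionSpace X}
    {A : hardy X →L[ℂ] hardy Y} {c : ℤ → ℂ} (hA : HasToeplitzMatrix hX A c) (hLX : EmbedsInL1 X)
    (hY : IsBanachFunctionSpace Y) (hYri : IsRearrangementInvariant Y)
    (hB : HasNontrivialBoydIndices Y) (hF : HasFatouProperty Y) (d : ℤ →₀ ℂ) :
    ∃ g : 𝕋 → ℂ, Y.fnrm g ≤ ‖A‖ₑ * X.fnrm (trigPoly d) ∧
      ∀ k, fourierCoeff g k = d.sum fun j z => z * c (k - j) := by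
  obtain ⟨N, hN⟩ := exists_forall_mem_support_le_add d
  have hd (n : ℕ) (j) (hj : j ∈ d.support) : 0 ≤ j + ((N + n : ℕ) : ℤ) := by
    have := hN j hj
    omega
  let b (n : ℕ) (t : 𝕋) : ℂ :=
    fourier (-(N + n : ℕ)) t * ((A (shiftedPoly hX (N + n : ℕ) d) : Y.space) : L0) t
  refine hY.exists_fourierCoeff_eq_of_tendsto hYri hB hF (l := atTop) (b := b)
    (fun n => (aestronglyMeasurable_continuousMap _).mul (AEEqFun.aestronglyMeasurable _))
    (ENNReal.mul_ne_top enorm_ne_top (hX.fnrm_continuousMap_lt_top _).ne)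
    (fun n => ?_) fun k => tendsto_const_nhds.congr' ?_
  · rw [hY.fnrm_fourier_mul _ (AEEqFun.aestronglyMeasurable _), ← enorm_shiftedPoly hX hLX (hd n),
      fnrm_coe, ← enorm_eq_nrm]
    exact A.le_opENorm _
  · filter_upwards [eventually_ge_atTop k.natAbs] with n hn
    obtain ⟨l, hl⟩ : ∃ l : ℕ, k - -((N + n : ℕ) : ℤ) = l := Int.eq_ofNat_of_zero_le (by omega)
    have hmap : fourierCoeff ((A (shiftedPoly hX (N + n : ℕ) d) : Y.space) : L0) l =
        d.sum fun j z => z * fourierCoeff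
          ((A (hardyχ hX (j + (N + n : ℕ)).toNat) : Y.space) : L0) l := by
      simpa only [ContinuousLinearMap.comp_apply, Submodule.subtypeL_apply,
        EmbedsInL1.coeff_apply] using map_shiftedPoly hX
          (((hY.embedsInL1 hYri hB).coeff l).comp ((hardy Y).subtypeL.comp A)) (N + n : ℕ) d
    rw [fourierCoeff_fourier_mul, hl, hmap]
    refine Finset.sum_congr rfl fun j hj => congrArg (d j * ·) ?_
    rw [hA, Int.toNat_of_nonneg (hd n j hj), ← hl]
    congr 1
    ring

variable {hX : IsBanachFunctionSpace X} {A : hardy X →L[ℂ] hardy Y} {a : L0} {c : ℤ → ℂ}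

theorem HasToeplitzMatrix.exists_fnrm_mul_trigPoly_le (hA : HasToeplitzMatrix hX A c)
    (hLX : EmbedsInL1 X) (hY : IsBanachFunctionSpace Y) (hYri : IsRearrangementInvariant Y)
    (hB : HasNontrivialBoydIndices Y) (hF : HasFatouProperty Y) :
    ∃ a ∈ Y.space, (∀ n, fourierCoeff (a : L0) n = c n) ∧
      ∀ d, Y.fnrm (fun t => a t * trigPoly d t) ≤ ‖A‖ₑ * X.fnrm (trigPoly d) := by
  have hLY := hY.embedsInL1 hYri hB
  have htop (d : ℤ →₀ ℂ) : ‖A‖ₑ * X.fnrm (trigPoly d) < ∞ :=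
    ENNReal.mul_lt_top enorm_lt_top (hX.fnrm_continuousMap_lt_top _)
  obtain ⟨a₀, ha₀, hcoeff₀⟩ := hA.exists_laurent hLX hY hYri hB hF (Finsupp.single 0 1)
  let a : Y.space := Y.toSpace a₀ (ha₀.trans_lt (htop _))
  have hcoeff (n) : fourierCoeff (a : L0) n = c n := by
    rw [fourierCoeff_congr_ae (coeFn_toSpace _), hcoeff₀]
    simp
  refine ⟨a, a.2, hcoeff, fun d => ?_⟩
  obtain ⟨g, hg, hgcoeff⟩ := hA.exists_laurent hLX hY hYri hB hF d
  have hga : g =ᵐ[m] fun t => trigPoly d t * (a : L0) t :=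
    ae_eq_of_fourierCoeff (hLY.integrable_of_fnrm_lt_top (hg.trans_lt (htop d)))
      (integrable_trigPoly_mul (hLY.integrable a) d) fun k => by
        simp only [hgcoeff, fourierCoeff_trigPoly_mul (hLY.integrable a), hcoeff]
  simpa only [mul_comm, fnrm_congr hga] using hg

theorem fnrm_mul_le_of_forall_trigPoly [TopologicalSpace.SeparableSpace X.space]
    (hX : IsBanachFunctionSpace X) (hLX : EmbedsInL1 X) (hY : IsBanachFunctionSpace Y)
    (hF : HasFatouProperty Y) {K : ℝ≥0∞} (hK : K ≠ ∞)
    (h : ∀ d, Y.fnrm (fun t => a t * trigPoly d t) ≤ K * X.fnrm (trigPoly d)) (f : X.space) :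
    Y.fnrm (fun t => a t * (f : L0) t) ≤ K * ‖f‖ₑ := by
  refine le_of_forall_gt_imp_ge_of_dense fun r hr => ?_
  obtain ⟨u, hu, hlim⟩ := mem_closure_iff_seq_limit.1 (denseRange_trigSpace hX f)
  choose d hd using hu
  obtain ⟨N, hN⟩ := eventually_atTop.1
    ((ENNReal.Tendsto.const_mul hlim.enorm (.inr hK)).eventually_lt_const hr)
  obtain ⟨ns, -, hae⟩ := hLX.exists_seq_tendsto_ae ((tendsto_add_atTop_iff_nat N).2 hlim)
  refine hY.fnrm_le_of_tendsto_ae hF (f := fun n t => a t * (u (ns n + N) : L0) t)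
    ((AEEqFun.aestronglyMeasurable _).mul (AEEqFun.aestronglyMeasurable _))
    (fun _ => (AEEqFun.aestronglyMeasurable _).mul (AEEqFun.aestronglyMeasurable _))
    (hae.mono fun t ht => ht.const_mul _) fun n => ?_
  calc Y.fnrm (fun t => a t * (u (ns n + N) : L0) t)
      = Y.fnrm (fun t => a t * trigPoly (d (ns n + N)) t) := by
        rw [← hd]
        exact fnrm_congr ((coeFn_trigSpace hX _).mono fun t ht => congrArg (a t * ·) ht)
    _ ≤ K * ‖u (ns n + N)‖ₑ := by
        rw [← hd, enorm_trigSpace]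
        exact h _
    _ ≤ r := (hN _ (Nat.le_add_left _ _)).le

theorem mem_multipliers_and_multiplierNorm_le {K : ℝ≥0∞} (hK : K ≠ ∞)
    (h : ∀ f : X.space, Y.fnrm (fun t => a t * (f : L0) t) ≤ K * ‖f‖ₑ) :
    a ∈ multipliers X Y ∧ multiplierNorm X Y a ≤ K := by
  have hnrm (g) (hg : g ∈ X.space) : Y.nrm (a * g) ≤ K * X.nrm g := by
    rw [← fnrm_coe, fnrm_congr (AEEqFun.coeFn_mul a g)]
    exact (h ⟨g, hg⟩).trans_eq (congrArg (K * ·) (enorm_eq_nrm _))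
  refine ⟨fun g hg => (hnrm g hg).trans_lt (ENNReal.mul_lt_top hK.lt_top hg),
    iSup₂_le fun g hg => ?_⟩
  exact (hnrm g (hg.trans_lt ENNReal.one_lt_top)).trans (mul_le_of_le_one_right' hg)

theorem HasToeplitzMatrix.exists_symbol [TopologicalSpace.SeparableSpace X.space]
    (hA : HasToeplitzMatrix hX A c) (hLX : EmbedsInL1 X) (hY : IsBanachFunctionSpace Y)
    (hYri : IsRearrangementInvariant Y) (hB : HasNontrivialBoydIndices Y)
    (hF : HasFatouProperty Y) :
    ∃ a ∈ multipliers X Y, multiplierNorm X Y a ≤ ENNReal.ofReal ‖A‖ ∧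
      a ∈ Y.space ∧ ∀ n, fourierCoeff (a : L0) n = c n := by
  obtain ⟨a, haY, hcoeff, hle⟩ := hA.exists_fnrm_mul_trigPoly_le hLX hY hYri hB hF
  obtain ⟨ha, hnorm⟩ := mem_multipliers_and_multiplierNorm_le enorm_ne_top
    (fnrm_mul_le_of_forall_trigPoly hX hLX hY hF enorm_ne_top hle)
  exact ⟨a, ha, hnorm.trans_eq (ofReal_norm A).symm, haY, hcoeff⟩

/-! ### Toeplitz operators -/

theorem fourierCoeff_mul_χ (a : L0) (j k : ℤ) :
    fourierCoeff (a * χ j : L0) k = fourierCoeff (a : L0) (k - j) := by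
  rw [← fourierCoeff_fourier_mul]
  refine congrFun (fourierCoeff_congr_ae ?_) k
  filter_upwards [AEEqFun.coeFn_mul a (χ j), coeFn_χ j] with t hmul hχ
  rw [hmul, Pi.mul_apply, hχ, mul_comm]

theorem IsToeplitz.hasToeplitzMatrix (h : IsToeplitz a A) (hX : IsBanachFunctionSpace X) :
    HasToeplitzMatrix hX A (fourierCoeff a) := fun j k => by
  rw [(h (hardyχ hX j)).2.2, if_pos (Int.natCast_nonneg k)]
  exact fourierCoeff_mul_χ a j k

theorem HasToeplitzMatrix.isToeplitz [TopologicalSpace.SeparableSpace X.space]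
    (hA : HasToeplitzMatrix hX A (fourierCoeff a)) (hXri : IsRearrangementInvariant X)
    (hLX : EmbedsInL1 X) (hY : IsBanachFunctionSpace Y) (hLY : EmbedsInL1 Y)
    {P : Y.space →L[ℂ] Y.space} (hP : IsRieszProjection P) (ha : a ∈ multipliers X Y) :
    IsToeplitz a A := by
  set M := mulCLM hX hY ha
  have hzero : (hardy Y).subtypeL.comp A - (P.comp M).comp (hardy X).subtypeL = 0 := by
    refine eq_zero_of_hardyχ hX hXri hLX fun j => sub_eq_zero.2 (hLY.ext fun k => ?_)
    change fourierCoeff ((A (hardyχ hX j) : Y.space) : L0) k =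
      fourierCoeff ((P (M (hardyχ hX j : X.space)) : Y.space) : L0) k
    rw [(hP _).2.2]
    split_ifs with hk
    · lift k to ℕ using hk
      rw [hA]
      exact (fourierCoeff_mul_χ a j k).symm
    · exact (A (hardyχ hX j)).2.2 k (not_le.1 hk)
  intro f
  have hf : (A f : Y.space) = P (M f) := sub_eq_zero.1 (DFunLike.congr_fun hzero f)
  rw [hf]
  exact hP (M f)

theorem enorm_mulCLM_le (hX : IsBanachFunctionSpace X) (hY : IsBanachFunctionSpace Y)
    (ha : a ∈ multipliers X Y) : ‖mulCLM hX hY ha‖ₑ ≤ multiplierNorm X Y a := by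
  refine ContinuousLinearMap.opENorm_le_bound _ fun g => ?_
  rw [enorm_eq_nrm, enorm_eq_nrm]
  exact nrm_mul_le_multiplierNorm_mul g.2

theorem exists_isToeplitz (hX : IsBanachFunctionSpace X) (hY : IsBanachFunctionSpace Y)
    {P : Y.space →L[ℂ] Y.space} (hP : IsRieszProjection P) (ha : a ∈ multipliers X Y) :
    ∃ T : hardy X →L[ℂ] hardy Y, IsToeplitz a T ∧
      ENNReal.ofReal ‖T‖ ≤ ENNReal.ofReal ‖P‖ * multiplierNorm X Y a := by
  set M := mulCLM hX hY ha
  let T : hardy X →L[ℂ] hardy Y := ((P.comp M).comp (hardy X).subtypeL).codRestrict (hardy Y)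
    fun f => ⟨(hP _).2.1, fun n hn => ((hP (M f)).2.2 n).trans (if_neg (not_le.2 hn))⟩
  refine ⟨T, fun f => hP (M f), ?_⟩
  rw [ofReal_norm P]
  refine (ofReal_norm T).trans_le ?_
  refine ContinuousLinearMap.opENorm_le_bound _ fun f => ?_
  calc ‖T f‖ₑ = ‖P (M f)‖ₑ := rfl
    _ ≤ ‖P‖ₑ * (‖M‖ₑ * ‖f‖ₑ) :=
        (P.le_opENorm _).trans (mul_le_mul_right (M.le_opENorm (f : X.space)) _)
    _ ≤ ‖P‖ₑ * multiplierNorm X Y a * ‖f‖ₑ := by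
        rw [← mul_assoc]
        gcongr
        exact enorm_mulCLM_le hX hY ha

theorem mem_space_of_mem_multipliers (hX : IsBanachFunctionSpace X) (ha : a ∈ multipliers X Y) :
    a ∈ Y.space := by
  have hone : (1 : L0) ∈ X.space := hX.linfty_subset 1 ⟨1, by
    filter_upwards [AEEqFun.coeFn_one (α := 𝕋) (μ := m) (β := ℂ)] with t ht
    simp [ht]⟩
  simpa using ha 1 hone

theorem IsToeplitz.multiplierNorm_le [TopologicalSpace.SeparableSpace X.space]
    (h : IsToeplitz a A) (ha : a ∈ multipliers X Y) (hX : IsBanachFunctionSpace X)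
    (hLX : EmbedsInL1 X) (hY : IsBanachFunctionSpace Y) (hYri : IsRearrangementInvariant Y)
    (hB : HasNontrivialBoydIndices Y) (hF : HasFatouProperty Y) :
    multiplierNorm X Y a ≤ ENNReal.ofReal ‖A‖ := by
  obtain ⟨b, -, hle, hbY, hcoeff⟩ := (h.hasToeplitzMatrix hX).exists_symbol hLX hY hYri hB hF
  have hab : (⟨a, mem_space_of_mem_multipliers hX ha⟩ : Y.space) = ⟨b, hbY⟩ :=
    (hY.embedsInL1 hYri hB).ext fun n => (hcoeff n).symm
  rwa [Subtype.mk.inj hab]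

end BrownHalmos

end

open BrownHalmos in
theorem theorem4p2_general (X Y : FunctionSpace)
    (hX : IsBanachFunctionSpace X) (hY : IsBanachFunctionSpace Y)
    (hXri : IsRearrangementInvariant X) (hYri : IsRearrangementInvariant Y)
    (hXsep : TopologicalSpace.SeparableSpace X.space)
    (hXY : X.space ≤ Y.space)
    (hYBoyd : HasNontrivialBoydIndices Y) (hYFatou : HasFatouProperty Y) :
    ∃ P : Y.space →L[ℂ] Y.space, IsRieszProjection P ∧
      (∀ (A : hardy X →L[ℂ] hardy Y) (c : ℤ → ℂ),
        (∀ j k : ℕ, pairing ((A (hardyχ hX j) : Y.space) : L0) (χ k) = c ((k : ℤ) - (j : ℤ))) ↔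
          ∃ a ∈ multipliers X Y, IsToeplitz a A ∧ ∀ n : ℤ, fourierCoeff a n = c n) ∧
      (∀ a ∈ multipliers X Y, ∃ T : hardy X →L[ℂ] hardy Y, IsToeplitz a T ∧
        multiplierNorm X Y a ≤ ENNReal.ofReal ‖T‖ ∧
        ENNReal.ofReal ‖T‖ ≤ ENNReal.ofReal ‖P‖ * multiplierNorm X Y a) := by
  have hLY := hY.embedsInL1 hYri hYBoyd
  have hLX := hLY.of_le hX hY hXY
  obtain ⟨P, hP⟩ := hY.exists_isRieszProjection hYri hYBoyd hYFatou
  refine ⟨P, hP, fun A c => ?_, fun a ha => ?_⟩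
  · simp only [pairing_χ]
    constructor
    · intro (hA : HasToeplitzMatrix hX A c)
      obtain ⟨a, ha, -, -, hac⟩ := hA.exists_symbol hLX hY hYri hYBoyd hYFatou
      obtain rfl : fourierCoeff a = c := funext hac
      exact ⟨a, ha, hA.isToeplitz hXri hLX hY hLY hP ha, hac⟩
    · rintro ⟨a, -, hT, hac⟩ j k
      rw [hT.hasToeplitzMatrix hX, hac]
  · obtain ⟨T, hT, hTP⟩ := exists_isToeplitz hX hY hP ha
    exact ⟨T, hT, hT.multiplierNorm_le ha hX hLX hY hYri hYBoyd hYFatou, hTP⟩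

open BrownHalmos in
theorem theorem4p2 (X Y : FunctionSpace)
    (hX : IsBanachFunctionSpace X) (hY : IsBanachFunctionSpace Y)
    (hXri : IsRearrangementInvariant X) (hYri : IsRearrangementInvariant Y)
    (hXsep : TopologicalSpace.SeparableSpace X.space)
    (hYsep : TopologicalSpace.SeparableSpace Y.space)
    (hXY : X.space ≤ Y.space)
    (hYBoyd : HasNontrivialBoydIndices Y) (hYFatou : HasFatouProperty Y) :
    ∃ P : Y.space →L[ℂ] Y.space, IsRieszProjection P ∧
      (∀ (A : hardy X →L[ℂ] hardy Y) (c : ℤ → ℂ),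
        (∀ j k : ℕ, pairing ((A (hardyχ hX j) : Y.space) : L0) (χ k) = c ((k : ℤ) - (j : ℤ))) ↔
          ∃ a ∈ multipliers X Y, IsToeplitz a A ∧ ∀ n : ℤ, fourierCoeff a n = c n) ∧
      (∀ a ∈ multipliers X Y, ∃ T : hardy X →L[ℂ] hardy Y, IsToeplitz a T ∧
        multiplierNorm X Y a ≤ ENNReal.ofReal ‖T‖ ∧
        ENNReal.ofReal ‖T‖ ≤ ENNReal.ofReal ‖P‖ * multiplierNorm X Y a) :=
  theorem4p2_general X Y hX hY hXri hYri hXsep hXY hYBoyd hYFatou
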